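/- Work over a field $k$ of characteristic zero. For a finite set $S$ let $\mathrm{Gr}(S)$ be the vector space with basis the $S$-graphs, i.e. the oriented graphs with vertex set $S$ whose underlying unoriented graph is connected and acyclic. A graph quotient $\phi:G\twoheadrightarrow K$ is a map from the vertices of $G$ to the vertices of $K$ which sends every edge of $G$ to an edge of $K$ (with the same orientation) or to a vertex of $K$, and for which the inverse image $\phi^{-1}(v)$ of every vertex $v$ of $K$ is a non-empty connected subgraph of $G$. For a set $E$ of edges of $K$ let $\mathrm{rev}_E(K)$ be $K$ with the orientations of the edges in $E$ reversed. The anti-commutative graph cooperad $\mathcal{AC}\mathrm{Gr}$ is the symmetric sequence $\mathrm{Gr}$ with the cocomposition $$G\longmapsto\sum_{\phi:G\twoheadrightarrow K}\frac{1}{2^{\#\mathrm{Edge}(K)}}\sum_{E\subseteq \mathrm{Edge}(K)}(-1)^{|E|}\,\mathrm{rev}_E(K)\otimes\Bigl(\bigotimes_{v\in\mathrm{Vert}(K)}\phi^{-1}(v)\Bigr)$$ (the component for a partition of $S$ being the sum over the $\phi$ whose fibres are its blocks) and the map $\mathrm{Gr}(\mathrm{pt})\to k$ sending the one-vertex graph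 to $1$. Let $\mathrm{Eil}(S)$ be the quotient of $\mathrm{Gr}(S)$ by the span of the arrow-reversing expressions $G+\mathrm{rev}_{\{e\}}(G)$, $e$ an edge of $G$, and of the Arnold expressions $G_1+G_2+G_3$, where for distinct vertices $a,b,c$ the graphs $G_1,G_2,G_3$ contain the edges $a\to b\to c$, respectively $b\to c\to a$, respectively $c\to a\to b$, and otherwise have the same edges. Let $\mathrm{Lie}(S)$ be the vector space spanned by rooted planar binary trees with leaves labelled bijectively by $S$, modulo anti-symmetry $R[T_1T_2]+R[T_2T_1]$ and Jacobi $R[(T_1T_2)T_3]+R[(T_2T_3)T_1]+R[(T_3T_1)T_2]$ at any place $R$ of a tree; it is an operad under grafting, and $\mathrm{Lie}^\vee$ is the linearly dual cooperad, $\mathrm{Lie}^\vee(S)=\mathrm{Lie}(S)^*$. Theorem. The cocomposition of $\mathcal{AC}\mathrm{Gr}$ is equivariant and coassociative, and $\mathrm{Lie}^\vee$ is a (counital) cooperad. The symmetric sequence $\mathrm{Eil}$ inherits from $\mathcal{AC}\mathrm{Gr}$ the structure of a (counital) cooperad, i.e. it has one for which the quotient map $\mathcal{AC}\mathrm{Gr}\to\mathrm{Eil}$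 commutes with the cocompositions and counits. As cooperads, $\mathrm{Eil}\cong\mathrm{Lie}^\vee$. The composite of this isomorphism with the quotient map is a surjection $\mathcal{AC}\mathrm{Gr}\to\mathrm{Lie}^\vee$ of symmetric sequences which commutes with the cocompositions and counits. -/

import Mathlib

open scoped TensorProduct

universe u

noncomputable section

namespace GraphCooperad

/-! ### Symmetric sequences and cooperads

A symmetric sequence is a functor from finite sets and bijections to vector spaces.  The structure
map of a cooperad has one component for every map `p : S → K` of finite sets (for sequences which
vanish on the empty set, as all those below do, only the surjective `p`, that is the partitions of
`S`, matter). -/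

/-- The fibre of `p` over `k`. -/
abbrev Fib {S K : Type} (p : S → K) (k : K) : Type := {s : S // p s = k}

/-- A bijection of maps of sets induces bijections of the fibres. -/
def fibEquiv {S S' K K' : Type} (e : S ≃ S') (f : K ≃ K') (p : S → K) (p' : S' → K')
    (h : ∀ s, p' (e s) = f (p s)) (k' : K') : Fib p (f.symm k') ≃ Fib p' k' :=
  e.subtypeEquiv fun s => by rw [h, Equiv.eq_symm_apply]

/-- The map from the fibre of `q ∘ p` over `l` to the fibre of `q` over `l` given by `p`. -/
def restr {S K L : Type} (p : S → K) (q : K → L) (l : L) : Fib (q ∘ p) l → Fib q l :=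
  fun s => ⟨p s.1, s.2⟩

/-- The fibres of the restrictions of `p` are fibres of `p`. -/
def fibRestrEquiv {S K L : Type} (p : S → K) (q : K → L) (l : L) (k : Fib q l) :
    Fib p k.1 ≃ Fib (restr p q l) k where
  toFun s := ⟨⟨s.1, by rw [Function.comp_apply, s.2]; exact k.2⟩, Subtype.ext s.2⟩
  invFun s := ⟨s.1.1, congrArg Subtype.val s.2⟩
  left_inv _ := rfl
  right_inv _ := rfl

/-- The fibre of the map to a point is the whole set. -/
def fibUnitEquiv (S : Type) : Fib (fun _ : S => ()) () ≃ S :=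
  Equiv.subtypeUnivEquiv fun _ => rfl

/-- The fibres of the identity are points. -/
def fibIdEquiv {S : Type} (s : S) : Fib (id : S → S) s ≃ Unit where
  toFun _ := ()
  invFun _ := ⟨s, rfl⟩
  left_inv x := Subtype.ext x.2.symm
  right_inv _ := rfl

/-- Symmetric sequences of vector spaces. -/
structure SymSeq (𝕜 : Type u) [Field 𝕜] where
  obj : (S : Type) → [Finite S] → Type u
  [acg : ∀ (S : Type) [Finite S], AddCommGroup (obj S)]
  [mod : ∀ (S : Type) [Finite S], Module 𝕜 (obj S)]
  map : ∀ {S T : Type} [Finite S] [Finite T], (S ≃ T) → (obj S →ₗ[𝕜] obj T)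
  map_refl : ∀ (S : Type) [Finite S], map (Equiv.refl S) = LinearMap.id
  map_trans : ∀ {S T U : Type} [Finite S] [Finite T] [Finite U] (e : S ≃ T) (f : T ≃ U),
    map (e.trans f) = map f ∘ₗ map e

attribute [instance] SymSeq.acg SymSeq.mod

variable {𝕜 : Type u} [Field 𝕜]

/-- Morphisms of symmetric sequences. -/
structure SymSeq.Hom (C D : SymSeq 𝕜) where
  app : ∀ (S : Type) [Finite S], C.obj S →ₗ[𝕜] D.obj S
  natural : ∀ {S T : Type} [Finite S] [Finite T] (e : S ≃ T),
    app T ∘ₗ C.map e = D.map e ∘ₗ app S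

/-- Composition of morphisms of symmetric sequences. -/
def SymSeq.Hom.comp {C D E : SymSeq 𝕜} (g : SymSeq.Hom D E) (f : SymSeq.Hom C D) :
    SymSeq.Hom C E where
  app S _ := g.app S ∘ₗ f.app S
  natural e := by
    rw [LinearMap.comp_assoc, f.natural, ← LinearMap.comp_assoc, g.natural, LinearMap.comp_assoc]

/-- The structure maps of a cooperad: the cocomposition and the counit. -/
structure CooperadStr (C : SymSeq 𝕜) where
  cocomp : ∀ {S K : Type} [Finite S] [Finite K] (p : S → K),
    C.obj S →ₗ[𝕜] C.obj K ⊗[𝕜] (⨂[𝕜] k : K, C.obj (Fib p k))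
  counit : C.obj Unit →ₗ[𝕜] 𝕜

/-- The structure maps of an operad: the composition and the unit. -/
structure OperadStr (P : SymSeq 𝕜) where
  comp : ∀ {S K : Type} [Finite S] [Finite K] (p : S → K),
    P.obj K ⊗[𝕜] (⨂[𝕜] k : K, P.obj (Fib p k)) →ₗ[𝕜] P.obj S
  one : P.obj Unit

theorem group_update {K L : Type} [DecidableEq K] [DecidableEq L] (q : K → L) (M : K → Type u)
    [∀ k, AddCommGroup (M k)] [∀ k, Module 𝕜 (M k)] (m : ∀ k, M k) (k : K) (z : M k) :
    (fun l => PiTensorProduct.tprod 𝕜 fun k' : Fib q l => Function.update m k z k'.1) =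
      Function.update (fun l => PiTensorProduct.tprod 𝕜 fun k' : Fib q l => m k'.1) (q k)
        (PiTensorProduct.tprod 𝕜
          (Function.update (fun k' : Fib q (q k) => m k'.1) ⟨k, rfl⟩ z)) := by
  funext l
  by_cases hl : l = q k
  · subst hl
    rw [Function.update_self]
    congr 1
    funext k'
    by_cases hk : k' = ⟨k, rfl⟩
    · subst hk; simp
    · have : k'.1 ≠ k := fun h => hk (Subtype.ext h)
      rw [Function.update_of_ne hk, Function.update_of_ne this]
  · rw [Function.update_of_ne hl]
    congr 1
    funext k'
    have : k'.1 ≠ k := fun h => hl (by rw [← k'.2, h])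
    rw [Function.update_of_ne this]

/-- Grouping the factors of a tensor product along a map of index sets:
`⨂_k m_k ↦ ⨂_l ⨂_{k ∈ q⁻¹(l)} m_k`. -/
def group {K L : Type} (q : K → L) (M : K → Type u) [∀ k, AddCommGroup (M k)]
    [∀ k, Module 𝕜 (M k)] :
    (⨂[𝕜] k : K, M k) →ₗ[𝕜] (⨂[𝕜] l : L, ⨂[𝕜] k : Fib q l, M k.1) :=
  PiTensorProduct.lift
    { toFun := fun m => PiTensorProduct.tprod 𝕜 fun l =>
        PiTensorProduct.tprod 𝕜 fun k : Fib q l => m k.1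
      map_update_add' := by
        intro _ m k x y
        classical
        simp only [group_update, MultilinearMap.map_update_add]
      map_update_smul' := by
        intro _ m k c x
        classical
        simp only [group_update, MultilinearMap.map_update_smul] }

/-- The interchange `(⨂_l A_l) ⊗ (⨂_l B_l) → ⨂_l (A_l ⊗ B_l)`. -/
def interchange {L : Type} (A B : L → Type u) [∀ l, AddCommGroup (A l)] [∀ l, Module 𝕜 (A l)]
    [∀ l, AddCommGroup (B l)] [∀ l, Module 𝕜 (B l)] :
    (⨂[𝕜] l : L, A l) ⊗[𝕜] (⨂[𝕜] l : L, B l) →ₗ[𝕜] ⨂[𝕜] l : L, (A l ⊗[𝕜] B l) :=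
  TensorProduct.lift (PiTensorProduct.map₂ fun l => TensorProduct.mk 𝕜 (A l) (B l))

/-- The regrouping isomorphism
`(C(L) ⊗ ⨂_l C(q⁻¹ l)) ⊗ ⨂_k C(p⁻¹ k) → C(L) ⊗ ⨂_l (C(q⁻¹ l) ⊗ ⨂_{k ∈ q⁻¹ l} C(p⁻¹ k))`. -/
def regroup (C : SymSeq 𝕜) {S K L : Type} [Finite S] [Finite K] [Finite L]
    (p : S → K) (q : K → L) :
    (C.obj L ⊗[𝕜] (⨂[𝕜] l : L, C.obj (Fib q l))) ⊗[𝕜] (⨂[𝕜] k : K, C.obj (Fib p k)) →ₗ[𝕜]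
      C.obj L ⊗[𝕜] (⨂[𝕜] l : L, (C.obj (Fib q l) ⊗[𝕜]
        (⨂[𝕜] k : Fib q l, C.obj (Fib (restr p q l) k)))) :=
  LinearMap.lTensor _
    (interchange _ _ ∘ₗ LinearMap.lTensor _
      (PiTensorProduct.map (fun l => PiTensorProduct.map fun k : Fib q l =>
        C.map (fibRestrEquiv p q l k)) ∘ₗ group q fun k => C.obj (Fib p k))) ∘ₗ
  (TensorProduct.assoc 𝕜 _ _ _).toLinearMap

namespace CooperadStr

variable {C : SymSeq 𝕜}

/-- The cooperad laws for the cocomposition: equivariance and coassociativity. -/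
structure IsCooperad (D : CooperadStr C) : Prop where
  equivariant : ∀ {S S' K K' : Type} [Finite S] [Finite S'] [Finite K] [Finite K']
    (e : S ≃ S') (f : K ≃ K') (p : S → K) (p' : S' → K') (h : ∀ s, p' (e s) = f (p s)),
    D.cocomp p' ∘ₗ C.map e =
      TensorProduct.map (C.map f)
        (PiTensorProduct.map (fun k' => C.map (fibEquiv e f p p' h k')) ∘ₗ
          (PiTensorProduct.reindex 𝕜 (fun k => C.obj (Fib p k)) f).toLinearMap) ∘ₗ
      D.cocomp p
  coassoc : ∀ {S K L : Type} [Finite S] [Finite K] [Finite L] (p : S → K) (q : K → L),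
    regroup C p q ∘ₗ LinearMap.rTensor _ (D.cocomp q) ∘ₗ D.cocomp p =
      LinearMap.lTensor _ (PiTensorProduct.map fun l => D.cocomp (restr p q l)) ∘ₗ
        D.cocomp (q ∘ p)

/-- Applying the counit to the outer factor of the cocomposition for `S → pt`. -/
def outerCounit (D : CooperadStr C) (S : Type) [Finite S] : C.obj S →ₗ[𝕜] C.obj S :=
  (TensorProduct.lid 𝕜 _).toLinearMap ∘ₗ
    TensorProduct.map D.counit (C.map (fibUnitEquiv S) ∘ₗ
      (PiTensorProduct.subsingletonEquiv (R := 𝕜)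
        (s := fun u : Unit => C.obj (Fib (fun _ : S => ()) u)) ()).toLinearMap) ∘ₗ
    D.cocomp fun _ : S => ()

/-- Applying the counit to all the inner factors of the cocomposition for `id : S → S`. -/
def innerCounit (D : CooperadStr C) (S : Type) [Finite S] : C.obj S →ₗ[𝕜] C.obj S :=
  (TensorProduct.rid 𝕜 _).toLinearMap ∘ₗ
    LinearMap.lTensor _ (PiTensorProduct.dualDistrib (R := 𝕜)
      (M := fun s : S => C.obj (Fib (id : S → S) s))
      (PiTensorProduct.tprod 𝕜 fun s => D.counit ∘ₗ C.map (fibIdEquiv s))) ∘ₗ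
    D.cocomp (id : S → S)

/-- The counit laws. -/
structure IsCounital (D : CooperadStr C) : Prop where
  outer : ∀ (S : Type) [Finite S], D.outerCounit S = LinearMap.id
  inner : ∀ (S : Type) [Finite S], D.innerCounit S = LinearMap.id

end CooperadStr

/-- Morphisms of cooperads: morphisms of symmetric sequences which commute with the
cocompositions and the counits. -/
structure IsCooperadHom {C D : SymSeq 𝕜} (X : CooperadStr C) (Y : CooperadStr D)
    (f : SymSeq.Hom C D) : Prop where
  cocomp : ∀ {S K : Type} [Finite S] [Finite K] (p : S → K),
    Y.cocomp p ∘ₗ f.app S =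
      TensorProduct.map (f.app K) (PiTensorProduct.map fun k => f.app (Fib p k)) ∘ₗ X.cocomp p
  counit : Y.counit ∘ₗ f.app Unit = X.counit

/-! ### Linear duals -/

/-- The linear dual of a symmetric sequence. -/
def SymSeq.dual (P : SymSeq 𝕜) : SymSeq 𝕜 where
  obj S _ := Module.Dual 𝕜 (P.obj S)
  map e := (P.map e.symm).dualMap
  map_refl S _ := by
    rw [Equiv.refl_symm, P.map_refl]; rfl
  map_trans e f := by
    rw [Equiv.symm_trans, P.map_trans]; rfl

/-- The canonical isomorphism `(A ⊗ ⨂_k B_k)^* ≅ A^* ⊗ ⨂_k B_k^*` for finite-dimensional vector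
spaces. -/
def dualTensor {K : Type} [Finite K] (A : Type u) (B : K → Type u) [AddCommGroup A] [Module 𝕜 A]
    [∀ k, AddCommGroup (B k)] [∀ k, Module 𝕜 (B k)] [Module.Finite 𝕜 A]
    [∀ k, Module.Finite 𝕜 (B k)] :
    Module.Dual 𝕜 (A ⊗[𝕜] (⨂[𝕜] k : K, B k)) ≃ₗ[𝕜]
      Module.Dual 𝕜 A ⊗[𝕜] (⨂[𝕜] k : K, Module.Dual 𝕜 (B k)) :=
  ((LinearEquiv.lTensor (Module.Dual 𝕜 A)
      (PiTensorProduct.dualDistribEquiv (R := 𝕜) (M := B))).trans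
    (TensorProduct.dualDistribEquiv 𝕜 A (⨂[𝕜] k : K, B k))).symm

/-- The linear dual of an operad with finite-dimensional components: the cocomposition is the
transpose of the composition. -/
def OperadStr.dual {P : SymSeq 𝕜} (O : OperadStr P)
    [∀ (S : Type) [Finite S], Module.Finite 𝕜 (P.obj S)] : CooperadStr P.dual where
  cocomp {_ K} _ _ p :=
    (dualTensor (P.obj K) fun k : K => P.obj (Fib p k)).toLinearMap ∘ₗ (O.comp p).dualMap
  counit := LinearMap.applyₗ O.one

/-! ### Graphs -/

/-- `S`-graphs: oriented graphs with vertex set `S` whose underlying graph is connected and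
acyclic. -/
@[ext]
structure SGraph (S : Type) where
  arrow : S → S → Prop
  asymm : ∀ a b, arrow a b → ¬ arrow b a
  isTree : (SimpleGraph.fromRel arrow).IsTree

namespace SGraph

variable {S T : Type}

instance [Finite S] : Finite (SGraph S) :=
  Finite.of_injective (fun G : SGraph S => G.arrow) fun _ _ h => SGraph.ext h

instance [Finite S] : Fintype (SGraph S) := Fintype.ofFinite _

/-- Relabelling the vertices. -/
def relabel (e : S ≃ T) (G : SGraph S) : SGraph T where
  arrow a b := G.arrow (e.symm a) (e.symm b)
  asymm a b := G.asymm _ _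
  isTree := by
    have : SimpleGraph.fromRel (fun a b => G.arrow (e.symm a) (e.symm b)) ≃g
        SimpleGraph.fromRel G.arrow :=
      { toEquiv := e.symm
        map_rel_iff' := by intro a b; simp [SimpleGraph.fromRel_adj] }
    exact this.isTree_iff.mpr G.isTree

/-- The set of (oriented) edges. -/
def edges [Finite S] (G : SGraph S) : Finset (S × S) :=
  (Set.toFinite {e : S × S | G.arrow e.1 e.2}).toFinset

/-- Reversing the orientations of the edges in `E`. -/
def rev (G : SGraph S) (E : Finset (S × S)) : SGraph S where
  arrow a b := (G.arrow a b ∧ (a, b) ∉ E) ∨ (G.arrow b a ∧ (b, a) ∈ E)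
  asymm a b h h' := by
    have := G.asymm a b
    tauto
  isTree := by
    convert G.isTree using 1
    ext a b
    simp only [SimpleGraph.fromRel_adj]
    tauto

/-- `φ` is a graph quotient `G ↠ K`: edges of `G` are mapped to edges of `K`, with the same
orientation, or to vertices of `K`, and inverse images of vertices are non-empty and connected. -/
structure IsQuotient (G : SGraph S) (K : SGraph T) (φ : S → T) : Prop where
  edge : ∀ a b, G.arrow a b → φ a = φ b ∨ K.arrow (φ a) (φ b)
  connected : ∀ k, ((SimpleGraph.fromRel G.arrow).comap (Subtype.val : Fib φ k → S)).Connected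

/-- The full subgraph of `G` on the fibre of `φ` over `k`, if it is connected. -/
def fib (G : SGraph S) (φ : S → T) (k : T)
    (h : ((SimpleGraph.fromRel G.arrow).comap (Subtype.val : Fib φ k → S)).Connected) :
    SGraph (Fib φ k) where
  arrow a b := G.arrow a.1 b.1
  asymm a b := G.asymm _ _
  isTree := by
    have h2 := G.isTree.isAcyclic.of_comap (Function.Embedding.subtype fun s => φ s = k)
    have e : SimpleGraph.fromRel (fun a b : Fib φ k => G.arrow a.1 b.1) =
        (SimpleGraph.fromRel G.arrow).comap (Subtype.val : Fib φ k → S) := by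
      ext a b
      simp [SimpleGraph.fromRel_adj, Subtype.ext_iff]
    rw [e]
    exact ⟨h, h2⟩

end SGraph

/-- The graph symmetric sequence: `Gr(S)` is the vector space freely generated by `S`-graphs. -/
def Gr (𝕜 : Type u) [Field 𝕜] : SymSeq 𝕜 where
  obj S _ := SGraph S →₀ 𝕜
  map e := Finsupp.lmapDomain 𝕜 𝕜 (SGraph.relabel e)
  map_refl S _ := by
    have : SGraph.relabel (Equiv.refl S) = id := rfl
    rw [this]; exact Finsupp.lmapDomain_id 𝕜 𝕜
  map_trans e f := by
    have : SGraph.relabel (e.trans f) = SGraph.relabel f ∘ SGraph.relabel e := rfl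
    rw [this]; exact Finsupp.lmapDomain_comp 𝕜 𝕜 _ _

/-- The graph `G` as an element of `Gr(S)`. -/
abbrev gr (𝕜 : Type u) [Field 𝕜] {S : Type} (G : SGraph S) : SGraph S →₀ 𝕜 := Finsupp.single G 1

open Classical in
/-- The anti-commutative graph cooperad: the component of the cocomposition for a map `φ : S → K'`
sends `G` to
`∑_K 2^{-|Edge K|} (∑_{E ⊆ Edge K} (-1)^{|E|} rev_E K) ⊗ (⨂_k φ⁻¹(k))`,
where `K` runs through the graphs with vertex set `K'` for which `φ` is a graph quotient `G ↠ K`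
(there is at most one of them).  The counit sends the one-vertex graph to `1`. -/
def ACGr (𝕜 : Type u) [Field 𝕜] : CooperadStr (Gr 𝕜) where
  cocomp {S K'} _ _ φ :=
    Finsupp.linearCombination 𝕜 fun G : SGraph S =>
      ∑ K : SGraph K', if h : G.IsQuotient K φ then
        (((2 : 𝕜) ^ K.edges.card)⁻¹ •
          ∑ E ∈ K.edges.powerset, (-1 : 𝕜) ^ E.card • gr 𝕜 (K.rev E)) ⊗ₜ[𝕜]
          (PiTensorProduct.tprod 𝕜 fun k => gr 𝕜 (G.fib φ k (h.connected k)))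
      else 0
  counit := Finsupp.linearCombination 𝕜 fun _ => 1

/-- Arrow-reversing expressions: `G + rev_{a → b} G` for an edge `a → b` of `G`. -/
def arrowReversing (𝕜 : Type u) [Field 𝕜] (S : Type) : Set (SGraph S →₀ 𝕜) :=
  {x | ∃ (G : SGraph S) (a b : S), G.arrow a b ∧ x = gr 𝕜 G + gr 𝕜 (G.rev {(a, b)})}

/-- The graph `G` consists of the edges `a → b`, `c → d` and of the edges in `R`. -/
def SGraph.HasEdges {S : Type} (G : SGraph S) (R : S → S → Prop) (a b c d : S) : Prop :=
  ∀ x y, G.arrow x y ↔ (x = a ∧ y = b) ∨ (x = c ∧ y = d) ∨ R x y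

/-- Arnold expressions: sums of three graphs which have the edges `a → b → c`, respectively
`b → c → a`, respectively `c → a → b`, and agree otherwise. -/
def arnold (𝕜 : Type u) [Field 𝕜] (S : Type) : Set (SGraph S →₀ 𝕜) :=
  {x | ∃ (a b c : S) (R : S → S → Prop) (G₁ G₂ G₃ : SGraph S), a ≠ b ∧ b ≠ c ∧ c ≠ a ∧
    G₁.HasEdges R a b b c ∧ G₂.HasEdges R b c c a ∧ G₃.HasEdges R c a a b ∧
    x = gr 𝕜 G₁ + gr 𝕜 G₂ + gr 𝕜 G₃}

/-- The span of the arrow-reversing and Arnold expressions. -/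
def eilRel (𝕜 : Type u) [Field 𝕜] (S : Type) : Submodule 𝕜 (SGraph S →₀ 𝕜) :=
  Submodule.span 𝕜 (arrowReversing 𝕜 S ∪ arnold 𝕜 S)

theorem eilRel_relabel {S T : Type} (e : S ≃ T) :
    eilRel 𝕜 S ≤ (eilRel 𝕜 T).comap (Finsupp.lmapDomain 𝕜 𝕜 (SGraph.relabel e)) := by
  refine Submodule.span_le.mpr ?_
  rintro x (⟨G, a, b, h, rfl⟩ | ⟨a, b, c, R, G₁, G₂, G₃, hab, hbc, hca, h₁, h₂, h₃, rfl⟩)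
  · refine Submodule.subset_span (Or.inl ⟨G.relabel e, e a, e b, by simpa [SGraph.relabel], ?_⟩)
    simp only [map_add, Finsupp.lmapDomain_apply, Finsupp.mapDomain_single]
    congr 3
    ext x y
    simp [SGraph.relabel, SGraph.rev, Equiv.symm_apply_eq]
  · refine Submodule.subset_span (Or.inr ⟨e a, e b, e c, fun x y => R (e.symm x) (e.symm y),
      G₁.relabel e, G₂.relabel e, G₃.relabel e, by simpa, by simpa, by simpa, ?_, ?_, ?_, ?_⟩)
    · intro x y; simpa [SGraph.relabel, Equiv.symm_apply_eq] using h₁ (e.symm x) (e.symm y)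
    · intro x y; simpa [SGraph.relabel, Equiv.symm_apply_eq] using h₂ (e.symm x) (e.symm y)
    · intro x y; simpa [SGraph.relabel, Equiv.symm_apply_eq] using h₃ (e.symm x) (e.symm y)
    · simp only [map_add, Finsupp.lmapDomain_apply, Finsupp.mapDomain_single]

/-- The symmetric sequence `Eil`. -/
def Eil (𝕜 : Type u) [Field 𝕜] : SymSeq 𝕜 where
  obj S _ := (SGraph S →₀ 𝕜) ⧸ eilRel 𝕜 S
  map e := Submodule.mapQ _ _ (Finsupp.lmapDomain 𝕜 𝕜 (SGraph.relabel e)) (eilRel_relabel e)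
  map_refl S _ := by
    refine Submodule.linearMap_qext _ ?_
    rw [Submodule.mapQ_mkQ]
    exact congrArg (fun g => (eilRel 𝕜 S).mkQ ∘ₗ g) ((Gr 𝕜).map_refl S)
  map_trans {S T U} _ _ _ e f := by
    refine Submodule.linearMap_qext _ ?_
    rw [LinearMap.comp_assoc, Submodule.mapQ_mkQ, Submodule.mapQ_mkQ, ← LinearMap.comp_assoc,
      Submodule.mapQ_mkQ, LinearMap.comp_assoc]
    exact congrArg (fun g => (eilRel 𝕜 U).mkQ ∘ₗ g) ((Gr 𝕜).map_trans e f)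

/-- The quotient map from `Gr` to `Eil`. -/
def eilQuot (𝕜 : Type u) [Field 𝕜] : SymSeq.Hom (Gr 𝕜) (Eil 𝕜) where
  app S _ := (eilRel 𝕜 S).mkQ
  natural e := (Submodule.mapQ_mkQ _ _ _ (h := eilRel_relabel e)).symm

/-! ### Trees and the Lie operad -/

/-- Rooted planar binary trees with leaves labelled by elements of `α`. -/
inductive PTree (α : Type) : Type
  | leaf : α → PTree α
  | node : PTree α → PTree α → PTree α

namespace PTree

variable {α β : Type}

/-- The labels of the leaves. -/
def leaves : PTree α → Multiset α
  | leaf a => {a}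
  | node l r => l.leaves + r.leaves

/-- Grafting the root of the tree `f a` onto every leaf with label `a`. -/
def graft (f : α → PTree β) : PTree α → PTree β
  | leaf a => f a
  | node l r => node (l.graft f) (r.graft f)

/-- Relabelling. -/
def relabel (f : α → β) : PTree α → PTree β := graft fun a => leaf (f a)

theorem leaves_graft (f : α → PTree β) (t : PTree α) :
    (t.graft f).leaves = t.leaves.bind fun a => (f a).leaves := by
  induction t with
  | leaf a => simp [graft, leaves]
  | node l r hl hr => simp [graft, leaves, hl, hr]

theorem leaves_relabel (f : α → β) (t : PTree α) : (t.relabel f).leaves = t.leaves.map f := by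
  rw [relabel, leaves_graft]
  simp [leaves, Multiset.bind_singleton]

theorem graft_congr {f g : α → PTree β} (t : PTree α) (h : ∀ a ∈ t.leaves, f a = g a) :
    t.graft f = t.graft g := by
  induction t with
  | leaf a => exact h a (by simp [leaves])
  | node l r hl hr =>
    simp only [leaves, Multiset.mem_add] at h
    rw [graft, graft, hl fun a ha => h a (Or.inl ha), hr fun a ha => h a (Or.inr ha)]

theorem graft_graft {γ : Type} (f : α → PTree β) (g : β → PTree γ) (t : PTree α) :
    (t.graft f).graft g = t.graft fun a => (f a).graft g := by
  induction t with
  | leaf a => rfl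
  | node l r hl hr => simp [graft, hl, hr]

theorem graft_leaf (t : PTree α) : t.graft leaf = t := by
  induction t with
  | leaf a => rfl
  | node l r hl hr => simp [graft, hl, hr]

theorem finite_card_leaves_le [Finite α] (n : ℕ) :
    {t : PTree α | t.leaves.card ≤ n}.Finite := by
  have pos : ∀ t : PTree α, 1 ≤ t.leaves.card := by
    intro t
    induction t with
    | leaf a => simp [leaves]
    | node l r hl hr => simp only [leaves, Multiset.card_add]; omega
  induction n with
  | zero =>
    refine Set.finite_empty.subset fun t ht => ?_
    have h := pos t
    have h' : t.leaves.card ≤ 0 := ht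
    omega
  | succ n ih =>
    refine ((Set.finite_range leaf).union (ih.image2 node ih)).subset fun t ht => ?_
    cases t with
    | leaf a => exact Or.inl ⟨a, rfl⟩
    | node l r =>
      have h : (l.leaves + r.leaves).card ≤ n + 1 := ht
      rw [Multiset.card_add] at h
      have h1 := pos l
      have h2 := pos r
      refine Or.inr ⟨l, ?_, r, ?_, rfl⟩
      · change l.leaves.card ≤ n; omega
      · change r.leaves.card ≤ n; omega

end PTree

/-- Trees with one distinguished place, into which a subtree can be plugged. -/
inductive Ctx (α : Type) : Type
  | hole : Ctx α
  | left : Ctx α → PTree α → Ctx α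
  | right : PTree α → Ctx α → Ctx α

namespace Ctx

variable {α β : Type}

/-- Plugging a tree into the distinguished place. -/
def plug : Ctx α → PTree α → PTree α
  | hole, t => t
  | left c r, t => PTree.node (c.plug t) r
  | right l c, t => PTree.node l (c.plug t)

theorem exists_graft (c : Ctx α) (f : α → PTree β) :
    ∃ c' : Ctx β, ∀ t, (c.plug t).graft f = c'.plug (t.graft f) := by
  induction c with
  | hole => exact ⟨hole, fun _ => rfl⟩
  | left c r ih =>
    obtain ⟨c', h⟩ := ih
    exact ⟨left c' (r.graft f), fun t => by simp [plug, PTree.graft, h]⟩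
  | right l c ih =>
    obtain ⟨c', h⟩ := ih
    exact ⟨right (l.graft f) c', fun t => by simp [plug, PTree.graft, h]⟩

theorem exists_comp (c d : Ctx α) : ∃ c' : Ctx α, ∀ t, c.plug (d.plug t) = c'.plug t := by
  induction c with
  | hole => exact ⟨d, fun _ => rfl⟩
  | left c r ih =>
    obtain ⟨c', h⟩ := ih
    exact ⟨left c' r, fun t => by simp [plug, h]⟩
  | right l c ih =>
    obtain ⟨c', h⟩ := ih
    exact ⟨right l c', fun t => by simp [plug, h]⟩

theorem exists_of_leaf [DecidableEq α] (f : α → PTree β) (i : α) (t : PTree α)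
    (hn : t.leaves.Nodup) (hi : i ∈ t.leaves) :
    ∃ c : Ctx β, ∀ x, t.graft (Function.update f i x) = c.plug x := by
  induction t with
  | leaf a =>
    obtain rfl : i = a := by simpa [PTree.leaves] using hi
    exact ⟨hole, fun x => by simp [PTree.graft, plug]⟩
  | node l r hl hr =>
    have hn' : (l.leaves + r.leaves).Nodup := hn
    have hi' : i ∈ l.leaves + r.leaves := hi
    rw [Multiset.nodup_add] at hn'
    obtain ⟨nl, nr, hd⟩ := hn'
    have stable : ∀ s : PTree α, i ∉ s.leaves → ∀ x, s.graft (Function.update f i x) = s.graft f :=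
      fun s hs x => PTree.graft_congr s fun a ha =>
        Function.update_of_ne (fun h : a = i => hs (h ▸ ha)) _ _
    rcases Multiset.mem_add.mp hi' with h | h
    · obtain ⟨c, hc⟩ := hl nl h
      have := stable r (Multiset.disjoint_left.mp hd h)
      exact ⟨left c (r.graft f), fun x => by rw [PTree.graft, hc, this, plug]⟩
    · obtain ⟨c, hc⟩ := hr nr h
      have := stable l fun h' => Multiset.disjoint_left.mp hd h' h
      exact ⟨right (l.graft f) c, fun x => by rw [PTree.graft, hc, this, plug]⟩

end Ctx

/-- `S`-trees: rooted planar binary trees whose leaves are labelled bijectively by `S`. -/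
def STree (S : Type) : Type := {t : PTree S // t.leaves.Nodup ∧ ∀ s, s ∈ t.leaves}

namespace STree

variable {S T K : Type}

instance [Finite S] : Finite (STree S) := by
  classical
  have := Fintype.ofFinite S
  refine (Set.Finite.subset (s := {t : PTree S | t.leaves.card ≤ Fintype.card S})
    (PTree.finite_card_leaves_le _) (t := {t | t.leaves.Nodup ∧ ∀ s, s ∈ t.leaves}) ?_).to_subtype
  rintro t ⟨h, -⟩
  exact Multiset.card_le_card (Multiset.le_iff_subset h |>.mpr fun a _ => Finset.mem_univ a)

/-- The trivial tree. -/
def trivial : STree Unit := ⟨PTree.leaf (), by simp [PTree.leaves]⟩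

/-- Relabelling the leaves. -/
def relabel (e : S ≃ T) (t : STree S) : STree T :=
  ⟨t.1.relabel e, by
    rw [PTree.leaves_relabel]
    refine ⟨t.2.1.map e.injective, fun s => ?_⟩
    exact Multiset.mem_map.mpr ⟨e.symm s, t.2.2 _, by simp⟩⟩

/-- The composition of the tree operad: grafting, for every `k`, the root of `ts k` onto the leaf
of `t` with label `k`. -/
def graft (p : S → K) (t : STree K) (ts : ∀ k, STree (Fib p k)) : STree S :=
  ⟨t.1.graft fun k => (ts k).1.relabel Subtype.val, by
    rw [PTree.leaves_graft]
    simp only [PTree.leaves_relabel]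
    constructor
    · refine Multiset.nodup_bind.mpr
        ⟨fun k _ => (ts k).2.1.map Subtype.val_injective, ?_⟩
      refine Multiset.Nodup.pairwise (fun k _ k' _ hk => ?_) t.2.1
      refine Multiset.disjoint_left.mpr fun {s} hs hs' => hk ?_
      obtain ⟨x, -, rfl⟩ := Multiset.mem_map.mp hs
      obtain ⟨y, -, hy⟩ := Multiset.mem_map.mp hs'
      rw [← x.2, ← y.2, hy]
    · intro s
      refine Multiset.mem_bind.mpr ⟨p s, t.2.2 _, ?_⟩
      exact Multiset.mem_map.mpr ⟨⟨s, rfl⟩, (ts (p s)).2.2 _, rfl⟩⟩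

end STree

/-- The tree `t` as an element of `Tr(S)`, the vector space generated by `S`-trees. -/
abbrev tr (𝕜 : Type u) [Field 𝕜] {S : Type} (t : STree S) : STree S →₀ 𝕜 := Finsupp.single t 1

/-- Anti-symmetry expressions. -/
def antiSymm (𝕜 : Type u) [Field 𝕜] (S : Type) : Set (STree S →₀ 𝕜) :=
  {x | ∃ (R : Ctx S) (T₁ T₂ : PTree S) (t t' : STree S),
    t.1 = R.plug (.node T₁ T₂) ∧ t'.1 = R.plug (.node T₂ T₁) ∧ x = tr 𝕜 t + tr 𝕜 t'}

/-- Jacobi expressions. -/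
def jacobi (𝕜 : Type u) [Field 𝕜] (S : Type) : Set (STree S →₀ 𝕜) :=
  {x | ∃ (R : Ctx S) (T₁ T₂ T₃ : PTree S) (t t' t'' : STree S),
    t.1 = R.plug (.node (.node T₁ T₂) T₃) ∧ t'.1 = R.plug (.node (.node T₂ T₃) T₁) ∧
    t''.1 = R.plug (.node (.node T₃ T₁) T₂) ∧ x = tr 𝕜 t + tr 𝕜 t' + tr 𝕜 t''}

/-- The span of the anti-symmetry and Jacobi expressions. -/
def lieRel (𝕜 : Type u) [Field 𝕜] (S : Type) : Submodule 𝕜 (STree S →₀ 𝕜) :=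
  Submodule.span 𝕜 (antiSymm 𝕜 S ∪ jacobi 𝕜 S)

/-- A map of trees which is given by plugging (a relabelling of) a tree into something fixed
preserves the relations. -/
theorem lieRel_of_plug {S T : Type} (F : STree S → STree T)
    (hF : ∀ R : Ctx S, ∃ (R' : Ctx T) (f : S → PTree T), ∀ (t : STree S) (X : PTree S),
      t.1 = R.plug X → (F t).1 = R'.plug (X.graft f)) :
    lieRel 𝕜 S ≤ (lieRel 𝕜 T).comap (Finsupp.lmapDomain 𝕜 𝕜 F) := by
  refine Submodule.span_le.mpr ?_
  rintro x (⟨R, T₁, T₂, t, t', h, h', rfl⟩ | ⟨R, T₁, T₂, T₃, t, t', t'', h, h', h'', rfl⟩)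
  · obtain ⟨R', f, hR⟩ := hF R
    refine Submodule.subset_span (Or.inl
      ⟨R', T₁.graft f, T₂.graft f, F t, F t', hR _ _ h, hR _ _ h', ?_⟩)
    simp only [map_add, Finsupp.lmapDomain_apply, Finsupp.mapDomain_single]
  · obtain ⟨R', f, hR⟩ := hF R
    refine Submodule.subset_span (Or.inr
      ⟨R', T₁.graft f, T₂.graft f, T₃.graft f, F t, F t', F t'', hR _ _ h, hR _ _ h', hR _ _ h'',
        ?_⟩)
    simp only [map_add, Finsupp.lmapDomain_apply, Finsupp.mapDomain_single]

theorem lieRel_relabel {S T : Type} (e : S ≃ T) :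
    lieRel 𝕜 S ≤ (lieRel 𝕜 T).comap (Finsupp.lmapDomain 𝕜 𝕜 (STree.relabel e)) := by
  refine lieRel_of_plug _ fun R => ?_
  obtain ⟨R', h⟩ := R.exists_graft fun s => PTree.leaf (e s)
  exact ⟨R', _, fun t X ht => by rw [← h, ← ht]; rfl⟩

/-- The symmetric sequence `Lie`. -/
def Lie (𝕜 : Type u) [Field 𝕜] : SymSeq 𝕜 where
  obj S _ := (STree S →₀ 𝕜) ⧸ lieRel 𝕜 S
  map e := Submodule.mapQ _ _ (Finsupp.lmapDomain 𝕜 𝕜 (STree.relabel e)) (lieRel_relabel e)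
  map_refl S _ := by
    refine Submodule.linearMap_qext _ ?_
    have : STree.relabel (Equiv.refl S) = id := funext fun t => Subtype.ext t.1.graft_leaf
    rw [Submodule.mapQ_mkQ, this, Finsupp.lmapDomain_id]
    rfl
  map_trans {S T U} _ _ _ e f := by
    refine Submodule.linearMap_qext _ ?_
    have : STree.relabel (e.trans f) = STree.relabel f ∘ STree.relabel e :=
      funext fun t => Subtype.ext
        (PTree.graft_graft (fun s => PTree.leaf (e s)) (fun s => PTree.leaf (f s)) t.1).symm
    rw [LinearMap.comp_assoc, Submodule.mapQ_mkQ, Submodule.mapQ_mkQ, ← LinearMap.comp_assoc,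
      Submodule.mapQ_mkQ, LinearMap.comp_assoc, this, Finsupp.lmapDomain_comp]

instance (S : Type) [Finite S] : Module.Finite 𝕜 ((Lie 𝕜).obj S) :=
  inferInstanceAs (Module.Finite 𝕜 ((STree S →₀ 𝕜) ⧸ lieRel 𝕜 S))

/-- A multilinear map which vanishes as soon as one of its arguments lies in the corresponding
submodule descends to the quotients. -/
theorem multilinear_congr {ι : Type} [Finite ι] {M : ι → Type u} [∀ i, AddCommGroup (M i)]
    [∀ i, Module 𝕜 (M i)] (N : ∀ i, Submodule 𝕜 (M i)) {E : Type u} [AddCommGroup E] [Module 𝕜 E]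
    (f : MultilinearMap 𝕜 M E) (h : ∀ m i, m i ∈ N i → f m = 0) (m m' : ∀ i, M i)
    (hm : ∀ i, m i - m' i ∈ N i) : f m = f m' := by
  classical
  have := Fintype.ofFinite ι
  have key : ∀ s : Finset ι, f (s.piecewise m' m) = f m := by
    intro s
    induction s using Finset.induction_on with
    | empty => simp
    | insert a s ha ih =>
      rw [Finset.piecewise_insert, ← ih]
      have h0 : f (Function.update (s.piecewise m' m) a (m a - m' a)) = 0 :=
        h _ a (by rw [Function.update_self]; exact hm a)
      have h1 : Function.update (s.piecewise m' m) a (m a) = s.piecewise m' m := by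
        rw [Function.update_eq_self_iff, Finset.piecewise_eq_of_notMem _ _ _ ha]
      rw [MultilinearMap.map_update_sub, h1, sub_eq_zero] at h0
      exact h0.symm
  have := key Finset.univ
  rw [Finset.piecewise_univ] at this
  exact this.symm

/-- The multilinear map on the quotients. -/
def multilinearQuot {ι : Type} [Finite ι] {M : ι → Type u} [∀ i, AddCommGroup (M i)]
    [∀ i, Module 𝕜 (M i)] (N : ∀ i, Submodule 𝕜 (M i)) {E : Type u} [AddCommGroup E] [Module 𝕜 E]
    (f : MultilinearMap 𝕜 M E) (h : ∀ m i, m i ∈ N i → f m = 0) :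
    MultilinearMap 𝕜 (fun i => M i ⧸ N i) E where
  toFun y := f fun i => (y i).out
  map_update_add' := by
    intro _ y i a b
    classical
    have mk : ∀ c : M i ⧸ N i, f (fun j => (Function.update y i c j).out) =
        f (Function.update (fun j => (y j).out) i c.out) := by
      intro c
      congr 1
      funext j
      by_cases hj : j = i
      · subst hj; simp
      · simp [hj]
    have hd : ∀ c, (@Function.update ι _ ‹_› y i c) = Function.update y i c := by
      intro c; congr
    rw [hd, hd, hd, mk, mk, mk, ← MultilinearMap.map_update_add]
    refine multilinear_congr N f h _ _ fun j => ?_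
    by_cases hj : j = i
    · subst hj
      rw [Function.update_self, Function.update_self, ← Submodule.Quotient.eq]
      simp only [Submodule.Quotient.mk_add, Submodule.Quotient.mk_out]
    · simp [hj]
  map_update_smul' := by
    intro _ y i a b
    classical
    have mk : ∀ c : M i ⧸ N i, f (fun j => (Function.update y i c j).out) =
        f (Function.update (fun j => (y j).out) i c.out) := by
      intro c
      congr 1
      funext j
      by_cases hj : j = i
      · subst hj; simp
      · simp [hj]
    have hd : ∀ c, (@Function.update ι _ ‹_› y i c) = Function.update y i c := by
      intro c; congr
    rw [hd, hd, mk, mk, ← MultilinearMap.map_update_smul]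
    refine multilinear_congr N f h _ _ fun j => ?_
    by_cases hj : j = i
    · subst hj
      rw [Function.update_self, Function.update_self, ← Submodule.Quotient.eq]
      simp only [Submodule.Quotient.mk_smul, Submodule.Quotient.mk_out]
    · simp [hj]

theorem multilinearQuot_mk {ι : Type} [Finite ι] {M : ι → Type u} [∀ i, AddCommGroup (M i)]
    [∀ i, Module 𝕜 (M i)] (N : ∀ i, Submodule 𝕜 (M i)) {E : Type u} [AddCommGroup E] [Module 𝕜 E]
    (f : MultilinearMap 𝕜 M E) (h : ∀ m i, m i ∈ N i → f m = 0) (m : ∀ i, M i) :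
    multilinearQuot N f h (fun i => (N i).mkQ (m i)) = f m := by
  refine multilinear_congr N f h _ _ fun i => ?_
  rw [← Submodule.Quotient.eq, Submodule.Quotient.mk_out]
  rfl

/-- The composition of the tree operad, extended linearly. -/
def treeComp (𝕜 : Type u) [Field 𝕜] {S K : Type} [Finite K] (p : S → K) :
    (STree K →₀ 𝕜) →ₗ[𝕜] (⨂[𝕜] k : K, (STree (Fib p k) →₀ 𝕜)) →ₗ[𝕜] (STree S →₀ 𝕜) :=
  Finsupp.basisSingleOne.constr 𝕜 fun t =>
    (Basis.piTensorProduct fun _ : K => Finsupp.basisSingleOne).constr 𝕜 fun ts =>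
      tr 𝕜 (STree.graft p t ts)

theorem treeComp_apply {S K : Type} [Finite K] (p : S → K) (t : STree K)
    (ts : ∀ k, STree (Fib p k)) :
    treeComp 𝕜 p (tr 𝕜 t) (PiTensorProduct.tprod 𝕜 fun k => tr 𝕜 (ts k)) =
      tr 𝕜 (STree.graft p t ts) := by
  have h1 : tr 𝕜 t = Finsupp.basisSingleOne (R := 𝕜) t := by simp
  have h2 : (PiTensorProduct.tprod 𝕜 fun k => tr 𝕜 (ts k)) =
      (Basis.piTensorProduct fun k : K =>
        (Finsupp.basisSingleOne : Module.Basis (STree (Fib p k)) 𝕜 _)) ts := by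
    rw [Basis.piTensorProduct_apply]; simp
  rw [h1, h2, treeComp, Module.Basis.constr_basis, Module.Basis.constr_basis]

/-- Two multilinear maps on spaces of trees agree if they agree on trees. -/
theorem tree_ext {S K : Type} [Finite K] (p : S → K) {E : Type u} [AddCommGroup E] [Module 𝕜 E]
    (f g : MultilinearMap 𝕜 (fun k : K => (STree (Fib p k) →₀ 𝕜)) E)
    (h : ∀ ts : ∀ k, STree (Fib p k), f (fun k => tr 𝕜 (ts k)) = g fun k => tr 𝕜 (ts k)) :
    f = g := by
  refine Module.Basis.ext_multilinear (fun _ => Finsupp.basisSingleOne) fun ts => ?_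
  simpa using h ts

/-- The composition respects the relations in the outer argument. -/
theorem treeComp_outer {S K : Type} [Finite K] (p : S → K) (x : STree K →₀ 𝕜)
    (hx : x ∈ lieRel 𝕜 K) (m : ∀ k, STree (Fib p k) →₀ 𝕜) :
    treeComp 𝕜 p x (PiTensorProduct.tprod 𝕜 m) ∈ lieRel 𝕜 S := by
  rw [← Submodule.Quotient.mk_eq_zero]
  have key : (((lieRel 𝕜 S).mkQ ∘ₗ treeComp 𝕜 p x).compMultilinearMap
      (PiTensorProduct.tprod 𝕜)) = 0 := by
    refine tree_ext p _ _ fun ts => ?_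
    have hlin : (treeComp 𝕜 p).flip (PiTensorProduct.tprod 𝕜 fun k => tr 𝕜 (ts k)) =
        Finsupp.lmapDomain 𝕜 𝕜 fun t => STree.graft p t ts := by
      ext t : 2
      simpa using treeComp_apply p t ts
    have := lieRel_of_plug (𝕜 := 𝕜) (fun t => STree.graft p t ts) (fun R => by
      obtain ⟨R', h⟩ := R.exists_graft fun k => (ts k).1.relabel Subtype.val
      exact ⟨R', _, fun t X ht => by rw [← h, ← ht]; rfl⟩) hx
    rw [← hlin] at this
    simpa using this
  exact congrArg (fun g => g m) key

/-- The composition respects the relations in the inner arguments. -/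
theorem treeComp_inner {S K : Type} [Finite K] (p : S → K) (x : STree K →₀ 𝕜)
    (m : ∀ k, STree (Fib p k) →₀ 𝕜) (i : K) (hm : m i ∈ lieRel 𝕜 (Fib p i)) :
    treeComp 𝕜 p x (PiTensorProduct.tprod 𝕜 m) ∈ lieRel 𝕜 S := by
  classical
  induction x using Finsupp.induction_linear with
  | zero => simp
  | add x y hx hy => rw [map_add, LinearMap.add_apply]; exact add_mem hx hy
  | single t c =>
    have hc : Finsupp.single t c = c • tr 𝕜 t := by simp
    rw [hc, map_smul, LinearMap.smul_apply]
    refine Submodule.smul_mem _ _ ?_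
    rw [← Submodule.Quotient.mk_eq_zero]
    -- in the argument with index `i` use the linear map sending every tree to `m i`
    let φ : ∀ k, (STree (Fib p k) →₀ 𝕜) →ₗ[𝕜] (STree (Fib p k) →₀ 𝕜) := fun k =>
      if k = i then Finsupp.linearCombination 𝕜 (fun _ => m k) else LinearMap.id
    have key : (((lieRel 𝕜 S).mkQ ∘ₗ treeComp 𝕜 p (tr 𝕜 t)).compMultilinearMap
        (PiTensorProduct.tprod 𝕜)).compLinearMap φ = 0 := by
      refine tree_ext p _ _ fun ts => ?_
      let F : STree (Fib p i) → STree S := fun s => STree.graft p t (Function.update ts i s)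
      have hlin : (treeComp 𝕜 p (tr 𝕜 t)) ∘ₗ ((PiTensorProduct.tprod 𝕜).toLinearMap
          (fun k => tr 𝕜 (ts k)) i) = Finsupp.lmapDomain 𝕜 𝕜 F := by
        ext s : 2
        have e : Function.update (fun k => tr 𝕜 (ts k)) i (tr 𝕜 s) =
            fun k => tr 𝕜 (Function.update ts i s k) := by
          funext k
          by_cases hk : k = i
          · subst hk; simp
          · simp [hk]
        have := treeComp_apply (𝕜 := 𝕜) p t (Function.update ts i s)
        rw [← e] at this
        simpa using this
      have := lieRel_of_plug (𝕜 := 𝕜) F (fun R => by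
        obtain ⟨c, hcx⟩ := Ctx.exists_of_leaf
          (fun k => (ts k).1.relabel (Subtype.val : Fib p k → S)) i t.1 t.2.1 (t.2.2 i)
        obtain ⟨R', h⟩ := R.exists_graft fun s : Fib p i => PTree.leaf s.1
        obtain ⟨R'', h'⟩ := c.exists_comp R'
        refine ⟨R'', fun s => PTree.leaf s.1, fun s X hs => ?_⟩
        rw [← h', ← h, ← hs, ← hcx]
        change t.1.graft _ = t.1.graft _
        congr 1
        funext k
        by_cases hk : k = i
        · subst hk
          rw [Function.update_self, Function.update_self]
          rfl
        · rw [Function.update_of_ne hk, Function.update_of_ne hk]) hm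
      rw [← hlin] at this
      have e : (fun k => φ k (tr 𝕜 (ts k))) = Function.update (fun k => tr 𝕜 (ts k)) i (m i) := by
        funext k
        by_cases hk : k = i
        · subst hk; simp [φ]
        · simp [φ, hk]
      simp only [MultilinearMap.compLinearMap_apply, LinearMap.compMultilinearMap_apply, e]
      simpa using this
    by_cases hne : Nonempty (STree (Fib p i))
    · obtain ⟨s⟩ := hne
      have := congrArg (fun g => g (Function.update m i (tr 𝕜 s))) key
      have e : (fun k => φ k (Function.update m i (tr 𝕜 s) k)) = m := by
        funext k
        by_cases hk : k = i
        · subst hk; simp [φ]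
        · simp [φ, hk]
      simp only [MultilinearMap.compLinearMap_apply, LinearMap.compMultilinearMap_apply, e] at this
      exact this
    · have h0 : m i = 0 := by
        ext s
        exact (hne ⟨s⟩).elim
      rw [(PiTensorProduct.tprod 𝕜).map_coord_zero i h0, map_zero]
      rfl

/-- The composition of the Lie operad, with the inner factors descended to the quotients. -/
def lieCompAux (𝕜 : Type u) [Field 𝕜] {S K : Type} [Finite K] (p : S → K) :
    (STree K →₀ 𝕜) →ₗ[𝕜]
      (⨂[𝕜] k : K, ((STree (Fib p k) →₀ 𝕜) ⧸ lieRel 𝕜 (Fib p k))) →ₗ[𝕜]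
        ((STree S →₀ 𝕜) ⧸ lieRel 𝕜 S) where
  toFun x := PiTensorProduct.lift (multilinearQuot (fun k => lieRel 𝕜 (Fib p k))
    (((lieRel 𝕜 S).mkQ ∘ₗ treeComp 𝕜 p x).compMultilinearMap (PiTensorProduct.tprod 𝕜))
    fun m i hm => (Submodule.Quotient.mk_eq_zero _).mpr (treeComp_inner p x m i hm))
  map_add' x y := by
    refine PiTensorProduct.ext (MultilinearMap.ext fun m => ?_)
    simp [multilinearQuot]
  map_smul' c x := by
    refine PiTensorProduct.ext (MultilinearMap.ext fun m => ?_)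
    simp [multilinearQuot]

/-- The composition of the Lie operad. -/
def lieComp (𝕜 : Type u) [Field 𝕜] {S K : Type} [Finite K] (p : S → K) :
    ((STree K →₀ 𝕜) ⧸ lieRel 𝕜 K) ⊗[𝕜]
      (⨂[𝕜] k : K, ((STree (Fib p k) →₀ 𝕜) ⧸ lieRel 𝕜 (Fib p k))) →ₗ[𝕜]
        ((STree S →₀ 𝕜) ⧸ lieRel 𝕜 S) :=
  TensorProduct.lift ((lieRel 𝕜 K).liftQ (lieCompAux 𝕜 p) (by
    intro x hx
    refine LinearMap.mem_ker.mpr (PiTensorProduct.ext (MultilinearMap.ext fun m => ?_))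
    refine (PiTensorProduct.lift.tprod _).trans ?_
    exact (Submodule.Quotient.mk_eq_zero _).mpr (treeComp_outer p x hx _)))

/-- The composition of the Lie operad is given on classes of trees by grafting. -/
theorem lieComp_mk {S K : Type} [Finite K] (p : S → K) (t : STree K)
    (ts : ∀ k, STree (Fib p k)) :
    lieComp 𝕜 p ((lieRel 𝕜 K).mkQ (tr 𝕜 t) ⊗ₜ[𝕜]
      PiTensorProduct.tprod 𝕜 fun k => (lieRel 𝕜 (Fib p k)).mkQ (tr 𝕜 (ts k))) =
      (lieRel 𝕜 S).mkQ (tr 𝕜 (STree.graft p t ts)) := by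
  have h1 := multilinearQuot_mk (fun k => lieRel 𝕜 (Fib p k))
    (((lieRel 𝕜 S).mkQ ∘ₗ treeComp 𝕜 p (tr 𝕜 t)).compMultilinearMap (PiTensorProduct.tprod 𝕜))
    (fun m i hm => (Submodule.Quotient.mk_eq_zero _).mpr (treeComp_inner p _ m i hm))
    (fun k => tr 𝕜 (ts k))
  rw [LinearMap.compMultilinearMap_apply, LinearMap.comp_apply, treeComp_apply,
    ← PiTensorProduct.lift.tprod] at h1
  exact h1

/-- The Lie operad: the composition is induced by grafting of trees, the unit is the trivial
tree. -/
def lieOperad (𝕜 : Type u) [Field 𝕜] : OperadStr (Lie 𝕜) where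
  comp p := lieComp 𝕜 p
  one := (lieRel 𝕜 Unit).mkQ (tr 𝕜 STree.trivial)

/-- The linear dual `Lie^∨` of the Lie operad. -/
def lieDual (𝕜 : Type u) [Field 𝕜] : CooperadStr (Lie 𝕜).dual := (lieOperad 𝕜).dual

end GraphCooperad

end

/-! Everything rests on a pairing of graphs with trees. An S-graph `G` has an antisymmetric
adjacency matrix, and `G.pair 𝕜 t` multiplies, over the nodes of the tree `t`, the total weight of
the edges crossing from the left leaves to the right leaves. For any antisymmetric matrix this
respects anti-symmetry and Jacobi, so a graph gives a functional on `Lie`.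

It also respects the relations on graphs. As a function of the weights of the few edges involved,
the pairing has a very simple form (`exists_pairing_add_edge`, `isTriangleForm_pairing`), and it
vanishes when the weight misses an edge of a tree, because a disconnected weight pairs to zero
(`pairing_eq_zero_of_cut`). These two facts force the sign for a reversed arrow and the Arnold
relation. So the pairing induces a map from `Eil` to the dual of `Lie`.

Grafting of trees corresponds to contraction of graphs. If all fibres of `p` are connected, at most
one edge joins two of them, and the pairing with a grafted tree is the pairing of the contraction
times those of the fibres (`SGraph.pair_graft`); if some fibre is disconnected, it is zero.
Averaging over orientations is invisible to anti-symmetric functionals, so the map from `ACGr` to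
`lieDual` commutes with the cocompositions.

For bijectivity fix `s₀` in S. Jacobi reduces every tree to left-normed trees starting with `s₀`,
and Arnold reduces every graph to paths starting at `s₀`. Both families are indexed by the
enumerations of S from `s₀`, and their pairing matrix is the identity (`Enum.pair_path_tree`), so
they are dual bases. No dimension count is needed.

The cooperad laws are verified directly only for `ACGr`, where coassociativity holds because
averaging is idempotent and commutes with contraction (`SGraph.avgMap_avg`, `grCocomp_avg`). They
pass to `lieDual` and to `Eil` along surjections, with the structure on `Eil` transported from
`lieDual`; associativity of the Lie operad is never checked, nor is it shown by hand that the
relations of `Eil` form a coideal. The inner counit of `ACGr` is the averaging map, which becomes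
the identity only in the quotients. -/

noncomputable section

namespace GraphCooperad

variable {𝕜 : Type u} [Field 𝕜]

/-! ### Trees and cuts -/

section Cuts

variable {V W : Type}

/-- A graph is acyclic if and only if every edge is the only edge of some cut. -/
theorem isAcyclic_iff_cut {G : SimpleGraph V} :
    G.IsAcyclic ↔ ∀ a b, G.Adj a b →
      ∃ X : Set V, a ∈ X ∧ b ∉ X ∧ ∀ x ∈ X, ∀ y ∉ X, G.Adj x y → x = a ∧ y = b := by
  rw [SimpleGraph.isAcyclic_iff_forall_adj_isBridge]
  refine forall_congr' fun a => forall_congr' fun b => forall_congr' fun hab => ?_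
  rw [SimpleGraph.isBridge_iff]
  constructor
  · intro h
    -- The cut is the component of `a` once the edge `ab` is deleted.
    refine ⟨{x | (G.deleteEdges {s(a, b)}).Reachable a x}, SimpleGraph.Reachable.refl _, h, ?_⟩
    intro x hx y hy hxy
    by_contra hne
    by_cases he : s(x, y) = s(a, b)
    · rcases Sym2.eq_iff.mp he with h' | ⟨rfl, rfl⟩
      · exact hne h'
      · exact h hx
    · refine hy (SimpleGraph.Reachable.trans hx (SimpleGraph.Adj.reachable ?_))
      rw [SimpleGraph.deleteEdges_adj]
      exact ⟨hxy, by simpa using he⟩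
  · rintro ⟨X, ha, hb, hX⟩ ⟨w⟩
    -- A walk can leave `X` only through the edge `ab`, which has been deleted.
    have key : ∀ {u v : V} (_ : (G.deleteEdges {s(a, b)}).Walk u v), u ∈ X → v ∈ X := by
      intro u v w
      induction w with
      | nil => exact id
      | @cons u v t h _ ih =>
        intro hu
        refine ih ?_
        by_contra hv
        rw [SimpleGraph.deleteEdges_adj] at h
        obtain ⟨rfl, rfl⟩ := hX _ hu _ hv h.1
        exact h.2 rfl
    exact hb (key w ha)

/-- A graph is connected if and only if it is non-empty and has no empty cuts. -/
theorem connected_iff_cut {G : SimpleGraph V} :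
    G.Connected ↔ Nonempty V ∧
      ∀ X : Set V, X.Nonempty → (∀ x ∈ X, ∀ y, G.Adj x y → y ∈ X) → ∀ y, y ∈ X := by
  constructor
  · intro h
    refine ⟨h.nonempty, fun X ⟨x, hx⟩ hX y => ?_⟩
    obtain ⟨w⟩ := h.preconnected x y
    induction w with
    | nil => exact hx
    | cons h _ ih => exact ih (hX _ hx _ h)
  · rintro ⟨h, hX⟩
    have := h
    refine ⟨fun x y => hX {z | G.Reachable x z} ⟨x, SimpleGraph.Reachable.refl _⟩ ?_ y⟩
    exact fun z hz t ht => SimpleGraph.Reachable.trans hz ht.reachable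

/-- The subgraph on a fibre is connected if and only if the fibre is not separated by a subset of
the vertex set. -/
theorem comap_connected_iff_cut {G : SimpleGraph V} (p : V → W) (k : W) :
    (G.comap (Subtype.val : Fib p k → V)).Connected ↔ (∃ x, p x = k) ∧
      ∀ X : Set V, (∀ x ∈ X, p x = k → ∀ y, p y = k → G.Adj x y → y ∈ X) →
        ∀ x ∈ X, p x = k → ∀ y, p y = k → y ∈ X := by
  rw [connected_iff_cut]
  refine and_congr ⟨fun ⟨x⟩ => ⟨x.1, x.2⟩, fun ⟨x, hx⟩ => ⟨⟨x, hx⟩⟩⟩ ⟨?_, ?_⟩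
  · intro h X hX x hx hxk y hy
    exact h (Subtype.val ⁻¹' X) ⟨⟨x, hxk⟩, hx⟩ (fun z hz t hzt => hX _ hz z.2 _ t.2 hzt) ⟨y, hy⟩
  · rintro h X ⟨x, hx⟩ hX y
    have := h (Subtype.val '' X) (by
      rintro _ ⟨z, hz, rfl⟩ _ t ht hzt
      exact ⟨⟨t, ht⟩, hX _ hz _ hzt, rfl⟩) x.1 ⟨x, hx, rfl⟩ x.2 y.1 y.2
    obtain ⟨z, hz, hzy⟩ := this
    rwa [← Subtype.ext hzy]

namespace SGraph

variable {S T K : Type} (G : SGraph S)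

theorem irrefl (a : S) : ¬ G.arrow a a := fun h => G.asymm a a h h

/-- Two vertices are joined by an edge, of any orientation. -/
def adj (a b : S) : Prop := G.arrow a b ∨ G.arrow b a

theorem adj_iff {a b : S} : (SimpleGraph.fromRel G.arrow).Adj a b ↔ G.adj a b := by
  rw [SimpleGraph.fromRel_adj, adj]
  refine ⟨fun h => h.2, fun h => ⟨?_, h⟩⟩
  rintro rfl
  exact G.irrefl a (by tauto)

variable {G}

theorem adj.symm {a b : S} (h : G.adj a b) : G.adj b a := Or.symm h

theorem adj.ne {a b : S} (h : G.adj a b) : a ≠ b := (G.adj_iff.mpr h).ne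

/-- Every edge is the only edge of some cut. -/
theorem adj.exists_cut {a b : S} (h : G.adj a b) :
    ∃ X : Set S, a ∈ X ∧ b ∉ X ∧ ∀ x ∈ X, ∀ y ∉ X, G.adj x y → x = a ∧ y = b := by
  simpa only [G.adj_iff] using isAcyclic_iff_cut.mp G.isTree.isAcyclic a b (G.adj_iff.mpr h)

variable (G)

theorem nonempty (G : SGraph S) : Nonempty S := G.isTree.connected.nonempty

theorem mem_of_closed (X : Set S) (hX : X.Nonempty)
    (h : ∀ x ∈ X, ∀ y, G.adj x y → y ∈ X) (y : S) : y ∈ X :=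
  (connected_iff_cut.mp G.isTree.connected).2 X hX
    (fun x hx y hxy => h x hx y (G.adj_iff.mp hxy)) y

/-- Construction of graphs from a relation by means of cuts. -/
def ofCut (arrow : S → S → Prop) (asymm : ∀ a b, arrow a b → ¬ arrow b a) (hS : Nonempty S)
    (hconn : ∀ X : Set S, X.Nonempty → (∀ x ∈ X, ∀ y, (arrow x y ∨ arrow y x) → y ∈ X) →
      ∀ y, y ∈ X)
    (hcut : ∀ a b, arrow a b → ∃ X : Set S, a ∈ X ∧ b ∉ X ∧ ∀ x ∈ X, ∀ y ∉ X,
      (arrow x y ∨ arrow y x) → x = a ∧ y = b) : SGraph S where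
  arrow := arrow
  asymm := asymm
  isTree := by
    have hne : ∀ {a b}, (arrow a b ∨ arrow b a) → a ≠ b := by
      rintro a b h rfl
      exact asymm a a (by tauto) (by tauto)
    refine ⟨connected_iff_cut.mpr ⟨hS, fun X h h' => hconn X h fun x hx y hxy => h' x hx y ?_⟩,
      isAcyclic_iff_cut.mpr fun a b hab => ?_⟩
    · exact (SimpleGraph.fromRel_adj _ _ _).mpr ⟨hne hxy, hxy⟩
    · rcases (SimpleGraph.fromRel_adj _ _ _).mp hab with ⟨-, h | h⟩
      · obtain ⟨X, ha, hb, hX⟩ := hcut a b h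
        exact ⟨X, ha, hb, fun x hx y hy hxy => hX x hx y hy ((SimpleGraph.fromRel_adj _ _ _).mp hxy).2⟩
      · obtain ⟨X, ha, hb, hX⟩ := hcut b a h
        refine ⟨Xᶜ, hb, fun h => h ha, fun x hx y hy hxy => ?_⟩
        have := hX y (not_not.mp hy) x hx ((SimpleGraph.fromRel_adj _ _ _).mp hxy).2.symm
        exact this.symm

/-- The inverse image of `k` is a non-empty connected subgraph of `G`. -/
abbrev FibConn (p : S → K) (k : K) : Prop :=
  ((SimpleGraph.fromRel G.arrow).comap (Subtype.val : Fib p k → S)).Connected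

theorem fibConn_iff {p : S → K} {k : K} : G.FibConn p k ↔ (∃ x, p x = k) ∧
    ∀ X : Set S, (∀ x ∈ X, p x = k → ∀ y, p y = k → G.adj x y → y ∈ X) →
      ∀ x ∈ X, p x = k → ∀ y, p y = k → y ∈ X := by
  rw [FibConn, comap_connected_iff_cut]
  simp only [G.adj_iff]

/-- Every edge between different fibres is the only edge of a cut consisting of fibres. -/
theorem exists_cut_fib {p : S → K} (h : ∀ k, G.FibConn p k) {a b : S} (hab : G.adj a b)
    (hp : p a ≠ p b) : ∃ X : Set K, p a ∈ X ∧ p b ∉ X ∧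
      ∀ x y, p x ∈ X → p y ∉ X → G.adj x y → x = a ∧ y = b := by
  obtain ⟨X, ha, hb, hX⟩ := hab.exists_cut
  -- The only edge leaving `X` joins different fibres, so by connectedness `X` splits no fibre.
  have key : ∀ x ∈ X, ∀ y, p y = p x → y ∈ X := by
    intro x hx y hy
    refine (G.fibConn_iff.mp (h (p x))).2 X ?_ x hx rfl y hy
    intro z hz hzx t htx hzt
    by_contra ht
    obtain ⟨rfl, rfl⟩ := hX z hz t ht hzt
    exact hp (hzx.trans htx.symm)
  refine ⟨p '' X, ⟨a, ha, rfl⟩, ?_, ?_⟩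
  · rintro ⟨x, hx, hxb⟩
    exact hb (key x hx b hxb.symm)
  · rintro x y ⟨x', hx', hx⟩ hy hxy
    exact hX x (key x' hx' x hx.symm) y (fun h => hy ⟨y, h, rfl⟩) hxy

/-- A second edge between the same two connected fibres would close a cycle; in terms of cuts, both
edges cross a cut that has only one edge. -/
theorem adj_unique {p : S → K} (h : ∀ k, G.FibConn p k) {a b a' b' : S} (hab : G.adj a b)
    (hp : p a ≠ p b) (hab' : G.adj a' b') (ha : p a' = p a) (hb : p b' = p b) :
    a' = a ∧ b' = b := by
  obtain ⟨X, h1, h2, h3⟩ := G.exists_cut_fib h hab hp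
  exact h3 a' b' (ha ▸ h1) (hb ▸ h2) hab'

/-- Contraction of the fibres of `p`. -/
def quot (p : S → K) (h : ∀ k, G.FibConn p k) : SGraph K :=
  ofCut (fun k l => k ≠ l ∧ ∃ a b, p a = k ∧ p b = l ∧ G.arrow a b)
    (by
      rintro k l ⟨hne, a, b, rfl, rfl, hab⟩ ⟨-, b', a', hb, ha, hab'⟩
      obtain ⟨rfl, rfl⟩ := G.adj_unique h (Or.inl hab) hne (Or.inr hab') ha hb
      exact G.asymm _ _ hab hab')
    (G.nonempty.map p)
    (by
      rintro X ⟨k, hk⟩ hX l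
      obtain ⟨⟨x, rfl⟩, -⟩ := G.fibConn_iff.mp (h k)
      obtain ⟨⟨y, rfl⟩, -⟩ := G.fibConn_iff.mp (h l)
      refine G.mem_of_closed (p ⁻¹' X) ⟨x, hk⟩ (fun z hz t hzt => ?_) y
      by_cases hp : p z = p t
      · rw [Set.mem_preimage, ← hp]; exact hz
      · rcases hzt with h | h
        · exact hX _ hz _ (Or.inl ⟨hp, z, t, rfl, rfl, h⟩)
        · exact hX _ hz _ (Or.inr ⟨Ne.symm hp, t, z, rfl, rfl, h⟩))
    (by
      rintro k l ⟨hne, a, b, rfl, rfl, hab⟩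
      obtain ⟨X, h1, h2, h3⟩ := G.exists_cut_fib h (Or.inl hab) hne
      refine ⟨X, h1, h2, ?_⟩
      rintro k hk l hl (⟨-, a', b', rfl, rfl, hab'⟩ | ⟨-, b', a', rfl, rfl, hab'⟩)
      · obtain ⟨rfl, rfl⟩ := h3 a' b' hk hl (Or.inl hab'); exact ⟨rfl, rfl⟩
      · obtain ⟨rfl, rfl⟩ := h3 a' b' hk hl (Or.inr hab'); exact ⟨rfl, rfl⟩)

/-- A tree which contains another tree is equal to it. -/
theorem adj_of_adj_imp {G H : SGraph S} (h : ∀ a b, G.adj a b → H.adj a b) {a b : S}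
    (hab : H.adj a b) : G.adj a b := by
  obtain ⟨X, ha, hb, hX⟩ := hab.exists_cut
  -- Without the edge `ab`, the cut that `H` crosses only there would be an empty cut of the
  -- connected graph `G`.
  by_contra hn
  refine hb (G.mem_of_closed X ⟨a, ha⟩ (fun x hx y hxy => ?_) b)
  by_contra hy
  obtain ⟨rfl, rfl⟩ := hX x hx y hy (h _ _ hxy)
  exact hn hxy

/-- A tree has no proper spanning subtree and an edge has only one orientation, so one inclusion of
arrows suffices. This halves the work in all later identifications of graphs. -/
theorem ext_of_imp {G H : SGraph S} (h : ∀ a b, G.arrow a b → H.arrow a b) : G = H := by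
  ext a b
  refine ⟨h a b, fun hab => ?_⟩
  rcases adj_of_adj_imp (G := G) (H := H) (fun _ _ => Or.imp (h _ _) (h _ _)) (Or.inl hab) with
    h' | h'
  · exact h'
  · exact (H.asymm _ _ hab (h _ _ h')).elim

/-- The contraction is the only possible quotient along `p`, so the sum over `K` in the
cocomposition has at most one non-zero term. -/
theorem isQuotient_iff {p : S → K} {H : SGraph K} :
    G.IsQuotient H p ↔ ∃ h : ∀ k, G.FibConn p k, H = G.quot p h := by
  constructor
  · intro hq
    refine ⟨hq.connected, (ext_of_imp ?_).symm⟩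
    rintro k l ⟨hne, a, b, rfl, rfl, hab⟩
    exact (hq.edge a b hab).resolve_left hne
  · rintro ⟨h, rfl⟩
    refine ⟨fun a b hab => ?_, h⟩
    by_cases hp : p a = p b
    · exact Or.inl hp
    · exact Or.inr ⟨hp, a, b, rfl, rfl, hab⟩

end SGraph

end Cuts

/-! ### The pairing of weights with trees -/

section Pairing

variable {S T K : Type}

/-- The total weight of the edges from `X` to `Y`. -/
def crossing (w : S → S → 𝕜) (X Y : Multiset S) : 𝕜 :=
  (X.map fun x => (Y.map fun y => w x y).sum).sum

theorem crossing_add_left (w : S → S → 𝕜) (X X' Y : Multiset S) :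
    crossing w (X + X') Y = crossing w X Y + crossing w X' Y := by
  simp [crossing]

theorem crossing_mul (c : 𝕜) (w : S → S → 𝕜) (X Y : Multiset S) :
    crossing (fun x y => c * w x y) X Y = c * crossing w X Y := by
  simp [crossing, Multiset.sum_map_mul_left]

theorem crossing_swap (w : S → S → 𝕜) (hw : ∀ x y, w y x = -w x y) (X Y : Multiset S) :
    crossing w Y X = -crossing w X Y := by
  have : w = fun x y => -1 * w y x := by
    funext x y
    rw [hw y x, neg_one_mul]
  rw [neg_eq_neg_one_mul]
  conv_lhs => rw [this]
  rw [crossing_mul, crossing, crossing, Multiset.sum_map_sum_map]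

theorem crossing_congr {w w' : S → S → 𝕜} {X Y : Multiset S}
    (h : ∀ x ∈ X, ∀ y ∈ Y, w x y = w' x y) : crossing w X Y = crossing w' X Y := by
  refine congrArg Multiset.sum (Multiset.map_congr rfl fun x hx => ?_)
  exact congrArg Multiset.sum (Multiset.map_congr rfl fun y hy => h x hx y hy)

theorem crossing_eq_zero {w : S → S → 𝕜} {X Y : Multiset S}
    (h : ∀ x ∈ X, ∀ y ∈ Y, w x y = 0) : crossing w X Y = 0 := by
  rw [crossing_congr (w' := fun _ _ => 0) h]
  simp [crossing]

theorem crossing_add (w w' : S → S → 𝕜) (X Y : Multiset S) :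
    crossing (fun x y => w x y + w' x y) X Y = crossing w X Y + crossing w' X Y := by
  simp [crossing, Multiset.sum_map_add]

theorem crossing_bind (w : T → T → 𝕜) (f : S → Multiset T) (X Y : Multiset S) :
    crossing w (X.bind f) (Y.bind f) = crossing (fun x y => crossing w (f x) (f y)) X Y := by
  simp only [crossing, Multiset.map_bind, Multiset.sum_bind]
  congr 2
  funext x
  rw [Multiset.sum_map_sum_map]

/-- The pairing of a weight of ordered pairs with a tree: the product over all nodes of the total
weight of the edges from the left to the right of the node. -/
def pairing (w : S → S → 𝕜) : PTree S → 𝕜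
  | .leaf _ => 1
  | .node l r => crossing w l.leaves r.leaves * (pairing w l * pairing w r)

theorem pairing_congr {w w' : S → S → 𝕜} (t : PTree S)
    (h : ∀ x ∈ t.leaves, ∀ y ∈ t.leaves, w x y = w' x y) : pairing w t = pairing w' t := by
  induction t with
  | leaf => rfl
  | node l r hl hr =>
    simp only [PTree.leaves, Multiset.mem_add] at h
    rw [pairing, pairing, crossing_congr fun x hx y hy => h x (Or.inl hx) y (Or.inr hy),
      hl fun x hx y hy => h x (Or.inl hx) y (Or.inl hy),
      hr fun x hx y hy => h x (Or.inr hx) y (Or.inr hy)]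

theorem pairing_swap (w : S → S → 𝕜) (hw : ∀ x y, w y x = -w x y) (l r : PTree S) :
    pairing w (.node r l) = -pairing w (.node l r) := by
  rw [pairing, pairing, crossing_swap w hw]
  ring

theorem _root_.GraphCooperad.Ctx.leaves_plug (R : Ctx S) (t t' : PTree S)
    (h : t.leaves = t'.leaves) : (R.plug t).leaves = (R.plug t').leaves := by
  induction R with
  | hole => exact h
  | left c r ih => simp [Ctx.plug, PTree.leaves, ih]
  | right l c ih => simp [Ctx.plug, PTree.leaves, ih]

/-- The nodes outside the distinguished place see the plugged tree only through its leaves, so their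
factors are common to all trees with the same leaves. -/
theorem pairing_plug (w : S → S → 𝕜) (R : Ctx S) (L : Multiset S) :
    ∃ c : 𝕜, ∀ t : PTree S, t.leaves = L → pairing w (R.plug t) = c * pairing w t := by
  -- A reference tree `t₀` with these leaves is used to write down the constant; if there is none,
  -- the claim is vacuous.
  by_cases hne : ∃ t₀ : PTree S, t₀.leaves = L
  · obtain ⟨t₀, h₀⟩ := hne
    induction R with
    | hole => exact ⟨1, fun t _ => by simp [Ctx.plug]⟩
    | left c r ih =>
      obtain ⟨d, hd⟩ := ih
      refine ⟨crossing w (c.plug t₀).leaves r.leaves * d * pairing w r, fun t ht => ?_⟩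
      rw [Ctx.plug, pairing, hd t ht, c.leaves_plug t t₀ (ht.trans h₀.symm)]
      ring
    | right l c ih =>
      obtain ⟨d, hd⟩ := ih
      refine ⟨crossing w l.leaves (c.plug t₀).leaves * d * pairing w l, fun t ht => ?_⟩
      rw [Ctx.plug, pairing, hd t ht, c.leaves_plug t t₀ (ht.trans h₀.symm)]
      ring
  · exact ⟨0, fun t ht => (hne ⟨t, ht⟩).elim⟩

/-- With `x`, `y`, `z` the crossing weights from `t₁` to `t₂`, `t₂` to `t₃` and `t₃` to `t₁`, the
three terms are `x(y - z)`, `y(z - x)` and `z(x - y)`, up to a common factor. -/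
theorem pairing_jacobi (w : S → S → 𝕜) (hw : ∀ x y, w y x = -w x y) (t₁ t₂ t₃ : PTree S) :
    pairing w (.node (.node t₁ t₂) t₃) + pairing w (.node (.node t₂ t₃) t₁) +
      pairing w (.node (.node t₃ t₁) t₂) = 0 := by
  simp only [pairing, PTree.leaves, crossing_add_left]
  rw [crossing_swap w hw t₁.leaves t₃.leaves, crossing_swap w hw t₁.leaves t₂.leaves,
    crossing_swap w hw t₂.leaves t₃.leaves]
  ring

/-- The nodes of the grafted tree are those of the trees `f x` together with those of `t`, and the
latter see the weights summed over pairs of blocks. -/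
theorem pairing_graft (w : T → T → 𝕜) (f : S → PTree T) (t : PTree S) :
    pairing w (t.graft f) = pairing (fun x y => crossing w (f x).leaves (f y).leaves) t *
      (t.leaves.map fun x => pairing w (f x)).prod := by
  induction t with
  | leaf a => simp [PTree.graft, pairing, PTree.leaves]
  | node l r hl hr =>
    simp only [PTree.graft, pairing, hl, hr, PTree.leaves_graft, crossing_bind, PTree.leaves,
      Multiset.map_add, Multiset.prod_add]
    ring

theorem pairing_relabel (w : T → T → 𝕜) (f : S → T) (t : PTree S) :
    pairing w (t.relabel f) = pairing (fun x y => w (f x) (f y)) t := by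
  rw [PTree.relabel, pairing_graft]
  simp [pairing, PTree.leaves, crossing]

/-- The pairing vanishes if some cut has no edges. -/
theorem pairing_eq_zero_of_cut {w : S → S → 𝕜} (X : Set S)
    (hw : ∀ x ∈ X, ∀ y ∉ X, w x y = 0 ∧ w y x = 0) (t : PTree S)
    (hX : ∃ x ∈ t.leaves, x ∈ X) (hX' : ∃ x ∈ t.leaves, x ∉ X) : pairing w t = 0 := by
  induction t with
  | leaf a =>
    simp only [PTree.leaves, Multiset.mem_singleton, exists_eq_left] at hX hX'
    exact (hX' hX).elim
  | node l r hl hr =>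
    rw [pairing]
    -- Descend as long as one subtree has leaves on both sides of the cut. Where neither has, one
    -- subtree lies in `X` and the other outside, so nothing crosses this node.
    by_cases h1 : (∃ x ∈ l.leaves, x ∈ X) ∧ ∃ x ∈ l.leaves, x ∉ X
    · rw [hl h1.1 h1.2]; ring
    by_cases h2 : (∃ x ∈ r.leaves, x ∈ X) ∧ ∃ x ∈ r.leaves, x ∉ X
    · rw [hr h2.1 h2.2]; ring
    simp only [PTree.leaves, Multiset.mem_add] at hX hX'
    push Not at h1 h2
    obtain ⟨x, hx | hx, hxX⟩ := hX <;> obtain ⟨y, hy | hy, hyX⟩ := hX'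
    · exact (hyX (h1 ⟨x, hx, hxX⟩ y hy)).elim
    · have hl' := h1 ⟨x, hx, hxX⟩
      have hr' : ∀ z ∈ r.leaves, z ∉ X := fun z hz hzX => hyX (h2 ⟨z, hz, hzX⟩ y hy)
      rw [crossing_eq_zero fun x hx y hy => (hw x (hl' x hx) y (hr' y hy)).1, zero_mul]
    · have hr' := h2 ⟨x, hx, hxX⟩
      have hl' : ∀ z ∈ l.leaves, z ∉ X := fun z hz hzX => hyX (h1 ⟨z, hz, hzX⟩ y hy)
      rw [crossing_eq_zero fun x hx y hy => (hw y (hr' y hy) x (hl' x hx)).2, zero_mul]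
    · exact (hyX (h2 ⟨x, hx, hxX⟩ y hy)).elim

open Classical in
/-- The weight of the graph with the single edge `a → b`. -/
def edgeWeight (a b x y : S) : 𝕜 :=
  (if x = a ∧ y = b then 1 else 0) - (if y = a ∧ x = b then 1 else 0)

theorem edgeWeight_swap (a b x y : S) :
    edgeWeight (𝕜 := 𝕜) a b y x = -edgeWeight a b x y := by
  simp only [edgeWeight]; ring

theorem edgeWeight_eq_zero {a b x y : S} (h : ¬ (x = a ∧ y = b)) (h' : ¬ (y = a ∧ x = b)) :
    edgeWeight (𝕜 := 𝕜) a b x y = 0 := by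
  simp [edgeWeight, h, h']

theorem crossing_edgeWeight_of_mem {a b : S} {X Y : Multiset S} (hX : X.Nodup) (hY : Y.Nodup)
    (h : Disjoint X Y) (ha : a ∈ X) (hb : b ∈ Y) :
    crossing (𝕜 := 𝕜) (edgeWeight a b) X Y = 1 := by
  classical
  have hbX : b ∉ X := fun h' => Multiset.disjoint_left.mp h h' hb
  have h1 : ∀ x ∈ X, ∀ y ∈ Y, edgeWeight (𝕜 := 𝕜) a b x y =
      (if x = a then 1 else 0) * (if y = b then 1 else 0) := by
    intro x hx y hy
    have : x ≠ b := fun h => hbX (h ▸ hx)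
    by_cases h2 : x = a <;> by_cases h3 : y = b <;> simp [edgeWeight, h2, h3, this]
    · rintro - rfl; exact this h2
    · rintro - rfl; exact this h2
  have h4 : ∀ (c : S) (Z : Multiset S), Z.Nodup → c ∈ Z →
      (Z.map fun z => if z = c then (1 : 𝕜) else 0).sum = 1 := by
    intro c Z hZ hc
    have := Finset.sum_ite_eq' (⟨Z, hZ⟩ : Finset S) c fun _ => (1 : 𝕜)
    rwa [if_pos (by exact hc)] at this
  rw [crossing_congr h1]
  simp only [crossing, Multiset.sum_map_mul_left, h4 a X hX ha,
    h4 b Y hY hb, mul_one]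

theorem crossing_edgeWeight_of_notMem {a b : S} {X Y : Multiset S}
    (h : ¬ (a ∈ X ∧ b ∈ Y)) (h' : ¬ (b ∈ X ∧ a ∈ Y)) :
    crossing (𝕜 := 𝕜) (edgeWeight a b) X Y = 0 := by
  refine crossing_eq_zero fun x hx y hy => edgeWeight_eq_zero ?_ ?_
  · rintro ⟨rfl, rfl⟩; exact h ⟨hx, hy⟩
  · rintro ⟨rfl, rfl⟩; exact h' ⟨hx, hy⟩

/-- The dependence of the pairing on the weight of one edge. -/
theorem exists_pairing_add_edge (w : S → S → 𝕜) (hw : ∀ x y, w y x = -w x y) {a b : S}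
    (t : PTree S) (ht : t.leaves.Nodup) (ha : a ∈ t.leaves) (hb : b ∈ t.leaves) (hab : a ≠ b) :
    ∃ C W : 𝕜, ∀ s : 𝕜, pairing (fun x y => w x y + s * edgeWeight a b x y) t = C * (W + s) := by
  have const : ∀ t : PTree S, ¬ (a ∈ t.leaves ∧ b ∈ t.leaves) → ∀ s : 𝕜,
      pairing (fun x y => w x y + s * edgeWeight a b x y) t = pairing w t := by
    intro t h s
    refine pairing_congr t fun x hx y hy => ?_
    rw [edgeWeight_eq_zero, mul_zero, add_zero]
    · rintro ⟨rfl, rfl⟩; exact h ⟨hx, hy⟩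
    · rintro ⟨rfl, rfl⟩; exact h ⟨hy, hx⟩
  have hw' : ∀ (s : 𝕜) (x y : S), w y x + s * edgeWeight a b y x =
      -(w x y + s * edgeWeight a b x y) := by
    intro s x y; rw [hw, edgeWeight_swap]; ring
  induction t with
  | leaf c =>
    simp only [PTree.leaves, Multiset.mem_singleton] at ha hb
    exact (hab (ha.trans hb.symm)).elim
  | node l r hl hr =>
    -- Exactly one node separates `a` from `b`. There the weight `s` enters with slope one, and `W`
    -- is the weight already crossing; `C` collects the other factors. Here `a` is on the left; the
    -- mirrored case only changes the sign of `C`.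
    have main : ∀ l r : PTree S, (l.leaves + r.leaves).Nodup → a ∈ l.leaves →
        (b ∈ l.leaves → ∃ C W : 𝕜, ∀ s : 𝕜,
          pairing (fun x y => w x y + s * edgeWeight a b x y) l = C * (W + s)) →
        b ∈ l.leaves + r.leaves → ∃ C W : 𝕜, ∀ s : 𝕜,
          pairing (fun x y => w x y + s * edgeWeight a b x y) (.node l r) = C * (W + s) := by
      intro l r hn ha hl hb
      obtain ⟨nl, nr, hd⟩ := Multiset.nodup_add.mp hn
      have har : a ∉ r.leaves := Multiset.disjoint_left.mp hd ha
      by_cases hbl : b ∈ l.leaves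
      · have hbr : b ∉ r.leaves := Multiset.disjoint_left.mp hd hbl
        obtain ⟨C, W, hCW⟩ := hl hbl
        refine ⟨crossing w l.leaves r.leaves * pairing w r * C, W, fun s => ?_⟩
        rw [pairing, crossing_add, crossing_mul, crossing_edgeWeight_of_notMem (by tauto)
          (by tauto), hCW, const r (by tauto)]
        ring
      · have hbr := (Multiset.mem_add.mp hb).resolve_left hbl
        refine ⟨pairing w l * pairing w r, crossing w l.leaves r.leaves, fun s => ?_⟩
        rw [pairing, crossing_add, crossing_mul, crossing_edgeWeight_of_mem nl nr hd ha hbr,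
          const l (by tauto), const r (by tauto)]
        ring
    have hn : (l.leaves + r.leaves).Nodup := ht
    obtain ⟨nl, nr, hd⟩ := Multiset.nodup_add.mp hn
    rcases Multiset.mem_add.mp ha with ha' | ha'
    · exact main l r hn ha' (hl nl ha') hb
    · obtain ⟨C, W, hCW⟩ := main r l (by rwa [add_comm]) ha' (hr nr ha')
        (by rw [add_comm]; exact hb)
      refine ⟨-C, W, fun s => ?_⟩
      rw [pairing_swap _ (hw' s) r l, hCW]
      ring

/-- Adding the edges of a triangle to a weight. -/
def addTriangle (w : S → S → 𝕜) (a b c : S) (s t r : 𝕜) (x y : S) : 𝕜 :=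
  w x y + (s * edgeWeight a b x y + t * edgeWeight b c x y + r * edgeWeight c a x y)

theorem addTriangle_rotate (w : S → S → 𝕜) (a b c : S) (s t r : 𝕜) :
    addTriangle w b c a t r s = addTriangle w a b c s t r := by
  funext x y
  simp only [addTriangle]
  ring

theorem addTriangle_swap (w : S → S → 𝕜) (hw : ∀ x y, w y x = -w x y) (a b c : S) (s t r : 𝕜)
    (x y : S) : addTriangle w a b c s t r y x = -addTriangle w a b c s t r x y := by
  simp only [addTriangle, hw x y, edgeWeight_swap _ _ x y]
  ring

theorem crossing_addTriangle (w : S → S → 𝕜) (a b c : S) (s t r : 𝕜) (X Y : Multiset S) :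
    crossing (addTriangle w a b c s t r) X Y = crossing w X Y +
      (s * crossing (edgeWeight a b) X Y + t * crossing (edgeWeight b c) X Y +
        r * crossing (edgeWeight c a) X Y) := by
  simp only [← crossing_mul, ← crossing_add]
  rfl

theorem pairing_addTriangle_of_notMem (w : S → S → 𝕜) {a b c : S} (t : PTree S)
    (hc : c ∉ t.leaves) (s r q : 𝕜) : pairing (addTriangle w a b c s r q) t =
      pairing (fun x y => w x y + s * edgeWeight a b x y) t := by
  refine pairing_congr t fun x hx y hy => ?_
  rw [addTriangle, edgeWeight_eq_zero (a := b) (b := c), edgeWeight_eq_zero (a := c) (b := a)]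
  · ring
  all_goals
    rintro ⟨rfl, rfl⟩
    exact hc ‹_›

theorem pairing_addTriangle_of_forall_notMem (w : S → S → 𝕜) {a b c : S} (t : PTree S)
    (h : ∀ x ∈ t.leaves, ∀ y ∈ t.leaves, ¬ (x = a ∧ y = b) ∧ ¬ (x = b ∧ y = c) ∧ ¬ (x = c ∧ y = a))
    (s r q : 𝕜) : pairing (addTriangle w a b c s r q) t = pairing w t := by
  refine pairing_congr t fun x hx y hy => ?_
  have h1 := h x hx y hy
  have h2 := h y hy x hx
  rw [addTriangle, edgeWeight_eq_zero h1.1 h2.1, edgeWeight_eq_zero h1.2.1 h2.2.1,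
    edgeWeight_eq_zero h1.2.2 h2.2.2]
  ring

/-- The ways in which the pairing with a tree can depend on the weights of a triangle. -/
def IsTriangleForm (f : 𝕜 → 𝕜 → 𝕜 → 𝕜) : Prop :=
  ∃ C W W' : 𝕜, (∀ s t r, f s t r = C * (W + s) * (W' + t - r)) ∨
    (∀ s t r, f s t r = C * (W + t) * (W' + r - s)) ∨
    (∀ s t r, f s t r = C * (W + r) * (W' + s - t))

theorem IsTriangleForm.rotate {f g : 𝕜 → 𝕜 → 𝕜 → 𝕜} (h : IsTriangleForm f)
    (hg : ∀ s t r, g s t r = f t r s) : IsTriangleForm g := by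
  obtain ⟨C, W, W', h | h | h⟩ := h
  · exact ⟨C, W, W', Or.inr (Or.inl fun s t r => (hg s t r).trans (h t r s))⟩
  · exact ⟨C, W, W', Or.inr (Or.inr fun s t r => (hg s t r).trans (h t r s))⟩
  · exact ⟨C, W, W', Or.inl fun s t r => (hg s t r).trans (h t r s)⟩

theorem IsTriangleForm.const_mul {f g : 𝕜 → 𝕜 → 𝕜 → 𝕜} (h : IsTriangleForm f) (d : 𝕜)
    (hg : ∀ s t r, g s t r = d * f s t r) : IsTriangleForm g := by
  obtain ⟨C, W, W', h | h | h⟩ := h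
  · exact ⟨d * C, W, W', Or.inl fun s t r => by rw [hg, h]; ring⟩
  · exact ⟨d * C, W, W', Or.inr (Or.inl fun s t r => by rw [hg, h]; ring)⟩
  · exact ⟨d * C, W, W', Or.inr (Or.inr fun s t r => by rw [hg, h]; ring)⟩

/-- In the first form the sum is `C((W+1)(W'+1) + WW' + (W+1)(W'-1))`, which is `2 f(1,0,0) +
f(0,0,0)`; the other forms are its rotations. The four hypotheses say that weights with at most one
edge of the triangle pair to zero. -/
theorem IsTriangleForm.arnold {f : 𝕜 → 𝕜 → 𝕜 → 𝕜} (h : IsTriangleForm f) (h0 : f 0 0 0 = 0)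
    (h1 : f 1 0 0 = 0) (h2 : f 0 1 0 = 0) (h3 : f 0 0 1 = 0) :
    f 1 1 0 + f 0 1 1 + f 1 0 1 = 0 := by
  obtain ⟨C, W, W', h | h | h⟩ := h <;> rw [h] at h0 h1 h2 h3 <;> rw [h, h, h]
  · linear_combination 2 * h1 + h0
  · linear_combination 2 * h2 + h0
  · linear_combination 2 * h3 + h0

/-- The root sees the edges `b → c` and, backwards, `c → a`, whence the factor `W' + t - r`. The
edge `a → b` is seen only inside `l`, whence `C(W + s)`; the subtree `r` sees none of the three. -/
theorem isTriangleForm_split (w : S → S → 𝕜) (hw : ∀ x y, w y x = -w x y) {a b c : S}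
    (l r : PTree S) (hn : (l.leaves + r.leaves).Nodup) (ha : a ∈ l.leaves) (hb : b ∈ l.leaves)
    (hc : c ∈ r.leaves) (hab : a ≠ b) :
    IsTriangleForm fun s t q => pairing (addTriangle w a b c s t q) (.node l r) := by
  obtain ⟨nl, nr, hd⟩ := Multiset.nodup_add.mp hn
  obtain ⟨C, W, h⟩ := exists_pairing_add_edge w hw l nl ha hb hab
  have hcl : c ∉ l.leaves := fun h => Multiset.disjoint_left.mp hd h hc
  have har : a ∉ r.leaves := Multiset.disjoint_left.mp hd ha
  have hbr : b ∉ r.leaves := Multiset.disjoint_left.mp hd hb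
  have h1 : crossing (𝕜 := 𝕜) (edgeWeight c a) l.leaves r.leaves = -1 := by
    rw [crossing_swap _ (edgeWeight_swap c a), crossing_edgeWeight_of_mem nr nl hd.symm hc ha]
  refine ⟨C * pairing w r, W, crossing w l.leaves r.leaves, Or.inl fun s t q => ?_⟩
  beta_reduce
  rw [pairing, crossing_addTriangle, crossing_edgeWeight_of_mem nl nr hd hb hc, h1,
    crossing_edgeWeight_of_notMem (a := a) (by tauto) (by tauto),
    pairing_addTriangle_of_notMem w l hcl, h, pairing_addTriangle_of_forall_notMem w r]
  · ring
  · rintro x hx y hy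
    refine ⟨?_, ?_, ?_⟩ <;> rintro ⟨rfl, rfl⟩ <;> tauto

/-- Descend to the node where `a`, `b`, `c` first fail to lie on one side. Two of them are then
together, and cyclic rotation and swapping the children reduce to `isTriangleForm_split`; every node
above contributes a constant. -/
theorem isTriangleForm_pairing (w : S → S → 𝕜) (hw : ∀ x y, w y x = -w x y) {a b c : S}
    (t : PTree S) (ht : t.leaves.Nodup) (ha : a ∈ t.leaves) (hb : b ∈ t.leaves)
    (hc : c ∈ t.leaves) (hab : a ≠ b) (hbc : b ≠ c) (hca : c ≠ a) :
    IsTriangleForm fun s r q => pairing (addTriangle w a b c s r q) t := by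
  induction t with
  | leaf d =>
    simp only [PTree.leaves, Multiset.mem_singleton] at ha hb
    exact (hab (ha.trans hb.symm)).elim
  | node l r hl hr =>
    have swap : ∀ l r, (IsTriangleForm fun s t q => pairing (addTriangle w a b c s t q)
        (.node r l)) → IsTriangleForm fun s t q => pairing (addTriangle w a b c s t q)
        (.node l r) := by
      intro l r h
      refine h.const_mul (-1) fun s t q => ?_
      rw [pairing_swap _ (addTriangle_swap w hw a b c s t q) r l]
      ring
    have all : ∀ l r, (l.leaves + r.leaves).Nodup → a ∈ l.leaves → b ∈ l.leaves →
        c ∈ l.leaves → (IsTriangleForm fun s t q => pairing (addTriangle w a b c s t q) l) →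
        IsTriangleForm fun s t q => pairing (addTriangle w a b c s t q) (.node l r) := by
      intro l r hn ha hb hc h
      obtain ⟨nl, nr, hd⟩ := Multiset.nodup_add.mp hn
      have har : a ∉ r.leaves := Multiset.disjoint_left.mp hd ha
      have hbr : b ∉ r.leaves := Multiset.disjoint_left.mp hd hb
      have hcr : c ∉ r.leaves := Multiset.disjoint_left.mp hd hc
      refine h.const_mul (crossing w l.leaves r.leaves * pairing w r) fun s t q => ?_
      rw [pairing, crossing_addTriangle, crossing_edgeWeight_of_notMem (a := a) (b := b) (by tauto)
        (by tauto), crossing_edgeWeight_of_notMem (a := b) (by tauto) (by tauto),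
        crossing_edgeWeight_of_notMem (a := c) (by tauto) (by tauto),
        pairing_addTriangle_of_forall_notMem w r]
      · ring
      · rintro x hx y hy
        refine ⟨?_, ?_, ?_⟩ <;> rintro ⟨rfl, rfl⟩ <;> tauto
    have two : ∀ l r, (l.leaves + r.leaves).Nodup →
        (a ∈ l.leaves ∧ b ∈ l.leaves ∧ c ∈ r.leaves) ∨
        (b ∈ l.leaves ∧ c ∈ l.leaves ∧ a ∈ r.leaves) ∨
        (c ∈ l.leaves ∧ a ∈ l.leaves ∧ b ∈ r.leaves) →
        IsTriangleForm fun s t q => pairing (addTriangle w a b c s t q) (.node l r) := by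
      rintro l r hn (⟨h1, h2, h3⟩ | ⟨h1, h2, h3⟩ | ⟨h1, h2, h3⟩)
      · exact isTriangleForm_split w hw l r hn h1 h2 h3 hab
      · exact (isTriangleForm_split w hw l r hn h1 h2 h3 hbc).rotate fun s t q => by
          rw [addTriangle_rotate w a b c]
      · exact ((isTriangleForm_split w hw l r hn h1 h2 h3 hca).rotate fun s t q => rfl).rotate
          fun s t q => by rw [addTriangle_rotate w b c a, addTriangle_rotate w a b c]
    have hn : (l.leaves + r.leaves).Nodup := ht
    have hn' : (r.leaves + l.leaves).Nodup := by rwa [add_comm]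
    obtain ⟨nl, nr, hd⟩ := Multiset.nodup_add.mp hn
    rcases Multiset.mem_add.mp ha with ha' | ha' <;> rcases Multiset.mem_add.mp hb with hb' | hb' <;>
      rcases Multiset.mem_add.mp hc with hc' | hc'
    · exact all l r hn ha' hb' hc' (hl nl ha' hb' hc')
    · exact two l r hn (Or.inl ⟨ha', hb', hc'⟩)
    · exact two l r hn (Or.inr (Or.inr ⟨hc', ha', hb'⟩))
    · exact swap l r (two r l hn' (Or.inr (Or.inl ⟨hb', hc', ha'⟩)))
    · exact two l r hn (Or.inr (Or.inl ⟨hb', hc', ha'⟩))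
    · exact swap l r (two r l hn' (Or.inr (Or.inr ⟨hc', ha', hb'⟩)))
    · exact swap l r (two r l hn' (Or.inl ⟨ha', hb', hc'⟩))
    · exact swap l r (all r l hn' ha' hb' hc' (hr nr ha' hb' hc'))

end Pairing

/-! ### The pairing of graphs with trees -/

section GraphPairing

variable {S T K : Type}

theorem PTree.exists_mem_leaves (t : PTree S) : ∃ a, a ∈ t.leaves := by
  induction t with
  | leaf a => exact ⟨a, by simp [PTree.leaves]⟩
  | node l r hl _ =>
    obtain ⟨a, ha⟩ := hl
    exact ⟨a, Multiset.mem_add.mpr (Or.inl ha)⟩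

namespace SGraph

variable (G : SGraph S)

theorem mem_edges [Finite S] {e : S × S} : e ∈ G.edges ↔ G.arrow e.1 e.2 := by
  simp [edges]

theorem rev_adj (E : Finset (S × S)) {a b : S} : (G.rev E).adj a b ↔ G.adj a b := by
  simp only [adj, rev]
  tauto

theorem rev_empty : G.rev ∅ = G := by
  ext a b
  simp [rev]

theorem rev_insert [DecidableEq (S × S)] {E : Finset (S × S)} {a b : S} (hab : G.arrow a b)
    (h : (a, b) ∉ E) : G.rev (insert (a, b) E) = (G.rev E).rev {(a, b)} := by
  ext x y
  have h1 := G.asymm a b hab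
  simp only [rev, Finset.mem_insert, Finset.mem_singleton, Prod.mk.injEq]
  by_cases h2 : x = a ∧ y = b
  · obtain ⟨rfl, rfl⟩ := h2
    tauto
  · by_cases h3 : y = a ∧ x = b
    · obtain ⟨rfl, rfl⟩ := h3
      tauto
    · tauto

/-- A function on graphs which is anti-symmetric with respect to the orientation of one edge is
anti-symmetric with respect to the orientation of any set of edges. -/
theorem apply_rev [Finite S] {M : Type*} [AddCommGroup M] [Module 𝕜 M] (f : SGraph S → M)
    (hf : ∀ (G : SGraph S) (a b : S), G.arrow a b → f (G.rev {(a, b)}) = -f G)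
    {E : Finset (S × S)} (hE : E ⊆ G.edges) : f (G.rev E) = (-1 : 𝕜) ^ E.card • f G := by
  classical
  induction E using Finset.induction_on with
  | empty => simp [rev_empty]
  | insert e E he ih =>
    obtain ⟨a, b⟩ := e
    have hab := G.mem_edges.mp (hE (Finset.mem_insert_self _ _))
    have hE' := (Finset.subset_insert _ _).trans hE
    rw [G.rev_insert hab he, hf _ _ _ (Or.inl ⟨hab, he⟩), ih hE', Finset.card_insert_of_notMem he,
      pow_succ, mul_neg_one, neg_smul]

/-- Graphs with the same underlying unoriented graph differ by reversing edges. -/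
theorem exists_rev_eq [Finite S] (H : SGraph S) (h : ∀ a b, G.arrow a b → H.adj a b) :
    ∃ E ⊆ G.edges, G.rev E = H := by
  classical
  refine ⟨G.edges.filter fun e => ¬ H.arrow e.1 e.2, Finset.filter_subset _ _, ?_⟩
  refine ext_of_imp fun a b hab => ?_
  simp only [rev, Finset.mem_filter, mem_edges] at hab
  rcases hab with ⟨h1, h2⟩ | ⟨h1, -, h2⟩
  · tauto
  · exact (h b a h1).resolve_left h2

/-- Whichever side of the cut of `ab` contains `c`, one of the other two edges would cross it as
well. -/
theorem no_triangle {a b c : S} (hab : G.adj a b) (hbc : G.adj b c) (hca : G.adj c a) : False := by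
  obtain ⟨X, ha, hb, hX⟩ := hab.exists_cut
  by_cases hc : c ∈ X
  · exact hca.ne (hX c hc b hb hbc.symm).1
  · exact hbc.ne (hX a ha c hc hca.symm).2.symm

variable (𝕜) in
open Classical in
/-- The antisymmetric adjacency matrix of `G`. -/
def weight (x y : S) : 𝕜 := (if G.arrow x y then 1 else 0) - (if G.arrow y x then 1 else 0)

theorem weight_swap (x y : S) : G.weight 𝕜 y x = -G.weight 𝕜 x y := by
  simp only [weight]; ring

variable {G}

theorem weight_congr {H : SGraph S} {x y : S} (h : G.arrow x y ↔ H.arrow x y)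
    (h' : G.arrow y x ↔ H.arrow y x) : G.weight 𝕜 x y = H.weight 𝕜 x y := by
  classical
  rw [weight, weight, if_congr h rfl rfl, if_congr h' rfl rfl]

theorem weight_of_arrow {x y : S} (h : G.arrow x y) : G.weight 𝕜 x y = 1 := by
  simp [weight, h, G.asymm x y h]

theorem weight_eq_zero {x y : S} (h : ¬ G.adj x y) : G.weight 𝕜 x y = 0 := by
  simp only [adj, not_or] at h
  simp [weight, h.1, h.2]

variable (G)

variable (𝕜) in
/-- The pairing of graphs with trees. -/
def pair (t : STree S) : 𝕜 := pairing (G.weight 𝕜) t.1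

/-- The cut that `G` crosses only in the edge `bc` is not crossed at all by a weight supported on
the other edges. -/
theorem pairing_eq_zero_of_missing {G : SGraph S} {b c : S} (hbc : G.adj b c) {w : S → S → 𝕜}
    (hw : ∀ x y, ¬ G.adj x y → w x y = 0) (h : w b c = 0) (h' : w c b = 0) (t : STree S) :
    pairing w t.1 = 0 := by
  obtain ⟨X, hb, hc, hX⟩ := hbc.exists_cut
  refine pairing_eq_zero_of_cut X (fun x hx y hy => ?_) t.1 ⟨b, t.2.2 b, hb⟩ ⟨c, t.2.2 c, hc⟩
  by_cases hxy : G.adj x y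
  · obtain ⟨rfl, rfl⟩ := hX x hx y hy hxy
    exact ⟨h, h'⟩
  · exact ⟨hw x y hxy, hw y x fun h => hxy h.symm⟩

/-- As a function of the weight `s` of this edge the pairing is `C(W + s)`. At `s = 0` the edge is
missing, so `CW = 0`, and the values at `1` and `-1` are opposite. -/
theorem pair_rev_singleton {a b : S} (hab : G.arrow a b) (t : STree S) :
    (G.rev {(a, b)}).pair 𝕜 t = -G.pair 𝕜 t := by
  have hne : a ≠ b := adj.ne (Or.inl hab)
  have hba := G.asymm a b hab
  -- The weight of `G` with the edge `a → b` removed.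
  let w : S → S → 𝕜 := fun x y => G.weight 𝕜 x y - edgeWeight a b x y
  have hw : ∀ x y, w y x = -w x y := fun x y => by
    simp only [w, G.weight_swap x y, edgeWeight_swap a b x y]; ring
  obtain ⟨C, W, h⟩ := exists_pairing_add_edge w hw t.1 t.2.1 (t.2.2 a) (t.2.2 b) hne
  have hw1 : w a b = 0 := by simp [w, weight, edgeWeight, hab, hba, hne]
  have h0 : pairing (fun x y => w x y + 0 * edgeWeight a b x y) t.1 = 0 := by
    simp only [zero_mul, add_zero]
    refine pairing_eq_zero_of_missing (G := G) (Or.inl hab) (fun x y hxy => ?_) hw1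
      (by rw [hw, hw1, neg_zero]) t
    simp only [w]
    rw [weight_eq_zero hxy, edgeWeight_eq_zero, sub_zero]
    · rintro ⟨rfl, rfl⟩; exact hxy (Or.inl hab)
    · rintro ⟨rfl, rfl⟩; exact hxy (Or.inr hab)
  have h1 : G.pair 𝕜 t = pairing (fun x y => w x y + 1 * edgeWeight a b x y) t.1 := by
    simp [pair, w]
  have h2 : (G.rev {(a, b)}).pair 𝕜 t =
      pairing (fun x y => w x y + -1 * edgeWeight a b x y) t.1 := by
    rw [pair]
    refine pairing_congr t.1 fun x _ y _ => ?_
    have hr : ∀ x y, (G.rev {(a, b)}).arrow x y ↔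
        (G.arrow x y ∧ ¬ (x = a ∧ y = b)) ∨ (G.arrow y x ∧ (y = a ∧ x = b)) := by
      intro x y
      simp only [rev, Finset.mem_singleton, Prod.mk.injEq]
    simp only [w]
    by_cases hx : x = a ∧ y = b
    · obtain ⟨rfl, rfl⟩ := hx
      rw [← neg_neg ((G.rev {(x, y)}).weight 𝕜 x y), ← weight_swap,
        weight_of_arrow ((hr y x).mpr (Or.inr ⟨hab, rfl, rfl⟩)), weight_of_arrow hab]
      simp [edgeWeight, hne.symm]
    · by_cases hy : y = a ∧ x = b
      · obtain ⟨rfl, rfl⟩ := hy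
        rw [weight_of_arrow ((hr x y).mpr (Or.inr ⟨hab, rfl, rfl⟩)), weight_swap,
          weight_of_arrow hab]
        simp [edgeWeight, hne]
      · have e1 : (G.rev {(a, b)}).arrow x y ↔ G.arrow x y := by rw [hr]; tauto
        have e2 : (G.rev {(a, b)}).arrow y x ↔ G.arrow y x := by rw [hr]; tauto
        rw [weight_congr e1 e2, edgeWeight_eq_zero hx hy]
        simp
  rw [h1, h2, h, h]
  rw [h] at h0
  linear_combination 2 * h0

-- The hypotheses say that the two named edges are distinct and not in `R`, so that indicator
-- functions add up without double counting.
open Classical in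
theorem HasEdges.weight_eq {G : SGraph S} {R : S → S → Prop} {a b c d : S}
    (h : G.HasEdges R a b c d) (hab : ¬ R a b) (hcd : ¬ R c d)
    (hne : ¬ (c = a ∧ d = b)) (x y : S) :
    G.weight 𝕜 x y = ((if R x y then 1 else 0) - (if R y x then 1 else 0)) +
      (edgeWeight a b x y + edgeWeight c d x y) := by
  have key : ∀ x y, (if G.arrow x y then (1 : 𝕜) else 0) = (if R x y then 1 else 0) +
      ((if x = a ∧ y = b then 1 else 0) + (if x = c ∧ y = d then 1 else 0)) := by
    intro x y
    rw [if_congr (h x y) rfl rfl]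
    by_cases hx : x = a ∧ y = b
    · obtain ⟨rfl, rfl⟩ := hx
      have : ¬ (x = c ∧ y = d) := fun h => hne ⟨h.1.symm, h.2.symm⟩
      simp [hab, this]
    · by_cases hy : x = c ∧ y = d
      · obtain ⟨rfl, rfl⟩ := hy
        simp [hcd, hne]
      · simp [hx, hy]
  simp only [weight, edgeWeight]
  rw [key x y, key y x]
  ring

/-- The pairing vanishes on Arnold expressions. -/
theorem pair_arnold {a b c : S} {R : S → S → Prop} {G₁ G₂ G₃ : SGraph S} (hab : a ≠ b)
    (hbc : b ≠ c) (hca : c ≠ a) (h₁ : G₁.HasEdges R a b b c) (h₂ : G₂.HasEdges R b c c a)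
    (h₃ : G₃.HasEdges R c a a b) (t : STree S) :
    G₁.pair 𝕜 t + G₂.pair 𝕜 t + G₃.pair 𝕜 t = 0 := by
  classical
  have e1 : G₁.arrow a b := (h₁ _ _).mpr (by tauto)
  have e2 : G₁.arrow b c := (h₁ _ _).mpr (by tauto)
  have e3 : G₂.arrow b c := (h₂ _ _).mpr (by tauto)
  have e4 : G₂.arrow c a := (h₂ _ _).mpr (by tauto)
  have e5 : G₃.arrow c a := (h₃ _ _).mpr (by tauto)
  have e6 : G₃.arrow a b := (h₃ _ _).mpr (by tauto)
  have r1 : ∀ x y, R x y → G₁.arrow x y := fun x y h => (h₁ _ _).mpr (by tauto)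
  have r2 : ∀ x y, R x y → G₂.arrow x y := fun x y h => (h₂ _ _).mpr (by tauto)
  have r3 : ∀ x y, R x y → G₃.arrow x y := fun x y h => (h₃ _ _).mpr (by tauto)
  -- An edge of `R` between two of `a`, `b`, `c` would form a triangle in the graph which contains
  -- the other two sides.
  have nab : ¬ (R a b ∨ R b a) := fun h =>
    G₂.no_triangle (Or.imp (r2 _ _) (r2 _ _) h) (Or.inl e3) (Or.inl e4)
  have nbc : ¬ (R b c ∨ R c b) := fun h =>
    G₃.no_triangle (Or.imp (r3 _ _) (r3 _ _) h) (Or.inl e5) (Or.inl e6)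
  have nca : ¬ (R c a ∨ R a c) := fun h =>
    G₁.no_triangle (Or.imp (r1 _ _) (r1 _ _) h) (Or.inl e1) (Or.inl e2)
  push Not at nab nbc nca
  let w : S → S → 𝕜 := fun x y => (if R x y then 1 else 0) - (if R y x then 1 else 0)
  have hw : ∀ x y, w y x = -w x y := fun x y => by simp only [w]; ring
  have hwR : ∀ x y, ¬ R x y → ¬ R y x → w x y = 0 := fun x y h h' => by simp [w, h, h']
  have form := isTriangleForm_pairing w hw t.1 t.2.1 (t.2.2 a) (t.2.2 b) (t.2.2 c) hab hbc hca
  -- A weight supported on the tree `G` but vanishing on its edge `xy` pairs to zero.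
  have zero : ∀ {G : SGraph S} {x y : S} (s r q : 𝕜), G.adj x y →
      (∀ z u, R z u → G.adj z u) → (s ≠ 0 → G.adj a b) → (r ≠ 0 → G.adj b c) →
      (q ≠ 0 → G.adj c a) → addTriangle w a b c s r q x y = 0 →
      pairing (addTriangle w a b c s r q) t.1 = 0 := by
    intro G x y s r q hxy hR hs hr hq h0
    refine pairing_eq_zero_of_missing hxy (fun z u hzu => ?_) h0
      (by rw [addTriangle_swap w hw, h0, neg_zero]) t
    have key : ∀ (v : 𝕜) (d e : S), (v ≠ 0 → G.adj d e) → v * edgeWeight d e z u = 0 := by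
      intro v d e h
      by_cases hv : v = 0
      · rw [hv, zero_mul]
      · rw [edgeWeight_eq_zero, mul_zero]
        · rintro ⟨rfl, rfl⟩; exact hzu (h hv)
        · rintro ⟨rfl, rfl⟩; exact hzu (h hv).symm
    rw [addTriangle, key _ _ _ hs, key _ _ _ hr, key _ _ _ hq,
      hwR z u (fun h => hzu (hR _ _ h)) (fun h => hzu (hR _ _ h).symm)]
    ring
  have wab : w a b = 0 := hwR _ _ nab.1 nab.2
  have wbc : w b c = 0 := hwR _ _ nbc.1 nbc.2
  have wca : w c a = 0 := hwR _ _ nca.1 nca.2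
  have R1 : ∀ z u, R z u → G₁.adj z u := fun z u h => Or.inl (r1 z u h)
  have R2 : ∀ z u, R z u → G₂.adj z u := fun z u h => Or.inl (r2 z u h)
  -- `R` with at most the side `ab`, or with only `bc`, misses an edge of `G₁`; `R` with only `ca`
  -- misses the edge `bc` of `G₂`.
  have key := form.arnold
    (zero 0 0 0 (Or.inl e1) R1 (by simp) (by simp) (by simp) (by simp [addTriangle, wab]))
    (zero 1 0 0 (Or.inl e2) R1 (fun _ => Or.inl e1) (by simp) (by simp)
      (by simp [addTriangle, wbc, edgeWeight, hab.symm, hbc, hbc.symm, hca]))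
    (zero 0 1 0 (Or.inl e1) R1 (by simp) (fun _ => Or.inl e2) (by simp)
      (by simp [addTriangle, wab, edgeWeight, hab, hab.symm, hbc, hca.symm]))
    (zero 0 0 1 (Or.inl e3) R2 (by simp) (by simp) (fun _ => Or.inl e4)
      (by simp [addTriangle, wbc, edgeWeight, hab.symm, hbc, hbc.symm, hca]))
  have p1 : G₁.pair 𝕜 t = pairing (addTriangle w a b c 1 1 0) t.1 :=
    pairing_congr t.1 fun x _ y _ => by
      rw [h₁.weight_eq nab.1 nbc.1 (by tauto)]
      simp [addTriangle, w]
  have p2 : G₂.pair 𝕜 t = pairing (addTriangle w a b c 0 1 1) t.1 :=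
    pairing_congr t.1 fun x _ y _ => by
      rw [h₂.weight_eq nbc.1 nca.1 (by tauto)]
      simp [addTriangle, w]
  have p3 : G₃.pair 𝕜 t = pairing (addTriangle w a b c 1 0 1) t.1 :=
    pairing_congr t.1 fun x _ y _ => by
      rw [h₃.weight_eq nca.1 nab.1 (by tauto)]
      simp only [addTriangle, w]
      ring
  rw [p1, p2, p3]
  exact key

theorem pair_relabel (e : S ≃ T) (t : STree T) :
    (G.relabel e).pair 𝕜 t = G.pair 𝕜 (t.relabel e.symm) :=
  (pairing_relabel (G.weight 𝕜) e.symm t.1).symm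

/-- Two different connected fibres are joined by at most one edge, so the total weight between them
is just an entry of the adjacency matrix of the contraction. -/
theorem crossing_weight_fib [CharZero 𝕜] {p : S → K} (h : ∀ k, G.FibConn p k)
    (ts : ∀ k, STree (Fib p k)) (k l : K) :
    crossing (G.weight 𝕜) ((ts k).1.relabel Subtype.val).leaves
      ((ts l).1.relabel Subtype.val).leaves = (G.quot p h).weight 𝕜 k l := by
  have mem : ∀ k x, x ∈ ((ts k).1.relabel Subtype.val).leaves ↔ p x = k := by
    intro k x
    rw [PTree.leaves_relabel, Multiset.mem_map]
    exact ⟨fun ⟨y, _, hy⟩ => hy ▸ y.2, fun hx => ⟨⟨x, hx⟩, (ts k).2.2 _, rfl⟩⟩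
  have nodup : ∀ k, ((ts k).1.relabel Subtype.val).leaves.Nodup := by
    intro k
    rw [PTree.leaves_relabel]
    exact (ts k).2.1.map Subtype.val_injective
  have one : ∀ k l, (G.quot p h).arrow k l →
      crossing (G.weight 𝕜) ((ts k).1.relabel Subtype.val).leaves
      ((ts l).1.relabel Subtype.val).leaves = 1 := by
    rintro k l ⟨hne, a, b, rfl, rfl, hab⟩
    rw [← crossing_edgeWeight_of_mem (𝕜 := 𝕜) (nodup (p a)) (nodup (p b)) ?_ ((mem _ a).mpr rfl)
      ((mem _ b).mpr rfl)]
    · refine crossing_congr fun x hx y hy => ?_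
      rw [mem] at hx hy
      by_cases hxy : G.adj x y
      · obtain ⟨rfl, rfl⟩ := G.adj_unique h (Or.inl hab) hne hxy hx hy
        rw [weight_of_arrow hab]
        simp [edgeWeight, (adj.ne hxy)]
      · rw [weight_eq_zero hxy, edgeWeight_eq_zero]
        · rintro ⟨rfl, rfl⟩; exact hxy (Or.inl hab)
        · rintro ⟨rfl, rfl⟩; exact hxy (Or.inr hab)
    · refine Multiset.disjoint_left.mpr fun {x} hx hy => hne ?_
      rw [mem] at hx hy
      exact hx.symm.trans hy
  by_cases hkl : (G.quot p h).arrow k l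
  · rw [one k l hkl, weight_of_arrow hkl]
  · by_cases hlk : (G.quot p h).arrow l k
    · rw [crossing_swap _ G.weight_swap, one l k hlk, weight_swap, weight_of_arrow hlk]
    · rw [weight_eq_zero (by simp [adj, hkl, hlk])]
      by_cases hne : k = l
      · subst hne
        -- The weight from a block to itself is its own negative, hence zero in characteristic zero.
        exact self_eq_neg.mp (crossing_swap _ G.weight_swap _ _)
      · refine crossing_eq_zero fun x hx y hy => weight_eq_zero ?_
        rw [mem] at hx hy
        rintro (hxy | hxy)
        · exact hkl ⟨hne, x, y, hx, hy, hxy⟩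
        · exact hlk ⟨Ne.symm hne, y, x, hy, hx, hxy⟩

/-- The pairing with a grafted tree. -/
theorem pair_graft [CharZero 𝕜] [Fintype K] {p : S → K} (h : ∀ k, G.FibConn p k) (t : STree K)
    (ts : ∀ k, STree (Fib p k)) : G.pair 𝕜 (STree.graft p t ts) =
      (G.quot p h).pair 𝕜 t * ∏ k, (G.fib p k (h k)).pair 𝕜 (ts k) := by
  have ht : t.1.leaves = Finset.univ.val :=
    (Multiset.Nodup.ext t.2.1 Finset.univ.nodup).mpr fun k => by simp [t.2.2 k]
  rw [pair, STree.graft, pairing_graft, pair]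
  simp only [G.crossing_weight_fib h]
  rw [ht, Finset.prod_map_val]
  congr 1
  exact Finset.prod_congr rfl fun k _ => pairing_relabel _ _ _

/-- The tree grafted onto the leaf of a disconnected fibre contributes the pairing with a
disconnected weight, which is zero. -/
theorem pair_graft_eq_zero {p : S → K} (h : ¬ ∀ k, G.FibConn p k) (t : STree K)
    (ts : ∀ k, STree (Fib p k)) : G.pair 𝕜 (STree.graft p t ts) = 0 := by
  push Not at h
  obtain ⟨k, hk⟩ := h
  rw [pair, STree.graft, pairing_graft, Multiset.prod_eq_zero, mul_zero]
  refine Multiset.mem_map.mpr ⟨k, t.2.2 k, ?_⟩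
  rw [pairing_relabel]
  rw [fibConn_iff] at hk
  -- The fibre is non-empty because `ts k` has a leaf, so the failure of connectedness is a
  -- separation of the fibre.
  obtain ⟨⟨x, hx⟩, -⟩ := (ts k).1.exists_mem_leaves
  rw [not_and] at hk
  have := hk ⟨x, hx⟩
  push Not at this
  obtain ⟨X, hX, x, hxX, hxk, y, hyk, hyX⟩ := this
  refine pairing_eq_zero_of_cut (Subtype.val ⁻¹' X) (fun x hx y hy => ?_) _
    ⟨⟨x, hxk⟩, (ts k).2.2 _, hxX⟩ ⟨⟨y, hyk⟩, (ts k).2.2 _, hyX⟩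
  have : ¬ G.adj x.1 y.1 := fun h => hy (hX _ hx x.2 _ y.2 h)
  exact ⟨weight_eq_zero this, weight_eq_zero fun h => this h.symm⟩

end SGraph

end GraphPairing

/-! ### Quotients of cooperads -/

section Quotients

theorem tensor_pi_ext {K : Type} {A E : Type u} {B : K → Type u} [AddCommGroup A] [Module 𝕜 A]
    [∀ k, AddCommGroup (B k)] [∀ k, Module 𝕜 (B k)] [AddCommGroup E] [Module 𝕜 E]
    {F F' : A ⊗[𝕜] (⨂[𝕜] k : K, B k) →ₗ[𝕜] E}
    (h : ∀ x y, F (x ⊗ₜ[𝕜] PiTensorProduct.tprod 𝕜 y) = F' (x ⊗ₜ[𝕜] PiTensorProduct.tprod 𝕜 y)) :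
    F = F' := by
  refine TensorProduct.ext (LinearMap.ext fun x => PiTensorProduct.ext (MultilinearMap.ext fun y => ?_))
  exact h x y

theorem tensor_pi_pi_ext {K L : Type} {A E : Type u} {B : K → Type u} {C : L → Type u}
    [AddCommGroup A] [Module 𝕜 A] [∀ k, AddCommGroup (B k)] [∀ k, Module 𝕜 (B k)]
    [∀ k, AddCommGroup (C k)] [∀ k, Module 𝕜 (C k)] [AddCommGroup E] [Module 𝕜 E]
    {F F' : (A ⊗[𝕜] (⨂[𝕜] k : K, B k)) ⊗[𝕜] (⨂[𝕜] l : L, C l) →ₗ[𝕜] E}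
    (h : ∀ x y z, F ((x ⊗ₜ[𝕜] PiTensorProduct.tprod 𝕜 y) ⊗ₜ[𝕜] PiTensorProduct.tprod 𝕜 z) =
      F' ((x ⊗ₜ[𝕜] PiTensorProduct.tprod 𝕜 y) ⊗ₜ[𝕜] PiTensorProduct.tprod 𝕜 z)) :
    F = F' := by
  refine TensorProduct.ext (tensor_pi_ext fun x y =>
    PiTensorProduct.ext (MultilinearMap.ext fun z => ?_))
  exact h x y z

theorem regroup_tmul (C : SymSeq 𝕜) {S K L : Type} [Finite S] [Finite K] [Finite L]
    (p : S → K) (q : K → L) (x : C.obj L) (y : ∀ l, C.obj (Fib q l)) (z : ∀ k, C.obj (Fib p k)) :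
    regroup C p q ((x ⊗ₜ[𝕜] PiTensorProduct.tprod 𝕜 y) ⊗ₜ[𝕜] PiTensorProduct.tprod 𝕜 z) =
      x ⊗ₜ[𝕜] PiTensorProduct.tprod 𝕜 fun l => y l ⊗ₜ[𝕜] PiTensorProduct.tprod 𝕜
        fun k : Fib q l => C.map (fibRestrEquiv p q l k) (z k.1) := by
  simp only [regroup, interchange, group, LinearMap.comp_apply, LinearEquiv.coe_coe,
    TensorProduct.assoc_tmul, LinearMap.lTensor_tmul, PiTensorProduct.lift.tprod,
    MultilinearMap.coe_mk, PiTensorProduct.map_tprod, TensorProduct.lift.tmul,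
    PiTensorProduct.map₂_tprod_tprod, TensorProduct.mk_apply]

theorem SymSeq.Hom.app_map {C D : SymSeq 𝕜} (f : SymSeq.Hom C D) {S T : Type} [Finite S]
    [Finite T] (e : S ≃ T) (x : C.obj S) : f.app T (C.map e x) = D.map e (f.app S x) :=
  LinearMap.congr_fun (f.natural e) x

theorem regroup_natural {C D : SymSeq 𝕜} (f : SymSeq.Hom C D) {S K L : Type} [Finite S] [Finite K]
    [Finite L] (p : S → K) (q : K → L) :
    regroup D p q ∘ₗ TensorProduct.map (TensorProduct.map (f.app L)
        (PiTensorProduct.map fun l => f.app (Fib q l))) (PiTensorProduct.map fun k => f.app (Fib p k)) =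
      TensorProduct.map (f.app L) (PiTensorProduct.map fun l => TensorProduct.map (f.app (Fib q l))
        (PiTensorProduct.map fun k => f.app (Fib (restr p q l) k))) ∘ₗ regroup C p q := by
  refine tensor_pi_pi_ext fun x y z => ?_
  simp only [LinearMap.comp_apply, TensorProduct.map_tmul, PiTensorProduct.map_tprod, regroup_tmul,
    f.app_map]

variable {C D : SymSeq 𝕜} {X : CooperadStr C} {Y : CooperadStr D} {f : SymSeq.Hom C D}

theorem IsCooperadHom.cocomp_apply (hf : IsCooperadHom X Y f) {S K : Type} [Finite S] [Finite K]
    (p : S → K) (x : C.obj S) : Y.cocomp p (f.app S x) =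
      TensorProduct.map (f.app K) (PiTensorProduct.map fun k => f.app (Fib p k)) (X.cocomp p x) :=
  LinearMap.congr_fun (hf.cocomp p) x

/-- The image of a cooperad is a cooperad. -/
theorem CooperadStr.IsCooperad.of_surjective (hX : X.IsCooperad) (hf : IsCooperadHom X Y f)
    (hs : ∀ (S : Type) [Finite S], Function.Surjective (f.app S)) : Y.IsCooperad where
  equivariant {S S' K K'} _ _ _ _ e g p p' h := by
    rw [← LinearMap.cancel_right (hs S), LinearMap.comp_assoc, ← f.natural, ← LinearMap.comp_assoc,
      hf.cocomp, LinearMap.comp_assoc, hX.equivariant e g p p' h, LinearMap.comp_assoc, hf.cocomp]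
    simp only [← LinearMap.comp_assoc]
    congr 1
    refine tensor_pi_ext fun y z => ?_
    simp only [LinearMap.comp_apply, TensorProduct.map_tmul, PiTensorProduct.map_tprod,
      LinearEquiv.coe_coe, PiTensorProduct.reindex_tprod, f.app_map]
  coassoc {S K L} _ _ _ p q := by
    rw [← LinearMap.cancel_right (hs S)]
    have e1 : LinearMap.rTensor _ (Y.cocomp q) ∘ₗ
        TensorProduct.map (f.app K) (PiTensorProduct.map fun k => f.app (Fib p k)) =
        TensorProduct.map (TensorProduct.map (f.app L)
        (PiTensorProduct.map fun l => f.app (Fib q l)))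
          (PiTensorProduct.map fun k => f.app (Fib p k)) ∘ₗ LinearMap.rTensor _ (X.cocomp q) := by
      refine tensor_pi_ext fun x y => ?_
      simp only [LinearMap.comp_apply, TensorProduct.map_tmul, LinearMap.rTensor_tmul,
        hf.cocomp_apply]
    have e2 : LinearMap.lTensor _ (PiTensorProduct.map fun l => Y.cocomp (restr p q l)) ∘ₗ
        TensorProduct.map (f.app L) (PiTensorProduct.map fun l => f.app (Fib (q ∘ p) l)) =
        TensorProduct.map (f.app L) (PiTensorProduct.map fun l =>
          TensorProduct.map (f.app (Fib q l))
            (PiTensorProduct.map fun k => f.app (Fib (restr p q l) k))) ∘ₗ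
          LinearMap.lTensor _ (PiTensorProduct.map fun l => X.cocomp (restr p q l)) := by
      refine tensor_pi_ext fun x y => ?_
      simp only [LinearMap.comp_apply, TensorProduct.map_tmul, LinearMap.lTensor_tmul,
        PiTensorProduct.map_tprod, hf.cocomp_apply]
    rw [LinearMap.comp_assoc, LinearMap.comp_assoc, hf.cocomp, LinearMap.comp_assoc, hf.cocomp,
      ← LinearMap.comp_assoc (X.cocomp p), e1, ← LinearMap.comp_assoc (X.cocomp (q ∘ p)), e2,
      LinearMap.comp_assoc, ← LinearMap.comp_assoc _ _ (regroup D p q), regroup_natural,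
      LinearMap.comp_assoc, hX.coassoc, LinearMap.comp_assoc]

theorem IsCooperadHom.counit_apply (hf : IsCooperadHom X Y f) (x : C.obj Unit) :
    Y.counit (f.app Unit x) = X.counit x := LinearMap.congr_fun hf.counit x

theorem IsCooperadHom.outerCounit (hf : IsCooperadHom X Y f) (S : Type) [Finite S] :
    Y.outerCounit S ∘ₗ f.app S = f.app S ∘ₗ X.outerCounit S := by
  rw [CooperadStr.outerCounit, CooperadStr.outerCounit, LinearMap.comp_assoc, LinearMap.comp_assoc,
    hf.cocomp]
  simp only [← LinearMap.comp_assoc]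
  congr 1
  refine tensor_pi_ext fun x y => ?_
  simp only [LinearMap.comp_apply, TensorProduct.map_tmul, PiTensorProduct.map_tprod,
    LinearEquiv.coe_coe, PiTensorProduct.subsingletonEquiv_apply_tprod, hf.counit_apply,
    TensorProduct.lid_tmul, map_smul, f.app_map]

theorem IsCooperadHom.innerCounit (hf : IsCooperadHom X Y f) (S : Type) [Finite S] :
    Y.innerCounit S ∘ₗ f.app S = f.app S ∘ₗ X.innerCounit S := by
  have := Fintype.ofFinite S
  rw [CooperadStr.innerCounit, CooperadStr.innerCounit, LinearMap.comp_assoc, LinearMap.comp_assoc,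
    hf.cocomp]
  simp only [← LinearMap.comp_assoc]
  congr 1
  refine tensor_pi_ext fun x y => ?_
  simp only [LinearMap.comp_apply, TensorProduct.map_tmul, PiTensorProduct.map_tprod,
    LinearEquiv.coe_coe, LinearMap.lTensor_tmul, PiTensorProduct.dualDistrib_apply,
    TensorProduct.rid_tmul, map_smul, ← f.app_map, hf.counit_apply]

/-- The inner law is required of the source only after applying `f`: for `ACGr` the inner counit is
an averaging map, not the identity. -/
theorem CooperadStr.IsCounital.of_surjective (hf : IsCooperadHom X Y f)
    (hs : ∀ (S : Type) [Finite S], Function.Surjective (f.app S))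
    (ho : ∀ (S : Type) [Finite S], X.outerCounit S = LinearMap.id)
    (hi : ∀ (S : Type) [Finite S], f.app S ∘ₗ X.innerCounit S = f.app S) : Y.IsCounital where
  outer S _ := by
    rw [← LinearMap.cancel_right (hs S), hf.outerCounit, ho]
    rfl
  inner S _ := by
    rw [← LinearMap.cancel_right (hs S), hf.innerCounit, hi]
    rfl

end Quotients

/-! ### Graphs up to reversing edges -/

section Average

variable {S T K L : Type}

namespace SGraph

/-- Graphs with the same underlying unoriented graph. -/
def SameAdj (G H : SGraph S) : Prop := ∀ a b, G.arrow a b → H.adj a b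

variable {G H : SGraph S}

/-- One inclusion suffices because a tree cannot properly contain a tree on the same vertices. -/
theorem SameAdj.adj_iff (h : G.SameAdj H) {a b : S} : G.adj a b ↔ H.adj a b := by
  have h' : ∀ a b, G.adj a b → H.adj a b := by
    rintro a b (hab | hab)
    · exact h a b hab
    · exact (h b a hab).symm
  exact ⟨h' a b, adj_of_adj_imp h'⟩

theorem SameAdj.symm (h : G.SameAdj H) : H.SameAdj G := fun _ _ hab =>
  h.adj_iff.mpr (Or.inl hab)

theorem SameAdj.fibConn (h : G.SameAdj H) {p : S → K} {k : K} (hG : G.FibConn p k) :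
    H.FibConn p k := by
  rw [fibConn_iff] at hG ⊢
  simpa only [h.adj_iff] using hG

theorem quot_adj_iff {p : S → K} {h : ∀ k, G.FibConn p k} {k l : K} :
    (G.quot p h).adj k l ↔ k ≠ l ∧ ∃ a b, p a = k ∧ p b = l ∧ G.adj a b := by
  constructor
  · rintro (⟨hne, a, b, ha, hb, hab⟩ | ⟨hne, a, b, ha, hb, hab⟩)
    · exact ⟨hne, a, b, ha, hb, Or.inl hab⟩
    · exact ⟨hne.symm, b, a, hb, ha, Or.inr hab⟩
  · rintro ⟨hne, a, b, ha, hb, hab | hab⟩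
    · exact Or.inl ⟨hne, a, b, ha, hb, hab⟩
    · exact Or.inr ⟨hne.symm, b, a, hb, ha, hab⟩

theorem SameAdj.quot (h : G.SameAdj H) {p : S → K} (hG : ∀ k, G.FibConn p k)
    (hH : ∀ k, H.FibConn p k) : (G.quot p hG).SameAdj (H.quot p hH) := by
  rintro k l ⟨hne, a, b, ha, hb, hab⟩
  exact quot_adj_iff.mpr ⟨hne, a, b, ha, hb, h a b hab⟩

theorem SameAdj.fib (h : G.SameAdj H) {p : S → K} {k : K} (hG : G.FibConn p k)
    (hH : H.FibConn p k) : (G.fib p k hG).SameAdj (H.fib p k hH) :=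
  fun a b hab => h a.1 b.1 hab

/-- The edges of `G` are the edges of the quotient and those of the fibres. -/
theorem prod_edges [Finite S] [Fintype K] {p : S → K} (h : ∀ k, G.FibConn p k) {M : Type*}
    [CommMonoid M] (g : S → S → M) (g' : K → K → M)
    (hg : ∀ a b, G.arrow a b → p a ≠ p b → g a b = g' (p a) (p b)) :
    ∏ e ∈ G.edges, g e.1 e.2 = (∏ e ∈ (G.quot p h).edges, g' e.1 e.2) *
      ∏ k, ∏ e ∈ (G.fib p k (h k)).edges, g e.1.1 e.2.1 := by
  classical
  rw [← Finset.prod_filter_not_mul_prod_filter _ fun e : S × S => p e.1 = p e.2]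
  congr 1
  · refine Finset.prod_bij (fun e _ => (p e.1, p e.2)) ?_ ?_ ?_ ?_
    · rintro ⟨a, b⟩ hab
      simp only [Finset.mem_filter, mem_edges] at hab ⊢
      exact ⟨hab.2, a, b, rfl, rfl, hab.1⟩
    · rintro ⟨a, b⟩ hab ⟨a', b'⟩ hab' he
      simp only [Finset.mem_filter, mem_edges, Prod.mk.injEq] at hab hab' he ⊢
      exact G.adj_unique h (Or.inl hab'.1) hab'.2 (Or.inl hab.1) he.1 he.2
    · rintro ⟨k, l⟩ hkl
      obtain ⟨hne, a, b, rfl, rfl, hab⟩ := (mem_edges _).mp hkl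
      exact ⟨(a, b), Finset.mem_filter.mpr ⟨(mem_edges _).mpr hab, hne⟩, rfl⟩
    · rintro ⟨a, b⟩ hab
      simp only [Finset.mem_filter, mem_edges] at hab
      exact hg a b hab.1 hab.2
  · rw [← Finset.prod_fiberwise _ fun e : S × S => p e.1]
    refine Finset.prod_congr rfl fun k _ => (Finset.prod_bij (fun e _ => (e.1.1, e.2.1)) ?_ ?_ ?_ ?_).symm
    · rintro ⟨a, b⟩ hab
      simp only [Finset.mem_filter, mem_edges] at hab ⊢
      exact ⟨⟨hab, a.2.trans b.2.symm⟩, a.2⟩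
    · rintro ⟨a, b⟩ _ ⟨a', b'⟩ _ he
      simp only [Prod.mk.injEq] at he
      exact Prod.ext (Subtype.ext he.1) (Subtype.ext he.2)
    · rintro ⟨a, b⟩ hab
      simp only [Finset.mem_filter, mem_edges] at hab
      exact ⟨(⟨a, hab.2⟩, ⟨b, hab.1.2.symm.trans hab.2⟩), (mem_edges _).mpr hab.1.1, rfl⟩
    · rintro ⟨a, b⟩ _
      rfl

variable (𝕜)

/-- The average of the orientations of `G` with signs. -/
def avg [Finite S] (G : SGraph S) : SGraph S →₀ 𝕜 :=
  ((2 : 𝕜) ^ G.edges.card)⁻¹ • ∑ E ∈ G.edges.powerset, (-1 : 𝕜) ^ E.card • gr 𝕜 (G.rev E)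

open Classical in
/-- The coefficient of an orientation `H` of the graph underlying `G` in the average. -/
def coeff [Finite S] (G H : SGraph S) : 𝕜 :=
  ∏ e ∈ G.edges, if H.arrow e.1 e.2 then 2⁻¹ else -2⁻¹

variable {𝕜}

-- Sets of edges correspond bijectively to orientations of the underlying graph. Indexing by
-- orientations makes the sum comparable with those for contractions and fibres.
open Classical in
theorem avg_eq_sum [Finite S] (G : SGraph S) :
    G.avg 𝕜 = ∑ H with G.SameAdj H, G.coeff 𝕜 H • gr 𝕜 H := by
  rw [avg, Finset.smul_sum]
  refine Finset.sum_bij (fun E _ => G.rev E) ?_ ?_ ?_ ?_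
  · intro E _
    refine Finset.mem_filter.mpr ⟨Finset.mem_univ _, fun a b hab => ?_⟩
    rw [rev_adj]
    exact Or.inl hab
  · intro E hE E' hE' h
    rw [Finset.mem_powerset] at hE hE'
    have key : ∀ E E' : Finset (S × S), E ⊆ G.edges → G.rev E = G.rev E' → E ⊆ E' := by
      rintro E E' hE h ⟨a, b⟩ hab
      have h1 : G.arrow a b := G.mem_edges.mp (hE hab)
      have h2 : (G.rev E).arrow b a := Or.inr ⟨h1, hab⟩
      rw [h] at h2
      rcases h2 with h2 | h2
      · exact (G.asymm _ _ h1 h2.1).elim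
      · exact h2.2
    exact (key E E' hE h).antisymm (key E' E hE' h.symm)
  · intro H hH
    obtain ⟨E, hE, rfl⟩ := G.exists_rev_eq H (Finset.mem_filter.mp hH).2
    exact ⟨E, Finset.mem_powerset.mpr hE, rfl⟩
  · intro E hE
    rw [Finset.mem_powerset] at hE
    rw [smul_smul, coeff]
    congr 1
    -- Each edge contributes one half, with a sign exactly if it is reversed.
    have : ∀ e ∈ G.edges, (if (G.rev E).arrow e.1 e.2 then (2⁻¹ : 𝕜) else -2⁻¹) =
        2⁻¹ * if e ∈ E then -1 else 1 := by
      rintro ⟨a, b⟩ hab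
      have hab' := G.mem_edges.mp hab
      have h2 := G.asymm a b hab'
      by_cases h : (a, b) ∈ E <;> simp [rev, h, h2, hab']
    rw [Finset.prod_congr rfl this, Finset.prod_mul_distrib, Finset.prod_const, inv_pow,
      Finset.prod_ite, Finset.prod_const, Finset.prod_const_one, mul_one,
      Finset.filter_mem_eq_inter, Finset.inter_eq_right.mpr hE]

/-- Only the factor of the reversed edge changes: `H` agrees with exactly one of its two
orientations. -/
theorem coeff_rev [Finite S] {a b : S} (hab : G.arrow a b) (h : G.SameAdj H) :
    (G.rev {(a, b)}).coeff 𝕜 H = -G.coeff 𝕜 H := by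
  classical
  have hba := G.asymm a b hab
  have h1 : (G.rev {(a, b)}).edges = insert (b, a) (G.edges.erase (a, b)) := by
    ext ⟨x, y⟩
    simp only [mem_edges, rev, Finset.mem_insert, Finset.mem_erase, Finset.mem_singleton, ne_eq,
      Prod.mk.injEq]
    constructor
    · rintro (h | h)
      · exact Or.inr ⟨h.2, h.1⟩
      · exact Or.inl ⟨h.2.2, h.2.1⟩
    · rintro (⟨rfl, rfl⟩ | h)
      · exact Or.inr ⟨hab, rfl, rfl⟩
      · exact Or.inl ⟨h.2, h.1⟩
  rw [coeff, coeff, h1, Finset.prod_insert, ← Finset.mul_prod_erase G.edges _ (G.mem_edges (e := (a, b)) |>.mpr hab),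
    ← neg_mul]
  · congr 1
    rcases h a b hab with h | h
    · simp [h, H.asymm a b h]
    · simp [h, H.asymm b a h]
  · simp [mem_edges, hba]

theorem avg_rev_singleton [Finite S] {a b : S} (hab : G.arrow a b) :
    (G.rev {(a, b)}).avg 𝕜 = -G.avg 𝕜 := by
  classical
  rw [avg_eq_sum, avg_eq_sum, ← Finset.sum_neg_distrib]
  have hG : G.SameAdj (G.rev {(a, b)}) := fun x y h => G.rev_adj _ |>.mpr (Or.inl h)
  refine Finset.sum_congr (Finset.filter_congr fun H _ => ?_) fun H hH => ?_
  · exact ⟨fun h x y hxy => h.adj_iff.mp (hG x y hxy), fun h x y hxy => h.adj_iff.mp (hG.symm x y hxy)⟩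
  · rw [coeff_rev hab (Finset.mem_filter.mp hH).2, neg_smul]

theorem sameAdj_relabel {e : S ≃ T} : (G.relabel e).SameAdj (H.relabel e) ↔ G.SameAdj H :=
  ⟨fun h a b hab => by
    have := h (e a) (e b) (by simpa [relabel] using hab)
    simpa [adj, relabel] using this, fun h a b hab => h _ _ hab⟩

theorem coeff_relabel [Finite S] [Finite T] (e : S ≃ T) :
    (G.relabel e).coeff 𝕜 (H.relabel e) = G.coeff 𝕜 H := by
  classical
  refine (Finset.prod_bij (fun x _ => (e x.1, e x.2)) ?_ ?_ ?_ ?_).symm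
  · intro x hx
    simpa [mem_edges, relabel] using hx
  · rintro ⟨a, b⟩ _ ⟨a', b'⟩ _ h
    simpa using h
  · rintro ⟨a, b⟩ hab
    exact ⟨(e.symm a, e.symm b), by simpa [mem_edges, relabel] using hab, by simp⟩
  · intro x _
    exact if_congr (by simp [relabel]) rfl rfl

theorem relabel_bijective (e : S ≃ T) : Function.Bijective (relabel e) := by
  refine Function.bijective_iff_has_inverse.mpr ⟨relabel e.symm, fun G => ?_, fun G => ?_⟩ <;>
  · ext a b
    simp [relabel]

theorem mapDomain_avg [Finite S] [Finite T] (e : S ≃ T) (G : SGraph S) :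
    Finsupp.lmapDomain 𝕜 𝕜 (relabel e) (G.avg 𝕜) = (G.relabel e).avg 𝕜 := by
  classical
  rw [avg_eq_sum, avg_eq_sum, map_sum]
  refine Finset.sum_bij (fun H _ => H.relabel e) ?_ (fun _ _ _ _ h => (relabel_bijective e).1 h) ?_ ?_
  · simp [sameAdj_relabel]
  · intro H hH
    obtain ⟨H', rfl⟩ := (relabel_bijective e).2 H
    exact ⟨H', by simpa [sameAdj_relabel] using hH, rfl⟩
  · intro H _
    rw [map_smul, Finsupp.lmapDomain_apply, Finsupp.mapDomain_single, coeff_relabel]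

variable (𝕜 S) in
/-- Averaging over orientations. -/
def avgMap [Finite S] : (SGraph S →₀ 𝕜) →ₗ[𝕜] (SGraph S →₀ 𝕜) :=
  Finsupp.linearCombination 𝕜 fun G => G.avg 𝕜

theorem avgMap_gr [Finite S] (G : SGraph S) : avgMap 𝕜 S (gr 𝕜 G) = G.avg 𝕜 := by
  simp [avgMap]

/-- An anti-symmetric function takes the same values on graphs and on their averages. -/
theorem linearCombination_avg [CharZero 𝕜] [Finite S] {M : Type*} [AddCommGroup M] [Module 𝕜 M]
    (f : (SGraph S →₀ 𝕜) →ₗ[𝕜] M)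
    (hf : ∀ (G : SGraph S) (a b : S), G.arrow a b → f (gr 𝕜 (G.rev {(a, b)})) = -f (gr 𝕜 G))
    (G : SGraph S) : f (G.avg 𝕜) = f (gr 𝕜 G) := by
  -- The sign from reversing the edges in `E` cancels the sign in the average, so all the terms, a
  -- power of two in number, coincide.
  have : ∀ E ∈ G.edges.powerset, (-1 : 𝕜) ^ E.card • f (gr 𝕜 (G.rev E)) = f (gr 𝕜 G) := by
    intro E hE
    rw [G.apply_rev (𝕜 := 𝕜) (fun G => f (gr 𝕜 G)) hf (Finset.mem_powerset.mp hE), smul_smul,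
      ← mul_pow]
    simp
  rw [avg, map_smul, map_sum]
  simp only [map_smul]
  rw [Finset.sum_congr rfl this, Finset.sum_const, Finset.card_powerset, ← Nat.cast_smul_eq_nsmul 𝕜,
    smul_smul, Nat.cast_pow, Nat.cast_ofNat, inv_mul_cancel₀ (pow_ne_zero _ two_ne_zero), one_smul]

/-- Averages are anti-symmetric under reversing an edge, so `linearCombination_avg` applies to
averaging itself. This idempotence is what coassociativity of `ACGr` needs. -/
theorem avgMap_avg [CharZero 𝕜] [Finite S] (G : SGraph S) : avgMap 𝕜 S (G.avg 𝕜) = G.avg 𝕜 := by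
  rw [linearCombination_avg, avgMap_gr]
  intro G a b hab
  rw [avgMap_gr, avgMap_gr, avg_rev_singleton hab]

/-- The coefficient is a product over edges, and each edge belongs either to the contraction or to
one fibre. An edge between fibres has the direction of its image, since it is the only edge above
it. -/
theorem coeff_eq_mul [Finite S] [Fintype K] {p : S → K} (hG : ∀ k, G.FibConn p k)
    (hH : ∀ k, H.FibConn p k) (h : G.SameAdj H) : G.coeff 𝕜 H =
      (G.quot p hG).coeff 𝕜 (H.quot p hH) *
        ∏ k, (G.fib p k (hG k)).coeff 𝕜 (H.fib p k (hH k)) := by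
  classical
  refine prod_edges hG (fun a b => if H.arrow a b then (2⁻¹ : 𝕜) else -2⁻¹)
    (fun k l => if (H.quot p hH).arrow k l then 2⁻¹ else -2⁻¹) fun a b hab hne => ?_
  refine if_congr ⟨fun h => ⟨hne, a, b, rfl, rfl, h⟩, ?_⟩ rfl rfl
  rintro ⟨-, a', b', ha, hb, hab'⟩
  obtain ⟨rfl, rfl⟩ := H.adj_unique hH (h a b hab) hne (Or.inl hab') ha hb
  exact hab'

/-- A graph can be glued from a graph on the quotient and graphs on the fibres. -/
theorem exists_glue {p : S → K} (hG : ∀ k, G.FibConn p k) (H' : SGraph K)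
    (Hs : ∀ k, SGraph (Fib p k)) (h' : (G.quot p hG).SameAdj H')
    (hs : ∀ k, (G.fib p k (hG k)).SameAdj (Hs k)) :
    ∃ (H : SGraph S) (_ : G.SameAdj H) (hH : ∀ k, H.FibConn p k),
      H.quot p hH = H' ∧ (fun k => H.fib p k (hH k)) = Hs := by
  -- Each edge of `G` is oriented by `H'` if it joins different fibres and by the graph on its fibre
  -- otherwise.
  let arrow : S → S → Prop := fun a b => G.adj a b ∧ (p a ≠ p b → H'.arrow (p a) (p b)) ∧
    ∀ h : p a = p b, (Hs (p b)).arrow ⟨a, h⟩ ⟨b, rfl⟩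
  -- The definition of `arrow` places the edge in the fibre of its endpoint `b`; this moves it to
  -- the fibre of `a`.
  have transport : ∀ {k l : K} (hkl : k = l) (a b : S) (ha : p a = k) (hb : p b = k),
      (Hs k).arrow ⟨a, ha⟩ ⟨b, hb⟩ ↔ (Hs l).arrow ⟨a, ha.trans hkl⟩ ⟨b, hb.trans hkl⟩ := by
    rintro k l rfl a b ha hb
    rfl
  have asymm : ∀ a b, arrow a b → ¬ arrow b a := by
    rintro a b ⟨hab, h1, h2⟩ ⟨-, h3, h4⟩
    by_cases h : p a = p b
    · exact (Hs (p b)).asymm _ _ (h2 h) ((transport h _ _ _ _).mp (h4 h.symm))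
    · exact H'.asymm _ _ (h1 h) (h3 (Ne.symm h))
  have total : ∀ a b, G.adj a b → arrow a b ∨ arrow b a := by
    intro a b hab
    by_cases h : p a = p b
    · have : (G.fib p (p b) (hG _)).adj ⟨a, h⟩ ⟨b, rfl⟩ := hab
      rcases (hs (p b)).adj_iff.mp this with h1 | h1
      · exact Or.inl ⟨hab, fun h' => (h' h).elim, fun _ => h1⟩
      · exact Or.inr ⟨hab.symm, fun h' => (h' h.symm).elim,
          fun _ => (transport h.symm _ _ _ _).mp h1⟩
    · have : (G.quot p hG).adj (p a) (p b) := quot_adj_iff.mpr ⟨h, a, b, rfl, rfl, hab⟩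
      rcases h'.adj_iff.mp this with h1 | h1
      · exact Or.inl ⟨hab, fun _ => h1, fun h' => (h h').elim⟩
      · exact Or.inr ⟨hab.symm, fun _ => h1, fun h' => (h h'.symm).elim⟩
  have iff : ∀ a b, (arrow a b ∨ arrow b a) ↔ G.adj a b := fun a b =>
    ⟨fun h => h.elim (fun h => h.1) fun h => h.1.symm, total a b⟩
  let H : SGraph S := ofCut arrow asymm G.nonempty
    (fun X hX h => G.mem_of_closed X hX fun x hx y hxy => h x hx y ((iff x y).mpr hxy))
    (fun a b hab => by
      obtain ⟨X, ha, hb, hX⟩ := hab.1.exists_cut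
      exact ⟨X, ha, hb, fun x hx y hy hxy => hX x hx y hy ((iff x y).mp hxy)⟩)
  have hGH : G.SameAdj H := fun a b hab => total a b (Or.inl hab)
  refine ⟨H, hGH, fun k => hGH.fibConn (hG k), ext_of_imp ?_, funext fun k => ext_of_imp ?_⟩
  · rintro k l ⟨hne, a, b, rfl, rfl, hab⟩
    exact hab.2.1 hne
  · rintro ⟨a, ha⟩ ⟨b, rfl⟩ hab
    exact hab.2.2 ha

end SGraph

variable (𝕜) in
open Classical in
/-- The cocomposition of the graph cooperad, without averages. -/
def grCocomp [Finite S] (p : S → K) : (SGraph S →₀ 𝕜) →ₗ[𝕜]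
    (SGraph K →₀ 𝕜) ⊗[𝕜] (⨂[𝕜] k : K, (SGraph (Fib p k) →₀ 𝕜)) :=
  Finsupp.linearCombination 𝕜 fun G : SGraph S => if h : ∀ k, G.FibConn p k then
    gr 𝕜 (G.quot p h) ⊗ₜ[𝕜] (PiTensorProduct.tprod 𝕜 fun k => gr 𝕜 (G.fib p k (h k))) else 0

theorem grCocomp_gr [Finite S] {p : S → K} {G : SGraph S} (h : ∀ k, G.FibConn p k) :
    grCocomp 𝕜 p (gr 𝕜 G) =
      gr 𝕜 (G.quot p h) ⊗ₜ[𝕜] (PiTensorProduct.tprod 𝕜 fun k => gr 𝕜 (G.fib p k (h k))) := by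
  simp only [grCocomp, Finsupp.linearCombination_single, dif_pos h, one_smul]

theorem grCocomp_gr_of_not [Finite S] {p : S → K} {G : SGraph S} (h : ¬ ∀ k, G.FibConn p k) :
    grCocomp 𝕜 p (gr 𝕜 G) = 0 := by
  simp only [grCocomp, Finsupp.linearCombination_single, dif_neg h, smul_zero]

/-- The cocomposition of the graph cooperad commutes with averages. -/
theorem grCocomp_avg [Finite S] [Finite K] {p : S → K} {G : SGraph S} (h : ∀ k, G.FibConn p k) :
    grCocomp 𝕜 p (G.avg 𝕜) = (G.quot p h).avg 𝕜 ⊗ₜ[𝕜]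
      (PiTensorProduct.tprod 𝕜 fun k => (G.fib p k (h k)).avg 𝕜) := by
  classical
  have := Fintype.ofFinite K
  simp only [SGraph.avg_eq_sum]
  rw [MultilinearMap.map_sum_finset, TensorProduct.sum_tmul, map_sum]
  simp only [TensorProduct.tmul_sum, MultilinearMap.map_smul_univ, TensorProduct.tmul_smul,
    ← TensorProduct.smul_tmul', smul_smul, map_smul]
  rw [← Finset.sum_product']
  have hH : ∀ H ∈ Finset.univ.filter G.SameAdj, ∀ k, H.FibConn p k :=
    fun H hH k => (Finset.mem_filter.mp hH).2.fibConn (h k)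
  -- Orienting `G` amounts to orienting the contraction and all the fibres independently, with
  -- multiplicative coefficients. Injectivity reads off each edge from its part, and surjectivity is
  -- gluing.
  refine Finset.sum_bij (fun H hH' => (H.quot p (hH H hH'), fun k => H.fib p k (hH H hH' k)))
    ?_ ?_ ?_ ?_
  · intro H hH'
    have := (Finset.mem_filter.mp hH').2
    simp only [Finset.mem_product, Finset.mem_filter, Finset.mem_univ, true_and,
      Fintype.mem_piFinset]
    exact ⟨this.quot _ _, fun k => this.fib _ _⟩
  · intro H₁ h₁ H₂ h₂ he
    simp only [Prod.mk.injEq] at he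
    refine SGraph.ext_of_imp fun a b hab => ?_
    by_cases hp : p a = p b
    · have : (H₁.fib p (p b) (hH _ h₁ _)).arrow ⟨a, hp⟩ ⟨b, rfl⟩ := hab
      rw [congrFun he.2 (p b)] at this
      exact this
    · have h3 : (H₁.quot p (hH _ h₁)).arrow (p a) (p b) := ⟨hp, a, b, rfl, rfl, hab⟩
      rw [he.1] at h3
      obtain ⟨-, a', b', ha, hb, hab'⟩ := h3
      have h4 : H₂.adj a b := (Finset.mem_filter.mp h₂).2.adj_iff.mp
        ((Finset.mem_filter.mp h₁).2.adj_iff.mpr (Or.inl hab))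
      obtain ⟨rfl, rfl⟩ := H₂.adj_unique (hH _ h₂) h4 hp (Or.inl hab') ha hb
      exact hab'
  · rintro ⟨H', Hs⟩ hm
    simp only [Finset.mem_product, Finset.mem_filter, Finset.mem_univ, true_and,
      Fintype.mem_piFinset] at hm
    obtain ⟨H, h1, h2, h3, h4⟩ := SGraph.exists_glue h H' Hs hm.1 hm.2
    exact ⟨H, Finset.mem_filter.mpr ⟨Finset.mem_univ _, h1⟩, Prod.ext h3 h4⟩
  · intro H hH'
    rw [grCocomp_gr (hH H hH'),
      SGraph.coeff_eq_mul h (hH H hH') (Finset.mem_filter.mp hH').2, mul_comm]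

end Average

/-! ### The anti-commutative graph cooperad -/

section ACGr

variable {S T K L : Type}

namespace SGraph

variable {G : SGraph S}

theorem fibConn_relabel {S' K' : Type} (e : S ≃ S') (f : K ≃ K') (p : S → K) (p' : S' → K')
    (h : ∀ s, p' (e s) = f (p s)) (k' : K') :
    (G.relabel e).FibConn p' k' ↔ G.FibConn p (f.symm k') := by
  have i : (SimpleGraph.fromRel G.arrow).comap (Subtype.val : Fib p (f.symm k') → S) ≃g
      (SimpleGraph.fromRel (G.relabel e).arrow).comap (Subtype.val : Fib p' k' → S') :=
    { toEquiv := fibEquiv e f p p' h k'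
      map_rel_iff' := by
        intro a b
        simp [SimpleGraph.fromRel_adj, fibEquiv, relabel] }
  exact i.connected_iff.symm

theorem quot_relabel {S' K' : Type} (e : S ≃ S') (f : K ≃ K') (p : S → K) (p' : S' → K')
    (h : ∀ s, p' (e s) = f (p s)) (hG : ∀ k, G.FibConn p k)
    (hG' : ∀ k', (G.relabel e).FibConn p' k') :
    (G.quot p hG).relabel f = (G.relabel e).quot p' hG' := by
  refine ext_of_imp ?_
  rintro k l ⟨hne, a, b, ha, hb, hab⟩
  refine ⟨fun h => hne (congrArg f.symm h), e a, e b, ?_, ?_, by simpa [relabel] using hab⟩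
  · rw [h, ha, Equiv.apply_symm_apply]
  · rw [h, hb, Equiv.apply_symm_apply]

theorem fib_relabel {S' K' : Type} (e : S ≃ S') (f : K ≃ K') (p : S → K) (p' : S' → K')
    (h : ∀ s, p' (e s) = f (p s)) (k' : K') (hG : G.FibConn p (f.symm k'))
    (hG' : (G.relabel e).FibConn p' k') :
    (G.fib p (f.symm k') hG).relabel (fibEquiv e f p p' h k') = (G.relabel e).fib p' k' hG' := rfl

/-- Contracting connected pieces neither creates nor destroys connectedness of a union of pieces. -/
theorem fibConn_quot {p : S → K} (q : K → L) (h : ∀ k, G.FibConn p k) (l : L) :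
    (G.quot p h).FibConn q l ↔ G.FibConn (q ∘ p) l := by
  rw [fibConn_iff, fibConn_iff]
  constructor
  · rintro ⟨⟨k, hk⟩, h'⟩
    obtain ⟨⟨x, rfl⟩, -⟩ := G.fibConn_iff.mp (h k)
    refine ⟨⟨x, hk⟩, fun X hX x hx hxl y hyl => ?_⟩
    -- Within the fibre over `l`, a set closed under adjacency is a union of fibres of `p`, so it
    -- can be pushed down to the contraction.
    have closed : ∀ z ∈ X, q (p z) = l → ∀ t, p t = p z → t ∈ X := by
      intro z hz hzl t ht
      refine (G.fibConn_iff.mp (h (p z))).2 X ?_ z hz rfl t ht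
      intro u hu hup v hvp huv
      refine hX u hu ?_ v ?_ huv
      · rw [Function.comp_apply, hup, hzl]
      · rw [Function.comp_apply, hvp, hzl]
    obtain ⟨z, ⟨hz, hzl⟩, hzy⟩ := h' (p '' {z | z ∈ X ∧ q (p z) = l}) (by
      rintro _ ⟨z, ⟨hz, hzl⟩, rfl⟩ - k hk hzk
      obtain ⟨hne, a, b, ha, rfl, hab⟩ := quot_adj_iff.mp hzk
      have haX := closed z hz hzl a ha
      exact ⟨b, ⟨hX a haX (by rw [Function.comp_apply, ha, hzl]) b hk hab, hk⟩, rfl⟩)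
      (p x) ⟨x, ⟨hx, hxl⟩, rfl⟩ hxl (p y) hyl
    exact closed z hz hzl y hzy.symm
  · rintro ⟨⟨x, hx⟩, h'⟩
    refine ⟨⟨p x, hx⟩, fun Y hY k hk hkl k' hkl' => ?_⟩
    obtain ⟨⟨x, rfl⟩, -⟩ := G.fibConn_iff.mp (h k)
    obtain ⟨⟨y, rfl⟩, -⟩ := G.fibConn_iff.mp (h k')
    refine h' (p ⁻¹' Y) (fun z hz hzl t htl hzt => ?_) x hk hkl y hkl'
    by_cases hp : p z = p t
    · rw [Set.mem_preimage, ← hp]; exact hz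
    · exact hY _ hz hzl _ htl (quot_adj_iff.mpr ⟨hp, z, t, rfl, rfl, hzt⟩)

theorem quot_quot {p : S → K} {q : K → L} (h : ∀ k, G.FibConn p k)
    (hq : ∀ l, (G.quot p h).FibConn q l) (hqp : ∀ l, G.FibConn (q ∘ p) l) :
    (G.quot p h).quot q hq = G.quot (q ∘ p) hqp := by
  refine ext_of_imp ?_
  rintro l l' ⟨hne, k, k', rfl, rfl, -, a, b, rfl, rfl, hab⟩
  exact ⟨hne, a, b, rfl, rfl, hab⟩

theorem fibConn_fib {p : S → K} {q : K → L} {l : L} (hl : G.FibConn (q ∘ p) l) (k : Fib q l) :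
    (G.fib (q ∘ p) l hl).FibConn (restr p q l) k ↔ G.FibConn p k.1 := by
  have i : (SimpleGraph.fromRel G.arrow).comap (Subtype.val : Fib p k.1 → S) ≃g
      (SimpleGraph.fromRel (G.fib (q ∘ p) l hl).arrow).comap
        (Subtype.val : Fib (restr p q l) k → Fib (q ∘ p) l) :=
    { toEquiv := fibRestrEquiv p q l k
      map_rel_iff' := by
        intro a b
        simp [SimpleGraph.fromRel_adj, fibRestrEquiv, fib, Subtype.ext_iff] }
  exact i.connected_iff.symm

theorem fib_quot {p : S → K} {q : K → L} {l : L} (h : ∀ k, G.FibConn p k)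
    (hq : (G.quot p h).FibConn q l) (hl : G.FibConn (q ∘ p) l)
    (hf : ∀ k, (G.fib (q ∘ p) l hl).FibConn (restr p q l) k) :
    (G.quot p h).fib q l hq = (G.fib (q ∘ p) l hl).quot (restr p q l) hf := by
  refine ext_of_imp ?_
  rintro ⟨k, hk⟩ ⟨k', hk'⟩ ⟨hne, a, b, rfl, rfl, hab⟩
  exact ⟨fun h => hne (congrArg Subtype.val h), ⟨a, hk⟩, ⟨b, hk'⟩, rfl, rfl, hab⟩

end SGraph

variable (𝕜) in
/-- The graph `G` as an element of the symmetric sequence `Gr`. -/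
def grOf [Finite S] (G : SGraph S) : (Gr 𝕜).obj S := gr 𝕜 G

variable (𝕜) in
/-- The average of the orientations of `G` as an element of the symmetric sequence `Gr`. -/
def avgOf [Finite S] (G : SGraph S) : (Gr 𝕜).obj S := G.avg 𝕜

variable (𝕜 S) in
/-- Averaging over orientations, on the symmetric sequence `Gr`. -/
def avgHom [Finite S] : (Gr 𝕜).obj S →ₗ[𝕜] (Gr 𝕜).obj S := SGraph.avgMap 𝕜 S

theorem avgHom_grOf [Finite S] (G : SGraph S) : avgHom 𝕜 S (grOf 𝕜 G) = avgOf 𝕜 G :=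
  SGraph.avgMap_gr G

theorem avgHom_avgOf [CharZero 𝕜] [Finite S] (G : SGraph S) :
    avgHom 𝕜 S (avgOf 𝕜 G) = avgOf 𝕜 G :=
  SGraph.avgMap_avg G

variable (𝕜) in
/-- The cocomposition of the graph cooperad, without averages, on the symmetric sequence `Gr`. -/
def grCocompHom [Finite S] [Finite K] (p : S → K) : (Gr 𝕜).obj S →ₗ[𝕜]
    (Gr 𝕜).obj K ⊗[𝕜] (⨂[𝕜] k : K, (Gr 𝕜).obj (Fib p k)) := grCocomp 𝕜 p

theorem grCocompHom_grOf [Finite S] [Finite K] {p : S → K} {G : SGraph S}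
    (h : ∀ k, G.FibConn p k) : grCocompHom 𝕜 p (grOf 𝕜 G) =
      grOf 𝕜 (G.quot p h) ⊗ₜ[𝕜] (PiTensorProduct.tprod 𝕜 fun k => grOf 𝕜 (G.fib p k (h k))) :=
  grCocomp_gr h

theorem grCocompHom_grOf_of_not [Finite S] [Finite K] {p : S → K} {G : SGraph S}
    (h : ¬ ∀ k, G.FibConn p k) : grCocompHom 𝕜 p (grOf 𝕜 G) = 0 := grCocomp_gr_of_not h

theorem grCocompHom_avgOf [Finite S] [Finite K] {p : S → K} {G : SGraph S}
    (h : ∀ k, G.FibConn p k) : grCocompHom 𝕜 p (avgOf 𝕜 G) =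
      avgOf 𝕜 (G.quot p h) ⊗ₜ[𝕜] (PiTensorProduct.tprod 𝕜 fun k => avgOf 𝕜 (G.fib p k (h k))) :=
  grCocomp_avg h

theorem gr_hom_ext [Finite S] {M : Type u} [AddCommGroup M] [Module 𝕜 M]
    {f g : (Gr 𝕜).obj S →ₗ[𝕜] M} (h : ∀ G : SGraph S, f (grOf 𝕜 G) = g (grOf 𝕜 G)) : f = g :=
  Finsupp.lhom_ext' fun G => LinearMap.ext_ring (h G)

theorem Gr_map_gr [Finite S] [Finite T] (e : S ≃ T) (G : SGraph S) :
    (Gr 𝕜).map e (grOf 𝕜 G) = grOf 𝕜 (G.relabel e) := by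
  exact Finsupp.mapDomain_single

theorem Gr_map_avg [Finite S] [Finite T] (e : S ≃ T) (G : SGraph S) :
    (Gr 𝕜).map e (avgOf 𝕜 G) = avgOf 𝕜 (G.relabel e) := SGraph.mapDomain_avg e G

theorem ACGr_cocomp_gr [Finite S] [Finite K] {p : S → K} {G : SGraph S}
    (h : ∀ k, G.FibConn p k) : (ACGr 𝕜).cocomp p (grOf 𝕜 G) = avgOf 𝕜 (G.quot p h) ⊗ₜ[𝕜]
      (PiTensorProduct.tprod 𝕜 fun k => grOf 𝕜 (G.fib p k (h k))) := by
  refine (Finsupp.linearCombination_single 𝕜 1 G).trans ?_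
  rw [one_smul, Finset.sum_eq_single (G.quot p h)]
  · rw [dif_pos (G.isQuotient_iff.mpr ⟨h, rfl⟩)]
    rfl
  · intro H _ hH
    refine dif_neg fun hq => hH ?_
    exact (G.isQuotient_iff.mp hq).2
  · exact fun h => (h (Finset.mem_univ _)).elim

theorem ACGr_cocomp_gr_of_not [Finite S] [Finite K] {p : S → K} {G : SGraph S}
    (h : ¬ ∀ k, G.FibConn p k) : (ACGr 𝕜).cocomp p (grOf 𝕜 G) = 0 := by
  refine (Finsupp.linearCombination_single 𝕜 1 G).trans ?_
  rw [one_smul]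
  exact Finset.sum_eq_zero fun H _ => dif_neg fun hq => h hq.connected

/-- Separating the averaging of the outer factor from the contraction lets `grCocomp_avg` be applied
to the iterated cocomposition. -/
theorem ACGr_cocomp_eq [Finite S] [Finite K] (p : S → K) :
    (ACGr 𝕜).cocomp p = LinearMap.rTensor _ (avgHom 𝕜 K) ∘ₗ grCocompHom 𝕜 p := by
  refine gr_hom_ext fun G => ?_
  rw [LinearMap.comp_apply]
  by_cases h : ∀ k, G.FibConn p k
  · rw [ACGr_cocomp_gr h, grCocompHom_grOf h, LinearMap.rTensor_tmul, avgHom_grOf]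
  · rw [ACGr_cocomp_gr_of_not h, grCocompHom_grOf_of_not h, map_zero]

/-- Contraction turns an average into averages of all the factors, and averaging the outer factor
once more changes nothing. -/
theorem ACGr_cocomp_avg [CharZero 𝕜] [Finite S] [Finite K] {p : S → K} {G : SGraph S}
    (h : ∀ k, G.FibConn p k) : (ACGr 𝕜).cocomp p (avgOf 𝕜 G) = avgOf 𝕜 (G.quot p h) ⊗ₜ[𝕜]
      (PiTensorProduct.tprod 𝕜 fun k => avgOf 𝕜 (G.fib p k (h k))) := by
  rw [ACGr_cocomp_eq, LinearMap.comp_apply, grCocompHom_avgOf h, LinearMap.rTensor_tmul,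
    avgHom_avgOf]

/-- Connectedness of the fibres depends only on the unoriented graph, so every term of the average
is killed. -/
theorem ACGr_cocomp_avg_of_not [Finite S] [Finite K] {p : S → K} {G : SGraph S}
    (h : ¬ ∀ k, G.FibConn p k) : (ACGr 𝕜).cocomp p (avgOf 𝕜 G) = 0 := by
  classical
  have h1 : avgOf 𝕜 G = ∑ H with G.SameAdj H, G.coeff 𝕜 H • grOf 𝕜 H := SGraph.avg_eq_sum G
  rw [h1, map_sum]
  refine Finset.sum_eq_zero fun H hH => ?_
  rw [map_smul, ACGr_cocomp_gr_of_not fun hH' => h fun k =>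
    (Finset.mem_filter.mp hH).2.symm.fibConn (hH' k), smul_zero]

-- For coassociativity, cocomposing the averaged contraction leaves averages on `L` and on the
-- fibres of `q`. The other side has the same averages, the latter now coming from the inner
-- cocompositions. Both sides are non-zero only if all fibres of `p` and of `q ∘ p` are connected.
variable (𝕜) in
theorem ACGr_isCooperad [CharZero 𝕜] : (ACGr 𝕜).IsCooperad where
  equivariant {S S' K K'} _ _ _ _ e f p p' h := by
    refine gr_hom_ext fun G => ?_
    rw [LinearMap.comp_apply, LinearMap.comp_apply, Gr_map_gr]
    by_cases hG : ∀ k, G.FibConn p k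
    · have hG' : ∀ k', (G.relabel e).FibConn p' k' := fun k' =>
        (SGraph.fibConn_relabel e f p p' h k').mpr (hG _)
      rw [ACGr_cocomp_gr hG, ACGr_cocomp_gr hG', TensorProduct.map_tmul, Gr_map_avg,
        SGraph.quot_relabel e f p p' h hG hG', LinearMap.comp_apply, LinearEquiv.coe_coe,
        PiTensorProduct.reindex_tprod, PiTensorProduct.map_tprod]
      congr 2
      funext k'
      rw [Gr_map_gr, SGraph.fib_relabel e f p p' h k' _ (hG' k')]
    · have hG' : ¬ ∀ k', (G.relabel e).FibConn p' k' := fun hG' => hG fun k => by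
        have := (SGraph.fibConn_relabel e f p p' h (f k)).mp (hG' _)
        rwa [Equiv.symm_apply_apply] at this
      rw [ACGr_cocomp_gr_of_not hG, ACGr_cocomp_gr_of_not hG', map_zero]
  coassoc {S K L} _ _ _ p q := by
    refine gr_hom_ext fun G => ?_
    simp only [LinearMap.comp_apply]
    by_cases hG : ∀ k, G.FibConn p k
    · rw [ACGr_cocomp_gr hG, LinearMap.rTensor_tmul]
      by_cases hq : ∀ l, (G.quot p hG).FibConn q l
      · have hqp : ∀ l, G.FibConn (q ∘ p) l := fun l =>
          (SGraph.fibConn_quot q hG l).mp (hq l)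
        have hf : ∀ l k, (G.fib (q ∘ p) l (hqp l)).FibConn (restr p q l) k := fun l k =>
          (SGraph.fibConn_fib (hqp l) k).mpr (hG _)
        rw [ACGr_cocomp_avg hq, ACGr_cocomp_gr hqp, regroup_tmul, LinearMap.lTensor_tmul,
          PiTensorProduct.map_tprod, SGraph.quot_quot hG hq hqp]
        congr 2
        funext l
        rw [ACGr_cocomp_gr (hf l), SGraph.fib_quot hG (hq l) (hqp l) (hf l)]
        congr 2
        funext k
        rw [Gr_map_gr]
        rfl
      · have hqp : ¬ ∀ l, G.FibConn (q ∘ p) l := fun hqp => hq fun l =>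
          (SGraph.fibConn_quot q hG l).mpr (hqp l)
        rw [ACGr_cocomp_avg_of_not hq, ACGr_cocomp_gr_of_not hqp, map_zero, TensorProduct.zero_tmul,
          map_zero]
    · rw [ACGr_cocomp_gr_of_not hG, map_zero, map_zero]
      -- The left side is zero. On the right, the block `q k` around a disconnected fibre over `k`
      -- has a vanishing inner cocomposition, which kills the whole tensor.
      by_cases hqp : ∀ l, G.FibConn (q ∘ p) l
      · push Not at hG
        obtain ⟨k, hk⟩ := hG
        have hf : ¬ ∀ k', (G.fib (q ∘ p) (q k) (hqp (q k))).FibConn (restr p q (q k)) k' :=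
          fun hf => hk ((SGraph.fibConn_fib (hqp (q k)) ⟨k, rfl⟩).mp (hf _))
        rw [ACGr_cocomp_gr hqp, LinearMap.lTensor_tmul, PiTensorProduct.map_tprod,
          (PiTensorProduct.tprod 𝕜).map_coord_zero (q k) (ACGr_cocomp_gr_of_not hf),
          TensorProduct.tmul_zero]
      · rw [ACGr_cocomp_gr_of_not hqp, map_zero]

theorem ACGr_counit_gr (G : SGraph Unit) : (ACGr 𝕜).counit (grOf 𝕜 G) = 1 := by
  refine (Finsupp.linearCombination_single 𝕜 1 G).trans ?_
  simp

theorem SGraph.edges_eq_empty [Finite S] [Subsingleton S] (G : SGraph S) : G.edges = ∅ := by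
  refine Finset.eq_empty_of_forall_notMem fun e he => ?_
  have := G.mem_edges.mp he
  rw [Subsingleton.elim e.2 e.1] at this
  exact G.irrefl _ this

theorem avgOf_of_subsingleton [Finite S] [Subsingleton S] (G : SGraph S) :
    avgOf 𝕜 G = grOf 𝕜 G := by
  simp [avgOf, grOf, SGraph.avg, G.edges_eq_empty, G.rev_empty]
  rfl

theorem SGraph.fibConn_unit (G : SGraph S) (u : Unit) : G.FibConn (fun _ => ()) u := by
  obtain ⟨x⟩ := G.nonempty
  refine G.fibConn_iff.mpr ⟨⟨x, rfl⟩, fun X hX x hx _ y _ => ?_⟩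
  exact G.mem_of_closed X ⟨x, hx⟩ (fun z hz t hzt => hX z hz rfl t rfl hzt) y

theorem SGraph.fibConn_id (G : SGraph S) (s : S) : G.FibConn (id : S → S) s :=
  G.fibConn_iff.mpr ⟨⟨s, rfl⟩, fun X _ x hx hxs y hys => by
    rwa [show y = x from hys.trans hxs.symm]⟩

theorem ACGr_outerCounit (S : Type) [Finite S] : (ACGr 𝕜).outerCounit S = LinearMap.id := by
  refine gr_hom_ext fun G => ?_
  rw [CooperadStr.outerCounit, LinearMap.comp_apply, LinearMap.comp_apply,
    ACGr_cocomp_gr G.fibConn_unit, TensorProduct.map_tmul, avgOf_of_subsingleton,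
    ACGr_counit_gr, LinearMap.comp_apply, LinearEquiv.coe_coe, LinearEquiv.coe_coe,
    PiTensorProduct.subsingletonEquiv_apply_tprod, Gr_map_gr, TensorProduct.lid_tmul, one_smul]
  rfl

/-- The contraction along the identity is `G` itself, but the outer factor gets averaged. Hence the
inner counit law holds only modulo arrow reversal. -/
theorem ACGr_innerCounit (S : Type) [Finite S] :
    (ACGr 𝕜).innerCounit S = avgHom 𝕜 S := by
  have := Fintype.ofFinite S
  refine gr_hom_ext fun G => ?_
  have hG : G.quot id G.fibConn_id = G := by
    refine (SGraph.ext_of_imp fun a b hab => ?_).symm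
    exact ⟨SGraph.adj.ne (Or.inl hab), a, b, rfl, rfl, hab⟩
  rw [CooperadStr.innerCounit, LinearMap.comp_apply, LinearMap.comp_apply,
    ACGr_cocomp_gr G.fibConn_id, LinearMap.lTensor_tmul, PiTensorProduct.dualDistrib_apply,
    LinearEquiv.coe_coe, TensorProduct.rid_tmul, hG, avgHom_grOf]
  simp only [LinearMap.comp_apply, Gr_map_gr, ACGr_counit_gr, Finset.prod_const_one, one_smul]

end ACGr

/-! ### The map from graphs to the linear dual of the Lie operad -/

section ToLieDual

variable {S T K : Type}

variable (𝕜) in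
/-- The class of a tree in the Lie operad. -/
def lieOf [Finite S] (t : STree S) : (Lie 𝕜).obj S := (lieRel 𝕜 S).mkQ (tr 𝕜 t)

theorem lie_hom_ext [Finite S] {M : Type u} [AddCommGroup M] [Module 𝕜 M]
    {f g : (Lie 𝕜).obj S →ₗ[𝕜] M} (h : ∀ t : STree S, f (lieOf 𝕜 t) = g (lieOf 𝕜 t)) : f = g :=
  Submodule.linearMap_qext _ (Finsupp.lhom_ext' fun t => LinearMap.ext_ring (h t))

theorem Lie_map_lieOf [Finite S] [Finite T] (e : S ≃ T) (t : STree S) :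
    (Lie 𝕜).map e (lieOf 𝕜 t) = lieOf 𝕜 (t.relabel e) := by
  refine (Submodule.mapQ_apply _ _ _ (h := lieRel_relabel e) _).trans ?_
  exact congrArg _ Finsupp.mapDomain_single

theorem lieOperad_comp_lieOf [Finite S] [Finite K] (p : S → K) (t : STree K)
    (ts : ∀ k, STree (Fib p k)) : (lieOperad 𝕜).comp p (lieOf 𝕜 t ⊗ₜ[𝕜]
      PiTensorProduct.tprod 𝕜 fun k => lieOf 𝕜 (ts k)) = lieOf 𝕜 (STree.graft p t ts) :=
  lieComp_mk p t ts

/-- The surrounding context contributes a common factor by `pairing_plug`, so it is enough to have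
the relations at the root. -/
theorem lieRel_le_ker (G : SGraph S) :
    lieRel 𝕜 S ≤ LinearMap.ker (Finsupp.linearCombination 𝕜 (G.pair 𝕜)) := by
  refine Submodule.span_le.mpr ?_
  rintro x (⟨R, T₁, T₂, t, t', h, h', rfl⟩ | ⟨R, T₁, T₂, T₃, t, t', t'', h, h', h'', rfl⟩)
  · obtain ⟨c, hc⟩ := pairing_plug (G.weight 𝕜) R (T₁.leaves + T₂.leaves)
    simp only [SetLike.mem_coe, LinearMap.mem_ker, map_add, Finsupp.linearCombination_single,
      one_smul, SGraph.pair, h, h']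
    rw [hc (.node T₁ T₂) rfl, hc (.node T₂ T₁) (add_comm _ _), pairing_swap _ G.weight_swap T₁ T₂]
    ring
  · obtain ⟨c, hc⟩ := pairing_plug (G.weight 𝕜) R (T₁.leaves + T₂.leaves + T₃.leaves)
    simp only [SetLike.mem_coe, LinearMap.mem_ker, map_add, Finsupp.linearCombination_single,
      one_smul, SGraph.pair, h, h', h'']
    rw [hc (.node (.node T₁ T₂) T₃) rfl, hc (.node (.node T₂ T₃) T₁) ?_,
      hc (.node (.node T₃ T₁) T₂) ?_, ← mul_add, ← mul_add, pairing_jacobi _ G.weight_swap, mul_zero]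
    · simp only [PTree.leaves]; abel
    · simp only [PTree.leaves]; abel

variable (𝕜) in
/-- The pairing with a graph as a functional on the Lie operad. -/
def pairDual [Finite S] (G : SGraph S) : Module.Dual 𝕜 ((Lie 𝕜).obj S) :=
  (lieRel 𝕜 S).liftQ (Finsupp.linearCombination 𝕜 (G.pair 𝕜)) (lieRel_le_ker G)

theorem pairDual_lieOf [Finite S] (G : SGraph S) (t : STree S) :
    pairDual 𝕜 G (lieOf 𝕜 t) = G.pair 𝕜 t := by
  refine (Submodule.liftQ_apply _ _ _).trans ?_
  rw [Finsupp.linearCombination_single, one_smul]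

theorem pairDual_rev_singleton [Finite S] (G : SGraph S) (a b : S) (hab : G.arrow a b) :
    pairDual 𝕜 (G.rev {(a, b)}) = -pairDual 𝕜 G := by
  refine lie_hom_ext fun t => ?_
  rw [pairDual_lieOf, G.pair_rev_singleton hab, LinearMap.neg_apply, pairDual_lieOf]

variable (𝕜 S) in
/-- The linear extension of `pairDual`. -/
def pairDualLin [Finite S] : (Gr 𝕜).obj S →ₗ[𝕜] Module.Dual 𝕜 ((Lie 𝕜).obj S) :=
  Finsupp.linearCombination 𝕜 fun G : SGraph S => pairDual 𝕜 G

theorem pairDualLin_grOf [Finite S] (G : SGraph S) :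
    pairDualLin 𝕜 S (grOf 𝕜 G) = pairDual 𝕜 G :=
  (Finsupp.linearCombination_single _ _ _).trans (one_smul _ _)

theorem pairDualLin_map [Finite S] [Finite T] (e : S ≃ T) (x : (Gr 𝕜).obj S) :
    pairDualLin 𝕜 T ((Gr 𝕜).map e x) = ((Lie 𝕜).map e.symm).dualMap (pairDualLin 𝕜 S x) := by
  revert x
  refine LinearMap.congr_fun (f := pairDualLin 𝕜 T ∘ₗ (Gr 𝕜).map e)
    (g := ((Lie 𝕜).map e.symm).dualMap ∘ₗ pairDualLin 𝕜 S) (gr_hom_ext fun G => ?_)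
  rw [LinearMap.comp_apply, LinearMap.comp_apply, Gr_map_gr, pairDualLin_grOf, pairDualLin_grOf]
  refine lie_hom_ext fun t => ?_
  rw [LinearMap.dualMap_apply, Lie_map_lieOf, pairDual_lieOf, pairDual_lieOf, G.pair_relabel]

variable (𝕜) in
/-- The map from graphs to the linear dual of the Lie operad which is given by the pairing. -/
def toLieDual : SymSeq.Hom (Gr 𝕜) (Lie 𝕜).dual where
  app S _ := pairDualLin 𝕜 S
  natural {_ _} _ _ e := LinearMap.ext fun x => pairDualLin_map e x

theorem toLieDual_grOf [Finite S] (G : SGraph S) :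
    (toLieDual 𝕜).app S (grOf 𝕜 G) = pairDual 𝕜 G := pairDualLin_grOf G

theorem toLieDual_avgOf [CharZero 𝕜] [Finite S] (G : SGraph S) :
    (toLieDual 𝕜).app S (avgOf 𝕜 G) = pairDual 𝕜 G := by
  refine (SGraph.linearCombination_avg ((toLieDual 𝕜).app S) (fun G a b hab => ?_) G).trans
    (toLieDual_grOf G)
  refine (toLieDual_grOf _).trans ((pairDual_rev_singleton G a b hab).trans ?_)
  exact congrArg Neg.neg (toLieDual_grOf G).symm

theorem dualTensor_symm_tmul [Fintype K] (A : Type u) (B : K → Type u) [AddCommGroup A] [Module 𝕜 A]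
    [∀ k, AddCommGroup (B k)] [∀ k, Module 𝕜 (B k)] [Module.Finite 𝕜 A]
    [∀ k, Module.Finite 𝕜 (B k)] (f : Module.Dual 𝕜 A) (g : ∀ k, Module.Dual 𝕜 (B k)) (x : A)
    (y : ∀ k, B k) :
    (dualTensor A B).symm (f ⊗ₜ[𝕜] PiTensorProduct.tprod 𝕜 g) (x ⊗ₜ[𝕜] PiTensorProduct.tprod 𝕜 y) =
      f x * ∏ k, g k (y k) := by
  have h : (dualTensor A B).symm (f ⊗ₜ[𝕜] PiTensorProduct.tprod 𝕜 g) =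
      TensorProduct.dualDistrib 𝕜 A _ (f ⊗ₜ[𝕜] PiTensorProduct.dualDistrib
        (PiTensorProduct.tprod 𝕜 g)) := rfl
  rw [h, TensorProduct.dualDistrib_apply, PiTensorProduct.dualDistrib_apply]

/-- Since classes of trees span `Lie`, a multilinear map on its components is determined after
pulling back to the free spaces on trees. -/
theorem tensor_lie_ext [Finite K] (p : S → K) [Finite S] {M : Type u} [AddCommGroup M] [Module 𝕜 M]
    {f g : (Lie 𝕜).obj K ⊗[𝕜] (⨂[𝕜] k : K, (Lie 𝕜).obj (Fib p k)) →ₗ[𝕜] M}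
    (h : ∀ (t : STree K) (ts : ∀ k, STree (Fib p k)),
      f (lieOf 𝕜 t ⊗ₜ[𝕜] PiTensorProduct.tprod 𝕜 fun k => lieOf 𝕜 (ts k)) =
        g (lieOf 𝕜 t ⊗ₜ[𝕜] PiTensorProduct.tprod 𝕜 fun k => lieOf 𝕜 (ts k))) : f = g := by
  refine TensorProduct.ext (lie_hom_ext fun t => PiTensorProduct.ext ?_)
  have key : ∀ F : MultilinearMap 𝕜 (fun k => (Lie 𝕜).obj (Fib p k)) M,
      (∀ ts : ∀ k, STree (Fib p k), F (fun k => lieOf 𝕜 (ts k)) = 0) → F = 0 := by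
    intro F hF
    have h0 : F.compLinearMap (fun k => (lieRel 𝕜 (Fib p k)).mkQ) = 0 := tree_ext p _ _ hF
    ext m
    choose m' hm' using fun k => (lieRel 𝕜 (Fib p k)).mkQ_surjective (m k)
    have := congrArg (fun F => F m') h0
    have e : (fun k => (lieRel 𝕜 (Fib p k)).mkQ (m' k)) = m := funext hm'
    exact (congrArg F e).symm.trans this
  rw [← sub_eq_zero]
  refine key _ fun ts => ?_
  rw [sub_apply, sub_eq_zero]
  exact h t ts

/-- After moving `dualTensor` to the other side, the claim is an equality of functionals that can be
tested on trees, where it is the formula for the pairing with a grafted tree. The averages disappear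
by `toLieDual_avgOf`. -/
theorem toLieDual_isCooperadHom [CharZero 𝕜] :
    IsCooperadHom (ACGr 𝕜) (lieDual 𝕜) (toLieDual 𝕜) where
  cocomp {S K} _ _ p := by
    have := Fintype.ofFinite K
    refine gr_hom_ext fun G => ?_
    have h1 : ((lieDual 𝕜).cocomp p ∘ₗ (toLieDual 𝕜).app S) (grOf 𝕜 G) =
        dualTensor ((Lie 𝕜).obj K) (fun k : K => (Lie 𝕜).obj (Fib p k))
          (((lieOperad 𝕜).comp p).dualMap (pairDual 𝕜 G)) := by
      rw [LinearMap.comp_apply, toLieDual_grOf]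
      rfl
    rw [h1, LinearMap.comp_apply]
    by_cases hG : ∀ k, G.FibConn p k
    · have h2 : TensorProduct.map ((toLieDual 𝕜).app K)
          (PiTensorProduct.map fun k => (toLieDual 𝕜).app (Fib p k))
          ((ACGr 𝕜).cocomp p (grOf 𝕜 G)) = pairDual 𝕜 (G.quot p hG) ⊗ₜ[𝕜]
            PiTensorProduct.tprod 𝕜 fun k => pairDual 𝕜 (G.fib p k (hG k)) := by
        rw [ACGr_cocomp_gr hG, TensorProduct.map_tmul, PiTensorProduct.map_tprod, toLieDual_avgOf]
        simp only [toLieDual_grOf]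
        rfl
      rw [h2]
      refine (LinearEquiv.eq_symm_apply _).mp (tensor_lie_ext p fun t ts => ?_)
      rw [LinearMap.dualMap_apply, lieOperad_comp_lieOf, pairDual_lieOf, G.pair_graft hG]
      refine Eq.trans ?_ (dualTensor_symm_tmul ((Lie 𝕜).obj K)
        (fun k : K => (Lie 𝕜).obj (Fib p k)) _ _ _ _).symm
      simp only [pairDual_lieOf]
    · rw [ACGr_cocomp_gr_of_not hG, map_zero]
      refine (LinearEquiv.eq_symm_apply _).mp (tensor_lie_ext p fun t ts => ?_)
      rw [LinearMap.dualMap_apply, lieOperad_comp_lieOf, pairDual_lieOf, G.pair_graft_eq_zero hG]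
      refine Eq.symm ?_
      exact LinearMap.congr_fun (map_zero (dualTensor ((Lie 𝕜).obj K)
        fun k : K => (Lie 𝕜).obj (Fib p k)).symm) _
  counit := by
    refine gr_hom_ext fun G => ?_
    rw [LinearMap.comp_apply, toLieDual_grOf, ACGr_counit_gr]
    exact (pairDual_lieOf G STree.trivial).trans rfl

end ToLieDual

/-! ### Left-normed trees span the Lie operad -/

section Combs

variable {S : Type}

namespace PTree

/-- The left-normed tree `((t t₁) t₂) … tₙ`. -/
def comb (t : PTree S) (ts : List (PTree S)) : PTree S := ts.foldl node t

/-- The number of nodes. -/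
def numNodes : PTree S → ℕ
  | leaf _ => 0
  | node l r => l.numNodes + r.numNodes + 1

theorem exists_comb_eq_plug (ts : List (PTree S)) : ∃ R : Ctx S, ∀ t, comb t ts = R.plug t := by
  induction ts with
  | nil => exact ⟨.hole, fun _ => rfl⟩
  | cons t₁ ts ih =>
    obtain ⟨R, hR⟩ := ih
    obtain ⟨R', hR'⟩ := R.exists_comp (.left .hole t₁)
    exact ⟨R', fun t => (hR (node t t₁)).trans (hR' t)⟩

theorem leaves_comb_leaf (t : PTree S) (l : List S) :
    (comb t (l.map leaf)).leaves = t.leaves + l := by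
  induction l generalizing t with
  | nil => simp [comb]
  | cons a l ih =>
    change (comb (node t (leaf a)) (l.map leaf)).leaves = _
    rw [ih, leaves, leaves, add_assoc]
    rfl

theorem exists_leaf_or_node (ts : List (PTree S)) : (∃ l : List S, ts = l.map leaf) ∨
    ∃ pre a b post, ts = pre ++ node a b :: post := by
  induction ts with
  | nil => exact Or.inl ⟨[], rfl⟩
  | cons t ts ih =>
    cases t with
    | leaf s =>
      rcases ih with ⟨l, rfl⟩ | ⟨pre, a, b, post, rfl⟩
      · exact Or.inl ⟨s :: l, rfl⟩
      · exact Or.inr ⟨leaf s :: pre, a, b, post, rfl⟩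
    | node a b => exact Or.inr ⟨[], a, b, ts, rfl⟩

variable (𝕜) in
open Classical in
/-- The class of a tree in the Lie operad, `0` if it is not an `S`-tree. -/
def lieClass [Finite S] (t : PTree S) : (Lie 𝕜).obj S :=
  if h : t.leaves.Nodup ∧ ∀ s, s ∈ t.leaves then lieOf 𝕜 ⟨t, h⟩ else 0

variable [Finite S]

/-- All trees in the relation have the same leaves, so either all are S-trees or all classes are `0`
by convention. Hence, as for `lieClass_jacobi`, no side condition on the leaves is needed. -/
theorem lieClass_antisymm (R : Ctx S) (t₁ t₂ : PTree S) :
    lieClass 𝕜 (R.plug (node t₁ t₂)) + lieClass 𝕜 (R.plug (node t₂ t₁)) = 0 := by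
  have hl := R.leaves_plug (node t₁ t₂) (node t₂ t₁) (add_comm _ _)
  by_cases h : (R.plug (node t₁ t₂)).leaves.Nodup ∧ ∀ s, s ∈ (R.plug (node t₁ t₂)).leaves
  · have h' := h
    rw [hl] at h'
    rw [lieClass, lieClass, dif_pos h, dif_pos h']
    exact (Submodule.Quotient.mk_eq_zero _).mpr (Submodule.subset_span
      (Or.inl ⟨R, t₁, t₂, ⟨_, h⟩, ⟨_, h'⟩, rfl, rfl, rfl⟩))
  · have h' := h
    rw [hl] at h'
    rw [lieClass, lieClass, dif_neg h, dif_neg h', add_zero]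

theorem lieClass_jacobi (R : Ctx S) (t₁ t₂ t₃ : PTree S) :
    lieClass 𝕜 (R.plug (node (node t₁ t₂) t₃)) + lieClass 𝕜 (R.plug (node (node t₂ t₃) t₁)) +
      lieClass 𝕜 (R.plug (node (node t₃ t₁) t₂)) = 0 := by
  have hl := R.leaves_plug (node (node t₁ t₂) t₃) (node (node t₂ t₃) t₁)
    (by simp only [leaves]; abel)
  have hl' := R.leaves_plug (node (node t₁ t₂) t₃) (node (node t₃ t₁) t₂)
    (by simp only [leaves]; abel)
  by_cases h : (R.plug (node (node t₁ t₂) t₃)).leaves.Nodup ∧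
    ∀ s, s ∈ (R.plug (node (node t₁ t₂) t₃)).leaves
  · have h' := h
    have h'' := h
    rw [hl] at h'
    rw [hl'] at h''
    rw [lieClass, lieClass, lieClass, dif_pos h, dif_pos h', dif_pos h'']
    exact (Submodule.Quotient.mk_eq_zero _).mpr (Submodule.subset_span
      (Or.inr ⟨R, t₁, t₂, t₃, ⟨_, h⟩, ⟨_, h'⟩, ⟨_, h''⟩, rfl, rfl, rfl, rfl⟩))
  · have h' := h
    have h'' := h
    rw [hl] at h'
    rw [hl'] at h''
    rw [lieClass, lieClass, lieClass, dif_neg h, dif_neg h', dif_neg h'', add_zero, add_zero]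

variable (𝕜) in
/-- The span of the left-normed trees starting with a given leaf. -/
def combSpan (s₀ : S) : Submodule 𝕜 ((Lie 𝕜).obj S) :=
  Submodule.span 𝕜 (Set.range fun l : List S => lieClass 𝕜 (comb (leaf s₀) (l.map leaf)))

/-- Jacobi in the form `[x,[a,b]] = [[x,a],b] - [[x,b],a]` replaces an attached bracket by its two
parts, attached one after the other. This lowers the number of nodes in the attached trees, on which
the induction runs. -/
theorem lieClass_comb_leaf_mem (s₀ : S) (n : ℕ) (ts : List (PTree S))
    (hn : (ts.map numNodes).sum ≤ n) : lieClass 𝕜 (comb (leaf s₀) ts) ∈ combSpan 𝕜 s₀ := by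
  induction n generalizing ts with
  | zero =>
    rcases exists_leaf_or_node ts with ⟨l, rfl⟩ | ⟨pre, a, b, post, rfl⟩
    · exact Submodule.subset_span ⟨l, rfl⟩
    · simp only [List.map_append, List.map_cons, List.sum_append, List.sum_cons, numNodes] at hn
      omega
  | succ n ih =>
    rcases exists_leaf_or_node ts with ⟨l, rfl⟩ | ⟨pre, a, b, post, rfl⟩
    · exact Submodule.subset_span ⟨l, rfl⟩
    · obtain ⟨R, hR⟩ := exists_comb_eq_plug post
      -- `R'` is the place of the inner bracket in `[[b,x],a]`; anti-symmetry there turns the third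
      -- term of Jacobi into `[[x,b],a]`.
      obtain ⟨R', hR'⟩ := R.exists_comp (.left .hole a)
      have split : ∀ us, comb (leaf s₀) (pre ++ us) = comb (comb (leaf s₀) pre) us :=
        fun us => List.foldl_append
      have h1 := ih (pre ++ a :: b :: post) (by
        simp only [List.map_append, List.map_cons, List.sum_append, List.sum_cons, numNodes] at hn ⊢
        omega)
      have h2 := ih (pre ++ b :: a :: post) (by
        simp only [List.map_append, List.map_cons, List.sum_append, List.sum_cons, numNodes] at hn ⊢
        omega)
      rw [split] at h1 h2 ⊢
      generalize comb (leaf s₀) pre = x at h1 h2 ⊢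
      have e1 : comb x (a :: b :: post) = R.plug (node (node x a) b) := hR _
      have e2 : comb x (b :: a :: post) = R.plug (node (node x b) a) := hR _
      have e3 : comb x (node a b :: post) = R.plug (node x (node a b)) := hR _
      rw [e1] at h1
      rw [e2] at h2
      rw [e3]
      have j := lieClass_jacobi (𝕜 := 𝕜) R x a b
      have s1 := lieClass_antisymm (𝕜 := 𝕜) R x (node a b)
      have s2 := lieClass_antisymm (𝕜 := 𝕜) R' b x
      rw [← hR', ← hR'] at s2
      simp only [Ctx.plug] at s2
      have : lieClass 𝕜 (R.plug (node x (node a b))) = lieClass 𝕜 (R.plug (node (node x a) b)) -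
          lieClass 𝕜 (R.plug (node (node x b) a)) := by
        rw [eq_neg_of_add_eq_zero_left s2] at j
        rw [eq_neg_of_add_eq_zero_left s1, neg_eq_iff_add_eq_zero, ← j]
        abel
      rw [this]
      exact sub_mem h1 h2

/-- Descend in `t` towards the leaf `s₀`, moving each sibling passed to the list of attached trees;
if `s₀` lies on the right, swap first at the cost of a sign. -/
theorem lieClass_comb_mem {s₀ : S} (t : PTree S) (ht : s₀ ∈ t.leaves) (ts : List (PTree S)) :
    lieClass 𝕜 (comb t ts) ∈ combSpan 𝕜 s₀ := by
  induction t generalizing ts with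
  | leaf a =>
    obtain rfl : s₀ = a := by simpa [leaves] using ht
    exact lieClass_comb_leaf_mem s₀ _ ts le_rfl
  | node l r hl hr =>
    rcases Multiset.mem_add.mp ht with h | h
    · exact hl h (r :: ts)
    · obtain ⟨R, hR⟩ := exists_comb_eq_plug ts
      have := lieClass_antisymm (𝕜 := 𝕜) R l r
      rw [hR, eq_neg_of_add_eq_zero_left this, ← hR]
      exact neg_mem (hr h (l :: ts))

theorem combSpan_eq_top (s₀ : S) : combSpan 𝕜 s₀ = ⊤ := by
  rw [eq_top_iff]
  have : ∀ t : STree S, lieOf 𝕜 t ∈ combSpan 𝕜 s₀ := by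
    intro t
    have h := lieClass_comb_mem (𝕜 := 𝕜) t.1 (t.2.2 s₀) []
    change lieClass 𝕜 t.1 ∈ _ at h
    rwa [lieClass, dif_pos t.2] at h
  have h0 : (combSpan 𝕜 s₀).mkQ = 0 := lie_hom_ext fun t => by
    rw [LinearMap.zero_apply, Submodule.mkQ_apply, Submodule.Quotient.mk_eq_zero]
    exact this t
  intro x _
  rw [← Submodule.Quotient.mk_eq_zero, ← Submodule.mkQ_apply, h0, LinearMap.zero_apply]

end PTree

/-- The enumerations of `S` which start with `s₀`. -/
def Enum (s₀ : S) : Type := {l : List S // (s₀ :: l).Nodup ∧ ∀ s, s ∈ s₀ :: l}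

/-- The left-normed tree of an enumeration. -/
def Enum.tree {s₀ : S} (l : Enum s₀) : STree S :=
  ⟨PTree.comb (.leaf s₀) (l.1.map .leaf), by
    have : (PTree.comb (.leaf s₀) (l.1.map .leaf)).leaves = ((s₀ :: l.1 : List S) : Multiset S) :=
      PTree.leaves_comb_leaf _ _
    rw [this]
    exact ⟨Multiset.coe_nodup.mpr l.2.1, fun s => Multiset.mem_coe.mpr (l.2.2 s)⟩⟩

theorem span_enum_tree [Finite S] (s₀ : S) :
    Submodule.span 𝕜 (Set.range fun l : Enum s₀ => lieOf 𝕜 l.tree) = ⊤ := by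
  rw [eq_top_iff, ← PTree.combSpan_eq_top s₀, PTree.combSpan, Submodule.span_le]
  rintro _ ⟨l, rfl⟩
  beta_reduce
  by_cases h : (PTree.comb (.leaf s₀) (l.map .leaf)).leaves.Nodup ∧
      ∀ s, s ∈ (PTree.comb (.leaf s₀) (l.map .leaf)).leaves
  · rw [PTree.lieClass, dif_pos h]
    refine Submodule.subset_span ⟨⟨l, ?_⟩, rfl⟩
    rw [PTree.leaves_comb_leaf] at h
    exact ⟨Multiset.coe_nodup.mp h.1, fun s => Multiset.mem_coe.mp (h.2 s)⟩
  · rw [PTree.lieClass, dif_neg h]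
    exact zero_mem _

end Combs

/-! ### Paths span `Eil` -/

section Paths

variable {S : Type}

open Relation

variable (𝕜) in
/-- The class of a graph in `Eil`. -/
def eilOf [Finite S] (G : SGraph S) : (Eil 𝕜).obj S := (eilRel 𝕜 S).mkQ (gr 𝕜 G)

theorem eilOf_rev_singleton [Finite S] (G : SGraph S) (a b : S) (hab : G.arrow a b) :
    eilOf 𝕜 (G.rev {(a, b)}) = -eilOf 𝕜 G := by
  rw [eq_neg_iff_add_eq_zero, add_comm]
  exact (Submodule.Quotient.mk_eq_zero _).mpr (Submodule.subset_span (Or.inl ⟨G, a, b, hab, rfl⟩))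

theorem eilOf_arnold [Finite S] {a b c : S} {R : S → S → Prop} {G₁ G₂ G₃ : SGraph S} (hab : a ≠ b)
    (hbc : b ≠ c) (hca : c ≠ a) (h₁ : G₁.HasEdges R a b b c) (h₂ : G₂.HasEdges R b c c a)
    (h₃ : G₃.HasEdges R c a a b) : eilOf 𝕜 G₁ + eilOf 𝕜 G₂ + eilOf 𝕜 G₃ = 0 :=
  (Submodule.Quotient.mk_eq_zero _).mpr (Submodule.subset_span
    (Or.inr ⟨a, b, c, R, G₁, G₂, G₃, hab, hbc, hca, h₁, h₂, h₃, rfl⟩))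

/-- Reversing edges only changes the sign of the class, so membership in a subspace depends on the
unoriented graph alone. -/
theorem eilOf_mem_of_sameAdj [Finite S] {U : Submodule 𝕜 ((Eil 𝕜).obj S)} {G H : SGraph S}
    (h : G.SameAdj H) (hG : eilOf 𝕜 G ∈ U) : eilOf 𝕜 H ∈ U := by
  obtain ⟨E, hE, rfl⟩ := G.exists_rev_eq H h
  rw [G.apply_rev (𝕜 := 𝕜) (fun G => eilOf 𝕜 G) (fun G a b h => eilOf_rev_singleton G a b h) hE]
  exact U.smul_mem _ hG

namespace SGraph.HasEdges

variable {G : SGraph S} {R : S → S → Prop} {a b c d : S}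

theorem swap (h : G.HasEdges R a b c d) : G.HasEdges R c d a b := fun x y =>
  (h x y).trans or_left_comm

theorem arrow_left (h : G.HasEdges R a b c d) : G.arrow a b := (h a b).mpr (Or.inl ⟨rfl, rfl⟩)

theorem rev (h : G.HasEdges R a b c d) (hab : ¬ R a b) (hne : ¬ (c = a ∧ d = b)) :
    (G.rev {(a, b)}).HasEdges R b a c d := by
  intro x y
  simp only [SGraph.rev, Finset.mem_singleton, Prod.mk.injEq]
  constructor
  · rintro (⟨h1, h2⟩ | ⟨-, rfl, rfl⟩)
    · rcases (h x y).mp h1 with h3 | h3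
      · exact (h2 h3).elim
      · exact Or.inr h3
    · exact Or.inl ⟨rfl, rfl⟩
  · rintro (⟨rfl, rfl⟩ | ⟨rfl, rfl⟩ | h1)
    · exact Or.inr ⟨h.arrow_left, rfl, rfl⟩
    · exact Or.inl ⟨h.swap.arrow_left, hne⟩
    · refine Or.inl ⟨(h x y).mpr (Or.inr (Or.inr h1)), ?_⟩
      rintro ⟨rfl, rfl⟩
      exact hab h1

end SGraph.HasEdges

/-- The step from a vertex different from the root to its parent. -/
def Step (s₀ : S) (par : S → S) (y x : S) : Prop := y ≠ s₀ ∧ par y = x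

/-- `x` is an ancestor of `y`. -/
abbrev Anc (s₀ : S) (par : S → S) : S → S → Prop := ReflTransGen (Step s₀ par)

/-- `par` is the map to the parents for some tree with root `s₀`. -/
def Rooted (s₀ : S) (par : S → S) : Prop := ∀ y, Anc s₀ par y s₀

variable {s₀ : S} {par : S → S}

theorem anc_root {x : S} (h : Anc s₀ par s₀ x) : x = s₀ := by
  rcases h.cases_head with h | ⟨z, hz, -⟩
  · exact h.symm
  · exact (hz.1 rfl).elim

theorem anc_cases {y x : S} (h : Anc s₀ par y x) : y = x ∨ y ≠ s₀ ∧ Anc s₀ par (par y) x := by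
  rcases h.cases_head with h | ⟨z, ⟨hz, rfl⟩, h⟩
  · exact Or.inl h
  · exact Or.inr ⟨hz, h⟩

theorem anc_par {y x : S} (hy : y ≠ s₀) (h : Anc s₀ par (par y) x) : Anc s₀ par y x :=
  ReflTransGen.head ⟨hy, rfl⟩ h

namespace Rooted

variable (h : Rooted s₀ par)

include h

theorem induction {P : S → Prop} (h0 : P s₀) (hs : ∀ y, y ≠ s₀ → P (par y) → P y) (y : S) : P y := by
  refine ReflTransGen.head_induction_on (motive := fun y _ => P y) (h y) h0 ?_
  rintro y _ ⟨hy, rfl⟩ - ih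
  exact hs y hy ih

/-- A cycle through `y` would also pass through its parent, hence by induction through the root,
which has no proper ancestors. -/
theorem not_anc (y : S) (hy : y ≠ s₀) : ¬ Anc s₀ par (par y) y := by
  revert hy
  refine h.induction (P := fun y => y ≠ s₀ → ¬ Anc s₀ par (par y) y) (fun h => (h rfl).elim) ?_ y
  intro y _ ih hy hyy
  by_cases h0 : par y = s₀
  · rw [h0] at hyy
    exact hy (anc_root hyy)
  · refine ih h0 ?_
    rcases anc_cases hyy with h1 | ⟨-, h1⟩
    · rw [h1, h1]
    · exact h1.trans (anc_par hy ReflTransGen.refl)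

end Rooted

/-- The tree with given parents, with all edges oriented away from the root. -/
def parGraph (h : Rooted s₀ par) : SGraph S :=
  SGraph.ofCut (fun x y => Step s₀ par y x)
    (by
      rintro x y ⟨hy, hyx⟩ ⟨hx, hxy⟩
      refine h.not_anc y hy (anc_par (hyx ▸ hx) ?_)
      rw [hyx, hxy])
    ⟨s₀⟩
    (by
      rintro X ⟨x, hx⟩ hX
      have h0 : s₀ ∈ X := by
        revert hx
        refine h.induction (P := fun x => x ∈ X → s₀ ∈ X) id (fun y hy ih hyX => ih ?_) x
        exact hX y hyX _ (Or.inr ⟨hy, rfl⟩)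
      exact h.induction h0 fun y hy ih => hX _ ih y (Or.inl ⟨hy, rfl⟩))
    (by
      rintro x y ⟨hy, rfl⟩
      -- The edge from the parent of `y` to `y` is the only one entering the subtree below `y`; the
      -- cut is the complement of this subtree.
      refine ⟨{z | ¬ Anc s₀ par z y}, h.not_anc y hy, fun h => h ReflTransGen.refl, ?_⟩
      rintro z hz t ht (⟨ht0, rfl⟩ | ⟨hz0, rfl⟩)
      · rcases anc_cases (not_not.mp ht) with rfl | ⟨-, h1⟩
        · exact ⟨rfl, rfl⟩
        · exact (hz h1).elim
      · exact (hz (anc_par hz0 (not_not.mp ht))).elim)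

theorem parGraph_arrow {h : Rooted s₀ par} {x y : S} :
    (parGraph h).arrow x y ↔ y ≠ s₀ ∧ par y = x := Iff.rfl

/-- Every graph can be rooted. -/
theorem exists_parGraph_sameAdj (s₀ : S) (G : SGraph S) :
    ∃ (par : S → S) (h : Rooted s₀ par), (parGraph h).SameAdj G := by
  -- The parent is the next vertex on a shortest walk to `s₀`; the value at `s₀` itself is
  -- irrelevant.
  have key : ∀ y, ∃ z, y ≠ s₀ → G.adj y z ∧ (SimpleGraph.fromRel G.arrow).dist z s₀ <
      (SimpleGraph.fromRel G.arrow).dist y s₀ := by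
    intro y
    by_cases hy : y = s₀
    · exact ⟨y, fun h => (h hy).elim⟩
    · obtain ⟨w, hw⟩ := (G.isTree.connected.preconnected y s₀).exists_walk_length_eq_dist
      cases w with
      | nil => exact (hy rfl).elim
      | @cons _ z _ hyz w =>
        refine ⟨z, fun _ => ⟨G.adj_iff.mp hyz, ?_⟩⟩
        rw [← hw, SimpleGraph.Walk.length_cons]
        exact Nat.lt_succ_of_le (SimpleGraph.dist_le w)
  choose par hpar using key
  have h : Rooted s₀ par := by
    intro y
    induction hn : (SimpleGraph.fromRel G.arrow).dist y s₀ using Nat.strong_induction_on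
      generalizing y with
    | _ n ih =>
      by_cases hy : y = s₀
      · rw [hy]
      · exact anc_par hy (ih _ (hn ▸ (hpar y hy).2) _ rfl)
  refine ⟨par, h, ?_⟩
  rintro x y ⟨hy, rfl⟩
  exact (hpar y hy).1.symm

theorem Rooted.not_anc_sibling {b c : S} (h : Rooted s₀ par) (hc : c ≠ s₀) (hbc : b ≠ c)
    (hp : par b = par c) : ¬ Anc s₀ par b c := by
  intro hb
  rcases anc_cases hb with h1 | ⟨-, h1⟩
  · exact hbc h1
  · rw [hp] at h1
    exact h.not_anc c hc h1

/-! ### Moving a vertex below its sibling -/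

section Move

variable [DecidableEq S] {b c : S}

/-- Every ancestor remains an ancestor if `b` is moved below its sibling `c`. -/
theorem anc_update (hc : c ≠ s₀) (hbc : b ≠ c) (hp : par b = par c) {x y : S}
    (h : Anc s₀ par x y) : Anc s₀ (Function.update par b c) x y := by
  induction h with
  | refl => exact ReflTransGen.refl
  | @tail y z _ hyz ih =>
    obtain ⟨hy, rfl⟩ := hyz
    by_cases hyb : y = b
    · subst hyb
      -- The step from `b` to its parent becomes a detour through `c`, which has the same parent.
      refine (ih.tail ⟨hy, Function.update_self _ _ _⟩).tail ⟨hc, ?_⟩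
      rw [Function.update_of_ne hbc.symm, hp]
    · exact ih.tail ⟨hy, Function.update_of_ne hyb _ _⟩

theorem Rooted.update (h : Rooted s₀ par) (hc : c ≠ s₀) (hbc : b ≠ c) (hp : par b = par c) :
    Rooted s₀ (Function.update par b c) := fun y => anc_update hc hbc hp (h y)

/-- The edges after moving `b` below its sibling `c`. -/
theorem hasEdges_update (h : Rooted s₀ par) (hb : b ≠ s₀) (hc : c ≠ s₀) (hbc : b ≠ c)
    (hp : par b = par c) : (parGraph (h.update hc hbc hp)).HasEdges
      (fun x y => y ≠ s₀ ∧ par y = x ∧ y ≠ b ∧ y ≠ c) (par b) c c b := by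
  intro x y
  simp only [parGraph_arrow]
  by_cases h1 : y = b
  · subst h1
    rw [Function.update_self]
    constructor
    · rintro ⟨-, rfl⟩; exact Or.inr (Or.inl ⟨rfl, rfl⟩)
    · rintro (⟨-, h⟩ | ⟨h, -⟩ | h)
      · exact (hbc h).elim
      · exact ⟨hb, h.symm⟩
      · exact (h.2.2.1 rfl).elim
  · rw [Function.update_of_ne h1]
    by_cases h2 : y = c
    · subst h2
      constructor
      · rintro ⟨-, rfl⟩; exact Or.inl ⟨hp.symm, rfl⟩
      · rintro (⟨rfl, -⟩ | ⟨-, h⟩ | h)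
        · exact ⟨hc, hp.symm⟩
        · exact (h1 h).elim
        · exact (h.2.2.2 rfl).elim
    · tauto

/-- This is the Arnold relation for the common parent `v` and its children `b`, `c`: a fork at `v`
is the sum of the two chains `v → c → b` and `v → b → c`. -/
theorem eilOf_parGraph_move [Finite S] (h : Rooted s₀ par) (hb : b ≠ s₀) (hc : c ≠ s₀)
    (hbc : b ≠ c) (hp : par b = par c) : eilOf 𝕜 (parGraph h) =
      eilOf 𝕜 (parGraph (h.update hc hbc hp)) +
        eilOf 𝕜 (parGraph (h.update hb hbc.symm hp.symm)) := by
  have hvb : par b ≠ b := fun h' => h.not_anc b hb (by rw [h'])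
  have hvc : par b ≠ c := fun h' => h.not_anc c hc (by rw [← hp, h'])
  let R : S → S → Prop := fun x y => y ≠ s₀ ∧ par y = x ∧ y ≠ b ∧ y ≠ c
  have Rb : ∀ x, ¬ R x b := fun x h => h.2.2.1 rfl
  have Rc : ∀ x, ¬ R x c := fun x h => h.2.2.2 rfl
  have h₁ : (parGraph h).HasEdges R (par b) b (par b) c := by
    intro x y
    simp only [parGraph_arrow, R]
    by_cases h1 : y = b
    · subst h1
      simp [hb, hbc, eq_comm]
    · by_cases h2 : y = c
      · subst h2
        simp [hc, h1, hp, eq_comm]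
      · simp [h1, h2]
  have h₂ : (parGraph (h.update hc hbc hp)).HasEdges R (par b) c c b := hasEdges_update h hb hc hbc hp
  have h₃ : (parGraph (h.update hb hbc.symm hp.symm)).HasEdges R b c (par b) b := by
    intro x y
    rw [hasEdges_update h hc hb hbc.symm hp.symm x y, ← hp]
    simp only [R]
    tauto
  have h₃' := (h₃.rev (Rc _) fun h => hbc h.2).swap
  -- The Arnold triple is `b`, `v`, `c`. The fork needs one reversal, the chain through `c` none and
  -- the chain through `b` two, which gives the signs.
  have key := eilOf_arnold (𝕜 := 𝕜) hvb.symm hvc hbc.symm (h₁.rev (Rb _) fun h => hbc h.2.symm) h₂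
    (h₃'.rev (Rb _) fun h => hvc h.1.symm).swap
  rw [eilOf_rev_singleton _ _ _ h₁.arrow_left, eilOf_rev_singleton _ _ _ h₃'.arrow_left,
    eilOf_rev_singleton _ _ _ h₃.arrow_left, neg_neg, add_assoc, neg_add_eq_zero] at key
  exact key

end Move

/-- The graph with an edge `x → y` whenever the rank of `y` is one more than the rank of `x`. -/
def rankGraph [Nonempty S] (r : S → ℕ) (hr : Function.Injective r)
    (hd : ∀ y, r y ≠ 0 → ∃ x, r y = r x + 1) : SGraph S :=
  have down : ∀ (n : ℕ) (y : S), n ≤ r y → ∃ x, r x = n := by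
    intro n y h
    induction hm : r y generalizing y with
    | zero => exact ⟨y, by omega⟩
    | succ m ih =>
      by_cases hn : n = m + 1
      · exact ⟨y, by omega⟩
      · obtain ⟨x, hx⟩ := hd y (by omega)
        exact ih x (by omega) (by omega)
  SGraph.ofCut (fun x y => r y = r x + 1) (fun x y h h' => by omega) ‹_›
    (by
      rintro X ⟨x, hx⟩ hX y
      have h0 : ∀ n x, r x = n → x ∈ X → ∀ z, r z = 0 → z ∈ X := by
        intro n
        induction n with
        | zero =>
          intro x hxn hx z hz
          rwa [hr (hz.trans hxn.symm)]
        | succ n ih =>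
          intro x hxn hx
          obtain ⟨t, ht⟩ := hd x (by omega)
          exact ih t (by omega) (hX x hx t (Or.inr ht))
      have h1 : ∀ n y, r y = n → y ∈ X := by
        intro n
        induction n with
        | zero => exact fun y hy => h0 _ x rfl hx y hy
        | succ n ih =>
          intro y hy
          obtain ⟨t, ht⟩ := hd y (by omega)
          exact hX t (ih t (by omega)) y (Or.inl ht)
      exact h1 _ y rfl)
    (by
      intro a b hab
      -- An edge raises the rank by exactly one and ranks are distinct, so the cut by rank is
      -- crossed only once.
      refine ⟨{x | r x ≤ r a}, le_refl (r a), ?_, ?_⟩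
      · change ¬ r b ≤ r a
        omega
      · rintro x hx y hy hxy
        have hx' : r x ≤ r a := hx
        have hy' : ¬ r y ≤ r a := hy
        exact ⟨hr (by omega), hr (by omega)⟩)

end Paths

/-! ### Enumerations, their paths, and the reduction of graphs to paths -/

section PathSpan

variable {S : Type} {s₀ : S} {par : S → S}

namespace Enum

open Classical in
/-- The position of an element in an enumeration. -/
def rank (l : Enum s₀) (x : S) : ℕ := (s₀ :: l.1).idxOf x

theorem rank_injective (l : Enum s₀) : Function.Injective l.rank := fun x _ h => by
  classical
  exact (List.idxOf_inj (l.2.2 x)).mp h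

theorem rank_getElem (l : Enum s₀) (i : ℕ) (h : i < (s₀ :: l.1).length) :
    l.rank ((s₀ :: l.1)[i]) = i := by
  classical
  exact l.2.1.idxOf_getElem i h

theorem exists_rank_eq (l : Enum s₀) (y : S) (hy : l.rank y ≠ 0) : ∃ x, l.rank y = l.rank x + 1 := by
  classical
  have h : l.rank y < (s₀ :: l.1).length := List.idxOf_lt_length_of_mem (l.2.2 y)
  refine ⟨(s₀ :: l.1)[l.rank y - 1], ?_⟩
  rw [l.rank_getElem]
  omega

/-- The path through an enumeration. -/
def path (l : Enum s₀) : SGraph S :=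
  have : Nonempty S := ⟨s₀⟩
  rankGraph l.rank l.rank_injective l.exists_rank_eq

theorem path_arrow {l : Enum s₀} {x y : S} : l.path.arrow x y ↔ l.rank y = l.rank x + 1 := Iff.rfl

/-- An injective rank function without gaps is given by an enumeration. -/
theorem exists_rank [Finite S] (r : S → ℕ) (hr : Function.Injective r) (h0 : r s₀ = 0)
    (hd : ∀ y, y ≠ s₀ → ∃ x, r y = r x + 1) : ∃ l : Enum s₀, ∀ x, l.rank x = r x := by
  classical
  have := Fintype.ofFinite S
  have down : ∀ (n : ℕ) (y : S), n ≤ r y → ∃ x, r x = n := by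
    intro n y h
    induction hm : r y generalizing y with
    | zero => exact ⟨y, by omega⟩
    | succ m ih =>
      by_cases hn : n = m + 1
      · exact ⟨y, by omega⟩
      · obtain ⟨x, hx⟩ := hd y (by rintro rfl; omega)
        exact ih x (by omega) (by omega)
  let n := Finset.univ.sup r
  have hn : ∀ x, r x < n + 1 := fun x => Nat.lt_succ_of_le (Finset.le_sup (Finset.mem_univ x))
  obtain ⟨y, -, hy⟩ := Finset.exists_mem_eq_sup Finset.univ ⟨s₀, Finset.mem_univ s₀⟩ r
  -- Without gaps the ranks fill an initial segment, so listing the vertices by rank gives the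
  -- enumeration.
  let e : S ≃ Fin (n + 1) := Equiv.ofBijective (fun x => ⟨r x, hn x⟩)
    ⟨fun x z h => hr (congrArg Fin.val h), fun i => by
      obtain ⟨x, hx⟩ := down i y (hy ▸ Nat.lt_succ_iff.mp i.2)
      exact ⟨x, Fin.ext hx⟩⟩
  let l := List.ofFn fun i : Fin n => e.symm i.succ
  have h0' : e.symm 0 = s₀ := e.symm_apply_eq.mpr (Fin.ext h0.symm)
  have hl : s₀ :: l = List.ofFn e.symm := by
    rw [List.ofFn_succ, h0']
  refine ⟨⟨l, ?_, ?_⟩, fun x => ?_⟩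
  · rw [hl]
    exact List.nodup_ofFn.mpr e.symm.injective
  · intro x
    rw [hl, List.mem_ofFn]
    exact ⟨e x, e.symm_apply_apply x⟩
  · have hx : (List.ofFn e.symm)[r x]'(by rw [List.length_ofFn]; exact hn x) = x := by
      rw [List.getElem_ofFn]
      exact e.symm_apply_apply x
    change (s₀ :: l).idxOf x = r x
    rw [hl]
    conv_lhs => rw [← hx]
    exact (List.nodup_ofFn.mpr e.symm.injective).idxOf_getElem _ _

end Enum

/-- A rooted tree without branching is a path. -/
theorem Rooted.exists_path_sameAdj [Finite S] (h : Rooted s₀ par)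
    (hp : ∀ b c, b ≠ s₀ → c ≠ s₀ → par b = par c → b = c) :
    ∃ l : Enum s₀, l.path.SameAdj (parGraph h) := by
  -- The rank is the depth, counted as the number of proper ancestors.
  let r : S → ℕ := fun y => {x | Anc s₀ par y x ∧ x ≠ y}.ncard
  have h0 : r s₀ = 0 := by
    refine (Set.ncard_eq_zero (Set.toFinite _)).mpr (Set.eq_empty_of_forall_notMem ?_)
    rintro x ⟨hx, hne⟩
    exact hne (anc_root hx)
  have hs : ∀ y, y ≠ s₀ → r y = r (par y) + 1 := by
    intro y hy
    have hm : par y ∉ {x | Anc s₀ par (par y) x ∧ x ≠ par y} := fun h => h.2 rfl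
    rw [← Set.ncard_insert_of_notMem hm (Set.toFinite _)]
    refine congrArg Set.ncard (Set.ext fun x => ⟨?_, ?_⟩)
    · rintro ⟨hx, hne⟩
      rcases anc_cases hx with h1 | ⟨-, h1⟩
      · exact (hne h1.symm).elim
      · by_cases h2 : x = par y
        · exact Or.inl h2
        · exact Or.inr ⟨h1, h2⟩
    · intro hx
      have hx' : Anc s₀ par (par y) x := by
        rcases hx with rfl | hx
        · exact Relation.ReflTransGen.refl
        · exact hx.1
      refine ⟨anc_par hy hx', ?_⟩
      rintro rfl
      exact h.not_anc _ hy hx'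
  -- Vertices of the same depth have parents of the same depth, which agree by induction; then the
  -- vertices agree as there is no branching.
  have hr : ∀ y z, r y = r z → y = z := by
    refine h.induction (fun z hz => ?_) (fun y hy ih z hz => ?_)
    · by_contra hne
      have := hs z (Ne.symm hne)
      omega
    · have h1 := hs y hy
      have hz0 : z ≠ s₀ := by rintro rfl; omega
      have h2 := hs z hz0
      exact hp y z hy hz0 (ih _ (by omega))
  obtain ⟨l, hl⟩ := Enum.exists_rank r hr h0 fun y hy => ⟨_, hs y hy⟩
  refine ⟨l, fun x y hxy => Or.inl ?_⟩
  rw [Enum.path_arrow, hl, hl] at hxy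
  have hy : y ≠ s₀ := by rintro rfl; omega
  refine ⟨hy, hr _ _ ?_⟩
  have := hs y hy
  omega

variable (𝕜) in
/-- The span of the paths starting with a given vertex. -/
def pathSpan [Finite S] (s₀ : S) : Submodule 𝕜 ((Eil 𝕜).obj S) :=
  Submodule.span 𝕜 (Set.range fun l : Enum s₀ => eilOf 𝕜 l.path)

/-- If two siblings exist, the tree is the sum of the two trees with one moved below the other. Both
keep all ancestor relations and gain one, so the number of pairs that are not related drops until
there is no branching left. -/
theorem eilOf_parGraph_mem [Finite S] (n : ℕ) (par : S → S) (h : Rooted s₀ par)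
    (hn : {p : S × S | ¬ Anc s₀ par p.1 p.2}.ncard ≤ n) :
    eilOf 𝕜 (parGraph h) ∈ pathSpan 𝕜 s₀ := by
  classical
  induction n using Nat.strong_induction_on generalizing par with
  | _ n ih =>
    by_cases hp : ∀ b c, b ≠ s₀ → c ≠ s₀ → par b = par c → b = c
    · obtain ⟨l, hl⟩ := h.exists_path_sameAdj hp
      exact eilOf_mem_of_sameAdj hl (Submodule.subset_span ⟨l, rfl⟩)
    · push Not at hp
      obtain ⟨b, c, hb, hc, hbc, hne⟩ := hp
      have key : ∀ {b c : S}, b ≠ s₀ → (hc : c ≠ s₀) → (hne : b ≠ c) → (hbc : par b = par c) →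
          eilOf 𝕜 (parGraph (h.update hc hne hbc)) ∈ pathSpan 𝕜 s₀ := by
        intro b c hb hc hne hbc
        refine ih _ (lt_of_lt_of_le (Set.ncard_lt_ncard ?_ (Set.toFinite _)) hn) _ _ le_rfl
        -- The pair `(b, c)` is the one that becomes related by the move.
        refine (Set.ssubset_iff_of_subset fun p (hp : ¬ _) hp' => hp (anc_update hc hne hbc hp')).mpr
          ⟨(b, c), h.not_anc_sibling hc hne hbc, fun h' => h' ?_⟩
        exact Relation.ReflTransGen.single ⟨hb, Function.update_self _ _ _⟩
      rw [eilOf_parGraph_move h hb hc hne hbc]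
      exact add_mem (key hb hc hne hbc) (key hc hb hne.symm hbc.symm)

theorem eil_hom_ext [Finite S] {M : Type u} [AddCommGroup M] [Module 𝕜 M]
    {f g : (Eil 𝕜).obj S →ₗ[𝕜] M} (h : ∀ G : SGraph S, f (eilOf 𝕜 G) = g (eilOf 𝕜 G)) : f = g :=
  Submodule.linearMap_qext _ (Finsupp.lhom_ext' fun G => LinearMap.ext_ring (h G))

theorem pathSpan_eq_top [Finite S] (s₀ : S) : pathSpan 𝕜 s₀ = ⊤ := by
  rw [eq_top_iff]
  have h0 : (pathSpan 𝕜 s₀).mkQ = 0 := eil_hom_ext fun G => by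
    rw [LinearMap.zero_apply, Submodule.mkQ_apply, Submodule.Quotient.mk_eq_zero]
    obtain ⟨par, h, hG⟩ := exists_parGraph_sameAdj s₀ G
    exact eilOf_mem_of_sameAdj hG (eilOf_parGraph_mem _ par h le_rfl)
  intro x _
  rw [← Submodule.Quotient.mk_eq_zero, ← Submodule.mkQ_apply, h0, LinearMap.zero_apply]

end PathSpan

/-! ### Paths and left-normed trees are dual bases -/

section DualBases

variable {S : Type} {s₀ : S}

namespace Enum

/-- Here `X` is the set of the first `j` vertices of the path. Only the predecessor of `a` can be
joined to `a` from `X`, and it lies in `X` exactly if `a` is the next vertex. -/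
theorem crossing_weight_path (l : Enum s₀) {X : Multiset S} (hX : X.Nodup) {j : ℕ}
    (hj : ∀ x, x ∈ X ↔ l.rank x < j) (hj0 : j ≠ 0) {a : S} (ha : a ∉ X) :
    crossing (l.path.weight 𝕜) X {a} = if l.rank a = j then 1 else 0 := by
  have hja : j ≤ l.rank a := not_lt.mp fun h => ha ((hj a).mpr h)
  have hw : ∀ x ∈ X, l.rank a ≠ l.rank x + 1 → l.path.weight 𝕜 x a = 0 := by
    intro x hx hne
    refine l.path.weight_eq_zero ?_
    have := (hj x).mp hx
    rintro (h | h)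
    · exact hne h
    · rw [path_arrow] at h
      omega
  split_ifs with h
  · obtain ⟨x, hx⟩ := l.exists_rank_eq a (by omega)
    obtain ⟨X', rfl⟩ := Multiset.exists_cons_of_mem ((hj x).mpr (by omega))
    have h1 : crossing (l.path.weight 𝕜) X' {a} = 0 := by
      refine crossing_eq_zero fun z hz y hy => ?_
      rw [Multiset.mem_singleton] at hy
      rw [hy]
      refine hw z (Multiset.mem_cons_of_mem hz) fun hza => ?_
      have : z = x := l.rank_injective (by omega)
      exact (Multiset.nodup_cons.mp hX).1 (this ▸ hz)
    rw [← Multiset.singleton_add, crossing_add_left, h1, add_zero]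
    have h2 : crossing (l.path.weight 𝕜) {x} {a} = l.path.weight 𝕜 x a := by simp [crossing]
    rw [h2, l.path.weight_of_arrow (path_arrow.mpr hx)]
  · refine crossing_eq_zero fun x hx y hy => ?_
    rw [Multiset.mem_singleton] at hy
    rw [hy]
    have := (hj x).mp hx
    exact hw x hx (by omega)

/-- Each node adds one leaf to the initial segment of the path collected so far, and its factor is
`1` or `0` according to whether this leaf is the next vertex of the path. -/
theorem pairing_comb (l : Enum s₀) (l' : List S) (t : PTree S) {j : ℕ}
    (hj : ∀ x, x ∈ t.leaves ↔ l.rank x < j) (hj0 : j ≠ 0) (hn : (t.leaves + (l' : Multiset S)).Nodup) :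
    pairing (l.path.weight 𝕜) (PTree.comb t (l'.map .leaf)) =
      pairing (l.path.weight 𝕜) t *
        if l'.map l.rank = List.range' j l'.length then 1 else 0 := by
  induction l' generalizing t j with
  | nil => simp [PTree.comb]
  | cons a l' ih =>
    have hta : t.leaves.Nodup := (Multiset.nodup_add.mp hn).1
    have ha : a ∉ t.leaves := fun h =>
      Multiset.disjoint_left.mp (Multiset.nodup_add.mp hn).2.2 h (by simp)
    have hn' : ((PTree.node t (.leaf a)).leaves + (l' : Multiset S)).Nodup := by
      rw [PTree.leaves, PTree.leaves, add_assoc]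
      exact hn
    have e : PTree.comb t ((a :: l').map .leaf) =
        PTree.comb (.node t (.leaf a)) (l'.map .leaf) := rfl
    have hnode : pairing (l.path.weight 𝕜) (.node t (.leaf a)) =
        (if l.rank a = j then 1 else 0) * pairing (l.path.weight 𝕜) t := by
      rw [pairing, pairing, mul_one, PTree.leaves, crossing_weight_path l hta hj hj0 ha]
    rw [e]
    by_cases h : l.rank a = j
    · rw [ih (.node t (.leaf a)) (j := j + 1) ?_ (by omega) hn', hnode, if_pos h, one_mul]
      · simp [h, List.range'_succ]
      · intro x
        rw [PTree.leaves, PTree.leaves, Multiset.mem_add, Multiset.mem_singleton, hj,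
          Nat.lt_succ_iff_lt_or_eq, ← h, l.rank_injective.eq_iff]
    -- A wrong leaf makes its node vanish, and the rest of the comb only multiplies this zero by a
    -- constant.
    · obtain ⟨R, hR⟩ := PTree.exists_comb_eq_plug (l'.map PTree.leaf)
      obtain ⟨c, hc⟩ := pairing_plug (l.path.weight 𝕜) R _
      rw [hR, hc _ rfl, hnode, if_neg h, if_neg, zero_mul, mul_zero, mul_zero]
      rw [List.map_cons, List.length_cons, List.range'_succ]
      exact fun h' => h (List.cons.inj h').1

theorem map_rank (l : Enum s₀) : l.1.map l.rank = List.range' 1 l.1.length := by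
  refine List.ext_getElem (by simp) fun i h₁ h₂ => ?_
  rw [List.getElem_map, List.getElem_range']
  have := l.rank_getElem (i + 1) (by simpa using h₁)
  rw [List.getElem_cons_succ] at this
  rw [this]
  omega

theorem length_eq (l l' : Enum s₀) : l.1.length = l'.1.length := by
  have h : (s₀ :: l.1).Perm (s₀ :: l'.1) :=
    (List.perm_ext_iff_of_nodup l.2.1 l'.2.1).mpr fun a => iff_of_true (l.2.2 a) (l'.2.2 a)
  exact h.cons_inv.length_eq

-- A left-normed tree pairs non-trivially only with the path visiting its leaves in the same order:
-- the two families are dual to each other.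
open Classical in
theorem pair_path_tree (l l' : Enum s₀) : l.path.pair 𝕜 l'.tree = if l = l' then 1 else 0 := by
  have h0 : l.rank s₀ = 0 := l.rank_getElem 0 (by simp)
  -- `j = 1`, as the initial leaf `s₀` is the vertex of rank zero.
  refine (pairing_comb l l'.1 (.leaf s₀) (j := 1) (fun x => ?_) one_ne_zero
    (Multiset.coe_nodup.mpr l'.2.1)).trans ?_
  · rw [PTree.leaves, Multiset.mem_singleton, Nat.lt_one_iff, ← h0, l.rank_injective.eq_iff]
  · rw [pairing, one_mul]
    refine if_congr ?_ rfl rfl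
    rw [length_eq l' l, ← l.map_rank, (List.map_injective_iff.mpr l.rank_injective).eq_iff]
    exact ⟨fun h => Subtype.ext h.symm, fun h => h ▸ rfl⟩

/-- There are finitely many graphs, and the path determines the enumeration, because its pairings
with left-normed trees do; any coefficient field serves for this. -/
instance [Finite S] : Finite (Enum s₀) := by
  classical
  refine Finite.of_injective path fun l l' h => ?_
  have h1 := l.pair_path_tree (𝕜 := ℚ) l
  rw [h, pair_path_tree, if_pos rfl] at h1
  by_contra hne
  rw [if_neg (Ne.symm hne)] at h1
  exact zero_ne_one h1

end Enum

end DualBases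

/-! ### The isomorphism of `Eil` with the linear dual of the Lie operad -/

section EilIso

variable {S T : Type}

theorem eilRel_le_ker [Finite S] :
    eilRel 𝕜 S ≤ LinearMap.ker (Finsupp.linearCombination 𝕜 fun G : SGraph S => pairDual 𝕜 G) := by
  refine Submodule.span_le.mpr ?_
  rintro x (⟨G, a, b, h, rfl⟩ | ⟨a, b, c, R, G₁, G₂, G₃, hab, hbc, hca, h₁, h₂, h₃, rfl⟩)
  · rw [SetLike.mem_coe, LinearMap.mem_ker, map_add, Finsupp.linearCombination_single,
      Finsupp.linearCombination_single, one_smul, one_smul, pairDual_rev_singleton _ _ _ h,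
      add_neg_cancel]
  · rw [SetLike.mem_coe, LinearMap.mem_ker, map_add, map_add, Finsupp.linearCombination_single,
      Finsupp.linearCombination_single, Finsupp.linearCombination_single, one_smul, one_smul,
      one_smul]
    refine lie_hom_ext fun t => ?_
    rw [LinearMap.add_apply, LinearMap.add_apply, pairDual_lieOf, pairDual_lieOf, pairDual_lieOf,
      LinearMap.zero_apply]
    exact SGraph.pair_arnold hab hbc hca h₁ h₂ h₃ t

variable (𝕜 S) in
/-- The pairing with classes of graphs in `Eil`. -/
def eilDual [Finite S] : (Eil 𝕜).obj S →ₗ[𝕜] Module.Dual 𝕜 ((Lie 𝕜).obj S) :=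
  (eilRel 𝕜 S).liftQ (Finsupp.linearCombination 𝕜 fun G : SGraph S => pairDual 𝕜 G) eilRel_le_ker

theorem eilDual_eilOf [Finite S] (G : SGraph S) : eilDual 𝕜 S (eilOf 𝕜 G) = pairDual 𝕜 G :=
  (Submodule.liftQ_apply _ _ _).trans
    ((Finsupp.linearCombination_single _ _ _).trans (one_smul _ _))

theorem eilQuot_surjective [Finite S] : Function.Surjective ((eilQuot 𝕜).app S) :=
  (eilRel 𝕜 S).mkQ_surjective

theorem eilDual_eilQuot [Finite S] (x : (Gr 𝕜).obj S) :
    eilDual 𝕜 S ((eilQuot 𝕜).app S x) = pairDualLin 𝕜 S x := Submodule.liftQ_apply _ _ _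

theorem eilDual_map [Finite S] [Finite T] (e : S ≃ T) (x : (Eil 𝕜).obj S) :
    eilDual 𝕜 T ((Eil 𝕜).map e x) = ((Lie 𝕜).map e.symm).dualMap (eilDual 𝕜 S x) := by
  obtain ⟨y, rfl⟩ := eilQuot_surjective x
  rw [← SymSeq.Hom.app_map, eilDual_eilQuot, eilDual_eilQuot, pairDualLin_map]

/-- Paths span `Eil`, left-normed trees span `Lie`, and the pairing matrix is the identity. So the
coefficients of an element of `Eil` are its values on trees, and a functional with prescribed values
on the trees can be written down. -/
theorem eilDual_bijective [Finite S] : Function.Bijective (eilDual 𝕜 S) := by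
  classical
  -- On the empty set there is no `s₀` to start from, but also neither a graph nor a tree, so both
  -- sides are zero.
  rcases isEmpty_or_nonempty S with hS | ⟨⟨s₀⟩⟩
  · have h1 : Subsingleton ((Eil 𝕜).obj S) := by
      have : (LinearMap.id : (Eil 𝕜).obj S →ₗ[𝕜] (Eil 𝕜).obj S) = 0 :=
        eil_hom_ext fun G => (hS.false G.nonempty.some).elim
      exact ⟨fun x y => (LinearMap.congr_fun this x).trans (LinearMap.congr_fun this y).symm⟩
    have h2 : Subsingleton (Module.Dual 𝕜 ((Lie 𝕜).obj S)) :=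
      ⟨fun f g => lie_hom_ext fun t => (hS.false t.1.exists_mem_leaves.choose).elim⟩
    exact ⟨fun x y _ => Subsingleton.elim x y, fun f => ⟨0, Subsingleton.elim _ _⟩⟩
  · have := Fintype.ofFinite (Enum s₀)
    have key : ∀ (c : Enum s₀ → 𝕜) (l' : Enum s₀),
        eilDual 𝕜 S (∑ l, c l • eilOf 𝕜 l.path) (lieOf 𝕜 l'.tree) = c l' := by
      intro c l'
      rw [map_sum, LinearMap.sum_apply]
      simp only [map_smul, LinearMap.smul_apply, eilDual_eilOf, pairDual_lieOf,
        Enum.pair_path_tree, smul_eq_mul, mul_ite, mul_one, mul_zero]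
      rw [Finset.sum_ite_eq' Finset.univ l' c, if_pos (Finset.mem_univ _)]
    constructor
    · rw [← LinearMap.ker_eq_bot, LinearMap.ker_eq_bot']
      intro x hx
      have hx' : x ∈ pathSpan 𝕜 s₀ := pathSpan_eq_top (𝕜 := 𝕜) s₀ ▸ Submodule.mem_top
      obtain ⟨c, rfl⟩ := (Submodule.mem_span_range_iff_exists_fun 𝕜).mp hx'
      refine Finset.sum_eq_zero fun l' _ => ?_
      rw [← key c l', hx, LinearMap.zero_apply, zero_smul]
    · intro f
      refine ⟨∑ l : Enum s₀, f (lieOf 𝕜 l.tree) • eilOf 𝕜 l.path, ?_⟩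
      refine LinearMap.ext_on (span_enum_tree (𝕜 := 𝕜) s₀) ?_
      rintro _ ⟨l', rfl⟩
      exact key (fun l => f (lieOf 𝕜 l.tree)) l'

variable (𝕜) in
/-- The isomorphism of `Eil` with the linear dual of the Lie operad. -/
def eilIso : SymSeq.Hom (Eil 𝕜) (Lie 𝕜).dual where
  app S _ := eilDual 𝕜 S
  natural {_ _} _ _ e := LinearMap.ext fun x => eilDual_map e x

theorem eilIso_bijective [Finite S] : Function.Bijective ((eilIso 𝕜).app S) := eilDual_bijective

theorem eilIso_comp_eilQuot : (eilIso 𝕜).comp (eilQuot 𝕜) = toLieDual 𝕜 := by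
  have h : ((eilIso 𝕜).comp (eilQuot 𝕜)).app = (toLieDual 𝕜).app := by
    funext S _
    exact LinearMap.ext fun x => eilDual_eilQuot x
  exact match (eilIso 𝕜).comp (eilQuot 𝕜), toLieDual 𝕜, h with
    | ⟨_, _⟩, ⟨_, _⟩, rfl => rfl

theorem toLieDual_surjective [Finite S] : Function.Surjective ((toLieDual 𝕜).app S) := by
  rw [← eilIso_comp_eilQuot]
  exact eilIso_bijective.2.comp eilQuot_surjective

variable (𝕜) in
/-- The components of `eilIso` as linear equivalences. -/
def eilEquiv (S : Type) [Finite S] : (Eil 𝕜).obj S ≃ₗ[𝕜] (Lie 𝕜).dual.obj S :=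
  LinearEquiv.ofBijective ((eilIso 𝕜).app S) eilIso_bijective

variable (𝕜) in
/-- The cooperad structure of `Eil`, transported from the linear dual of the Lie operad. -/
def eilCooperad : CooperadStr (Eil 𝕜) where
  cocomp {_ K} _ _ p := TensorProduct.map (eilEquiv 𝕜 K).symm.toLinearMap
    (PiTensorProduct.map fun k => (eilEquiv 𝕜 (Fib p k)).symm.toLinearMap) ∘ₗ
      (lieDual 𝕜).cocomp p ∘ₗ (eilIso 𝕜).app _
  counit := (lieDual 𝕜).counit ∘ₗ (eilIso 𝕜).app Unit

theorem eilIso_isCooperadHom : IsCooperadHom (eilCooperad 𝕜) (lieDual 𝕜) (eilIso 𝕜) where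
  cocomp {S K} _ _ p := by
    refine LinearMap.ext fun x => ?_
    change (lieDual 𝕜).cocomp p ((eilIso 𝕜).app S x) = TensorProduct.map _ _
      (TensorProduct.map _ _ ((lieDual 𝕜).cocomp p ((eilIso 𝕜).app S x)))
    generalize (lieDual 𝕜).cocomp p ((eilIso 𝕜).app S x) = y
    rw [← LinearMap.comp_apply, ← TensorProduct.map_comp, ← PiTensorProduct.map_comp]
    have h : ∀ (T : Type) [Finite T],
        (eilIso 𝕜).app T ∘ₗ (eilEquiv 𝕜 T).symm.toLinearMap = LinearMap.id := fun T _ =>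
      LinearMap.ext fun x => (eilEquiv 𝕜 T).apply_symm_apply x
    simp only [h, PiTensorProduct.map_id, TensorProduct.map_id, LinearMap.id_apply]
  counit := rfl

/-- The structure transported from `lieDual` is the one inherited from `ACGr`: apply the inverse of
the isomorphism to the compatibility of `toLieDual`. -/
theorem eilQuot_isCooperadHom [CharZero 𝕜] :
    IsCooperadHom (ACGr 𝕜) (eilCooperad 𝕜) (eilQuot 𝕜) where
  cocomp {S K} _ _ p := by
    have h : ∀ (T : Type) [Finite T],
        (eilEquiv 𝕜 T).symm.toLinearMap ∘ₗ (toLieDual 𝕜).app T = (eilQuot 𝕜).app T := fun T _ => by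
      rw [← eilIso_comp_eilQuot]
      exact LinearMap.ext fun x => (eilEquiv 𝕜 T).symm_apply_apply ((eilQuot 𝕜).app T x)
    have h1 := toLieDual_isCooperadHom.cocomp (𝕜 := 𝕜) p
    have h2 : (eilCooperad 𝕜).cocomp p ∘ₗ (eilQuot 𝕜).app S =
        TensorProduct.map (eilEquiv 𝕜 K).symm.toLinearMap
          (PiTensorProduct.map fun k => (eilEquiv 𝕜 (Fib p k)).symm.toLinearMap) ∘ₗ
            (lieDual 𝕜).cocomp p ∘ₗ (toLieDual 𝕜).app S := by
      rw [← eilIso_comp_eilQuot]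
      rfl
    rw [h2, h1, ← LinearMap.comp_assoc, ← TensorProduct.map_comp, ← PiTensorProduct.map_comp]
    simp only [h]
  counit := by
    rw [← toLieDual_isCooperadHom.counit, ← eilIso_comp_eilQuot]
    rfl

/-- The laws descend along the surjection from `ACGr`, so the operad laws for grafting are not
needed. -/
theorem lieDual_isCooperad [CharZero 𝕜] : (lieDual 𝕜).IsCooperad :=
  .of_surjective (ACGr_isCooperad 𝕜) toLieDual_isCooperadHom fun _ _ => toLieDual_surjective

/-- The inner counit of `ACGr` is averaging, which the anti-symmetric map `toLieDual` does not see.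
-/
theorem lieDual_isCounital [CharZero 𝕜] : (lieDual 𝕜).IsCounital :=
  .of_surjective toLieDual_isCooperadHom (fun _ _ => toLieDual_surjective)
    (fun S _ => ACGr_outerCounit S) fun S _ => by
      rw [ACGr_innerCounit]
      refine gr_hom_ext fun G => ?_
      rw [LinearMap.comp_apply, avgHom_grOf, toLieDual_avgOf, toLieDual_grOf]

theorem eilCooperad_isCooperad [CharZero 𝕜] : (eilCooperad 𝕜).IsCooperad :=
  .of_surjective (ACGr_isCooperad 𝕜) eilQuot_isCooperadHom fun _ _ => eilQuot_surjective

theorem eilCooperad_isCounital [CharZero 𝕜] : (eilCooperad 𝕜).IsCounital :=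
  .of_surjective eilQuot_isCooperadHom (fun _ _ => eilQuot_surjective)
    (fun S _ => ACGr_outerCounit S) fun S _ => by
      rw [ACGr_innerCounit]
      refine gr_hom_ext fun G => ?_
      rw [LinearMap.comp_apply, avgHom_grOf]
      exact SGraph.linearCombination_avg ((eilQuot 𝕜).app S) (fun G a b => eilOf_rev_singleton G a b) G

end EilIso

end GraphCooperad

end

open GraphCooperad in
theorem mainTheorem3 (𝕜 : Type u) [Field 𝕜] [CharZero 𝕜] :
    (ACGr 𝕜).IsCooperad ∧
    ((lieDual 𝕜).IsCooperad ∧ (lieDual 𝕜).IsCounital) ∧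
    ∃ E : CooperadStr (Eil 𝕜),
      IsCooperadHom (ACGr 𝕜) E (eilQuot 𝕜) ∧ E.IsCooperad ∧ E.IsCounital ∧
      ∃ φ : SymSeq.Hom (Eil 𝕜) (Lie 𝕜).dual,
        (∀ (S : Type) [Finite S], Function.Bijective (φ.app S)) ∧
        IsCooperadHom E (lieDual 𝕜) φ ∧
        IsCooperadHom (ACGr 𝕜) (lieDual 𝕜) (φ.comp (eilQuot 𝕜)) ∧
        ∀ (S : Type) [Finite S], Function.Surjective ((φ.comp (eilQuot 𝕜)).app S) := by
  refine ⟨ACGr_isCooperad 𝕜, ⟨lieDual_isCooperad, lieDual_isCounital⟩, eilCooperad 𝕜,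
    eilQuot_isCooperadHom, eilCooperad_isCooperad, eilCooperad_isCounital, eilIso 𝕜,
    fun _ _ => eilIso_bijective, eilIso_isCooperadHom, ?_, fun S _ => ?_⟩
  · rw [eilIso_comp_eilQuot]
    exact toLieDual_isCooperadHom
  · rw [eilIso_comp_eilQuot]
    exact toLieDual_surjective
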